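/- Let $p>0$. For $j\ge 1$ let $\lambda_j$ be the root of $p\sin(\pi\lambda)+\lambda\cos(\pi\lambda)=0$ in $(j-\tfrac12,j)$ (these are all the positive roots), and put $$\sigma(t)=\frac{p+t}{p-t},\qquad w_j=\frac{p^2+\lambda_j^2}{p\left(p+\frac1\pi\right)+\lambda_j^2}.$$ For real $t$, the quantity $1/(\sigma(t)e^{2\pi t}-1)$ is understood to be $0$ at the pole $t=p$ of $\sigma$. Let Koshliakov's zeta function be $$\eta_p(s)=\sum_{k=1}^\infty\frac{(s,2\pi pk)_k}{k^s}\quad(\operatorname{Re}(s)>1),\qquad (s,\nu k)_k=\frac1{\Gamma(s)}\int_0^\infty e^{-x}\left(\frac{k\nu-x}{k\nu+x}\right)^k x^{s-1}\,dx .$$ Theorem ($p$-analogue of an identity of Ramanujan). Let $\alpha,\beta>0$ with $\alpha\beta=4\pi^2$, and let $n\in\mathbb{C}$ with $\operatorname{Re}(n)>2$. Then the series $\eta_p(n)$ and the two series over $j$ below converge absolutely, the principal value integral below exists, and $$\alpha^{n/2}\left(\frac{\Gamma(n)\eta_p(n)}{(2\pi)^n}+\cos\left(\frac{\pi n}2\right)\sum_{j=1}^\infty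 w_j\frac{\lambda_j^{n-1}}{\sigma\left(\frac{\alpha\lambda_j}{2\pi}\right)e^{\alpha\lambda_j}-1}\right)$$ $$=\beta^{n/2}\Bigg(\cos\left(\frac{\pi n}2\right)\frac{\Gamma(n)\eta_p(n)}{(2\pi)^n}+\sum_{j=1}^\infty w_j\frac{\lambda_j^{n-1}}{\sigma\left(\frac{\beta\lambda_j}{2\pi}\right)e^{\beta\lambda_j}-1}$$ $$-i\sin\left(\frac{\pi n}2\right)\mathrm{P.V.}\!\int_0^\infty\frac{z^{n-1}}{\sigma(z)e^{2\pi z}-1}\cdot\frac{\sigma\left(-\frac{i\beta z}{2\pi}\right)e^{-i\beta z}-\sigma\left(\frac{i\beta z}{2\pi}\right)e^{i\beta z}}{\left(\sigma\left(\frac{i\beta z}{2\pi}\right)e^{i\beta z}-1\right)\left(\sigma\left(-\frac{i\beta z}{2\pi}\right)e^{-i\beta z}-1\right)}\,dz\Bigg).$$ Here the principal value is the limit as $\varepsilon\to0^+$ of the (absolutely convergent) integral over $(0,\infty)$ with the closed $\varepsilon$-neighbourhoods of all the poles $z=2\pi\lambda_j/\beta$, $j\ge1$, removed. -/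

import Mathlib

open Set Filter Topology MeasureTheory

noncomputable section

namespace Koshliakov

/-- The transcendental equation `p sin (π x) + x cos (π x) = 0`. -/
def IsRoot (p x : ℝ) : Prop := p * Real.sin (Real.pi * x) + x * Real.cos (Real.pi * x) = 0

theorem isRoot_iff_shift (p x : ℝ) (j : ℕ) :
    IsRoot p x ↔ p * Real.sin (Real.pi * (x - j)) + x * Real.cos (Real.pi * (x - j)) = 0 := by
  have e : Real.pi * (x - j) = Real.pi * x - j * Real.pi := by ring
  rw [e, Real.sin_sub_nat_mul_pi, Real.cos_sub_nat_mul_pi, IsRoot]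
  have h : ((-1 : ℝ)) ^ j ≠ 0 := pow_ne_zero _ (by norm_num)
  constructor
  · intro hx
    linear_combination (-1 : ℝ) ^ j * hx
  · intro hx
    apply (mul_eq_zero.1 (_ : (-1 : ℝ) ^ j * _ = 0)).resolve_left h
    linear_combination hx

/-- For `p > 0` and `j ≥ 1`, the root `λ_j` of `p sin (π x) + x cos (π x) = 0` in the interval
`(j - 1/2, j)`; see `lam_spec`, `lam_unique` and `exists_lam_eq`. -/
def lam (p : ℝ) (j : ℕ) : ℝ :=
  Classical.epsilon fun x : ℝ => (j : ℝ) - 1 / 2 < x ∧ x < j ∧ IsRoot p x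

theorem lam_spec {p : ℝ} (hp : 0 < p) {j : ℕ} (hj : 1 ≤ j) :
    (j : ℝ) - 1 / 2 < lam p j ∧ lam p j < j ∧ IsRoot p (lam p j) := by
  apply Classical.epsilon_spec (p := fun x : ℝ => (j : ℝ) - 1 / 2 < x ∧ x < j ∧ IsRoot p x)
  have hj' : (1 : ℝ) ≤ j := by exact_mod_cast hj
  let g : ℝ → ℝ := fun x =>
    p * Real.sin (Real.pi * (x - j)) + x * Real.cos (Real.pi * (x - j))
  have hg : ContinuousOn g (Icc ((j : ℝ) - 1 / 2) j) := by
    apply Continuous.continuousOn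
    fun_prop
  have h1 : g ((j : ℝ) - 1 / 2) = -p := by
    have e : Real.pi * ((j : ℝ) - 1 / 2 - j) = -(Real.pi / 2) := by ring
    simp only [g, e, Real.sin_neg, Real.cos_neg, Real.sin_pi_div_two, Real.cos_pi_div_two]
    ring
  have h2 : g (j : ℝ) = j := by simp [g]
  obtain ⟨x, hx, hx0⟩ := intermediate_value_Ioo (by linarith : (j : ℝ) - 1 / 2 ≤ j) hg
    (show (0 : ℝ) ∈ Ioo (g ((j : ℝ) - 1 / 2)) (g j) by
      rw [h1, h2]
      exact ⟨by linarith, by linarith⟩)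
  exact ⟨x, hx.1, hx.2, (isRoot_iff_shift p x j).2 hx0⟩

theorem root_unique {p : ℝ} (hp : 0 < p) {j : ℕ} {x y : ℝ}
    (hx : (j : ℝ) - 1 / 2 < x) (hxj : x < j) (hxr : IsRoot p x)
    (hy : (j : ℝ) - 1 / 2 < y) (hyj : y < j) (hyr : IsRoot p y) : x ≤ y := by
  by_contra! h
  rw [isRoot_iff_shift p _ j] at hxr hyr
  have hpi := Real.pi_pos
  have cx : 0 < Real.cos (Real.pi * (x - j)) :=
    Real.cos_pos_of_mem_Ioo ⟨by nlinarith, by nlinarith⟩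
  have cy : 0 < Real.cos (Real.pi * (y - j)) :=
    Real.cos_pos_of_mem_Ioo ⟨by nlinarith, by nlinarith⟩
  have s : 0 < Real.sin (Real.pi * (x - j) - Real.pi * (y - j)) :=
    Real.sin_pos_of_pos_of_lt_pi (by nlinarith) (by nlinarith)
  rw [Real.sin_sub] at s
  have key : p * (Real.sin (Real.pi * (x - j)) * Real.cos (Real.pi * (y - j)) -
      Real.cos (Real.pi * (x - j)) * Real.sin (Real.pi * (y - j))) =
      -((x - y) * (Real.cos (Real.pi * (x - j)) * Real.cos (Real.pi * (y - j)))) := by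
    linear_combination Real.cos (Real.pi * (y - j)) * hxr - Real.cos (Real.pi * (x - j)) * hyr
  have h1 := mul_pos hp s
  have h2 := mul_pos (sub_pos.2 h) (mul_pos cx cy)
  linarith

theorem lam_unique {p : ℝ} (hp : 0 < p) {j : ℕ} (hj : 1 ≤ j) {x : ℝ}
    (hx : (j : ℝ) - 1 / 2 < x) (hxj : x < j) (hxr : IsRoot p x) : x = lam p j := by
  obtain ⟨h1, h2, h3⟩ := lam_spec hp hj
  exact le_antisymm (root_unique hp hx hxj hxr h1 h2 h3) (root_unique hp h1 h2 h3 hx hxj hxr)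

/-- The numbers `λ_1 < λ_2 < …` are all the positive roots. -/
theorem exists_lam_eq {p : ℝ} (hp : 0 < p) {x : ℝ} (hx : 0 < x) (hxr : IsRoot p x) :
    ∃ j : ℕ, 1 ≤ j ∧ x = lam p j := by
  have hpi := Real.pi_pos
  have hj : 1 ≤ ⌈x⌉₊ := Nat.one_le_ceil_iff.2 hx
  have h1 : x ≤ ⌈x⌉₊ := Nat.le_ceil x
  have h2 : (⌈x⌉₊ : ℝ) < x + 1 := Nat.ceil_lt_add_one hx.le
  have hr := (isRoot_iff_shift p x ⌈x⌉₊).1 hxr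
  refine ⟨⌈x⌉₊, hj, lam_unique hp hj ?_ ?_ hxr⟩
  · by_contra! h
    have s : Real.sin (Real.pi * (x - ⌈x⌉₊)) < 0 :=
      Real.sin_neg_of_neg_of_neg_pi_lt (by nlinarith) (by nlinarith)
    have c : Real.cos (Real.pi * (x - ⌈x⌉₊)) ≤ 0 := by
      rw [← Real.cos_neg]
      exact Real.cos_nonpos_of_pi_div_two_le_of_le (by nlinarith) (by nlinarith)
    nlinarith [mul_neg_of_pos_of_neg hp s, mul_nonpos_of_nonneg_of_nonpos hx.le c]
  · refine lt_of_le_of_ne h1 fun h => ?_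
    rw [← h] at hr
    simp at hr
    exact hx.ne' hr

/-- The weight `(p² + λ_j²) / (p (p + 1/π) + λ_j²)`. -/
def weight (p : ℝ) (j : ℕ) : ℝ :=
  (p ^ 2 + lam p j ^ 2) / (p * (p + 1 / Real.pi) + lam p j ^ 2)

/-- `σ(t) = (p + t) / (p - t)`. -/
def sigma (p : ℝ) (t : ℂ) : ℂ := (p + t) / (p - t)

/-- `1 / (σ(t) e^{2πt} - 1)` for real `t`, with its limit value `0` at the pole `t = p` of `σ`. -/
def kernel (p t : ℝ) : ℂ :=
  if t = p then 0 else 1 / (sigma p t * Complex.exp (2 * Real.pi * t) - 1)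

/-- `kernel` in a form without a case distinction. -/
theorem kernel_eq (p t : ℝ) :
    kernel p t = (p - t) / ((p + t) * Complex.exp (2 * Real.pi * t) - (p - t)) := by
  unfold kernel sigma
  split_ifs with h
  · simp [h]
  · have h' : (p : ℂ) - t ≠ 0 := by
      rw [← Complex.ofReal_sub]
      exact_mod_cast sub_ne_zero.2 (Ne.symm h)
    rw [div_mul_eq_mul_div, div_sub_one h', one_div_div]

/-- The coefficient `(s, νk)_k = (1/Γ(s)) ∫_0^∞ e^{-x} ((kν - x) / (kν + x))^k x^{s-1} dx`,
with `a` standing for the product `kν`. -/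
def etaCoeff (s : ℂ) (a : ℝ) (k : ℕ) : ℂ :=
  1 / Complex.Gamma s *
    ∫ x in Ioi (0 : ℝ), Complex.exp (-x) * (((a - x) / (a + x) : ℝ) : ℂ) ^ k * (x : ℂ) ^ (s - 1)

/-- The integrals in `etaCoeff` converge absolutely for `Re s > 0` and `a > 0`. -/
theorem etaCoeff_integrable {s : ℂ} (hs : 0 < s.re) {a : ℝ} (ha : 0 < a) (k : ℕ) :
    IntegrableOn (fun x : ℝ =>
      Complex.exp (-x) * (((a - x) / (a + x) : ℝ) : ℂ) ^ k * (x : ℂ) ^ (s - 1)) (Ioi 0) := by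
  have h := (Complex.GammaIntegral_convergent hs).bdd_mul (c := 1)
    (f := fun x : ℝ => (((a - x) / (a + x) : ℝ) : ℂ) ^ k)
    (by
      apply Measurable.aestronglyMeasurable
      fun_prop)
    (by
      refine (ae_restrict_mem measurableSet_Ioi).mono fun x hx => ?_
      have hx' : (0 : ℝ) < x := hx
      rw [norm_pow, Complex.norm_real]
      refine pow_le_one₀ (norm_nonneg _) ?_
      rw [Real.norm_eq_abs, abs_div, abs_of_pos (by linarith : 0 < a + x)]
      rw [div_le_one (by linarith), abs_le]
      constructor <;> linarith)
  refine h.congr (Eventually.of_forall fun x => ?_)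
  push_cast
  ring

/-- The `k`-th term `(s, 2πpk)_k / k^s` of Koshliakov's zeta function `η_p(s)`. -/
def etaTerm (p : ℝ) (s : ℂ) (k : ℕ) : ℂ :=
  etaCoeff s (2 * Real.pi * p * k) k / (k : ℂ) ^ s

/-- Koshliakov's zeta function `η_p(s) = ∑_{k ≥ 1} (s, 2πpk)_k / k^s`, for `Re s > 1`. -/
def eta (p : ℝ) (s : ℂ) : ℂ := ∑' k : ℕ, etaTerm p s (k + 1)

/-- The term `w_j λ_j^{n-1} / (σ(αλ_j / 2π) e^{αλ_j} - 1)`. -/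
def seriesTerm (p α : ℝ) (n : ℂ) (j : ℕ) : ℂ :=
  weight p j * ((lam p j : ℂ) ^ (n - 1) * kernel p (α * lam p j / (2 * Real.pi)))

/-- The integrand of the principal value integral. -/
def pvIntegrand (p β : ℝ) (n : ℂ) (z : ℝ) : ℂ :=
  (z : ℂ) ^ (n - 1) * kernel p z *
    ((sigma p (-(Complex.I * β * z / (2 * Real.pi))) * Complex.exp (-(Complex.I * β * z)) -
        sigma p (Complex.I * β * z / (2 * Real.pi)) * Complex.exp (Complex.I * β * z)) /
      ((sigma p (Complex.I * β * z / (2 * Real.pi)) * Complex.exp (Complex.I * β * z) - 1) *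
        (sigma p (-(Complex.I * β * z / (2 * Real.pi))) * Complex.exp (-(Complex.I * β * z)) - 1)))

/-- The singularities `2πλ_j / β`, `j ≥ 1`, of `pvIntegrand` on `(0, ∞)`. -/
def pvPoles (p β : ℝ) : Set ℝ := {z | ∃ j : ℕ, 1 ≤ j ∧ z = 2 * Real.pi * lam p j / β}

/-- `I` is the Cauchy principal value of `∫_0^∞ f` with respect to the singular points `S`:
`f` is integrable over `(0, ∞)` with closed `ε`-neighbourhoods of the points of `S` removed,
for all small `ε > 0`, and these integrals tend to `I` as `ε → 0+`. -/
def HasPVIntegral (f : ℝ → ℂ) (S : Set ℝ) (I : ℂ) : Prop :=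
  (∀ᶠ ε in 𝓝[>] (0 : ℝ), IntegrableOn f {x | 0 < x ∧ ∀ s ∈ S, ε < |x - s|}) ∧
  Tendsto (fun ε : ℝ => ∫ x in {x | 0 < x ∧ ∀ s ∈ S, ε < |x - s|}, f x) (𝓝[>] 0) (𝓝 I)

end Koshliakov

end

namespace Koshliakov

/-! The two functions behind the identity are `kerC` = 1/(E - 1) and `cothC` = (E + 1)/(E - 1) with
E(u) = σ(u)e^{2πu}. Since E(-u) = 1/E(u), `cothC` is odd, and it equals 1 + 2 `kerC`. All zeros of
`den` lie on the imaginary axis; the nonzero ones are ±iλ_j, and the weights w_j come from the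
residues there.

Put b = β/(2π), so that α/(2π) = 1/b. The principal value integrand is f_b(z) = z^{n-1} `kerC`(z)
`cothC`(ibz), whose poles in the right half-plane are the real points λ_j/b. Pushing the contour to
the ray arg z = π/4 costs half of each residue, so P.V. = R⁺(b) + πi Σ res, where R^±(b) is the
integral along the ray arg z = ±π/4 (`tendsto_integral_pvFun`). Complex conjugation gives P.V. =
R⁻(b) - πi Σ res (`tendsto_integral_pvFun_below`). The sum πi Σ res is b^{-n} times the series with
parameter α (`tsum_res`).

The modular step is `rayInt_functional`: on the lower ray write z = -iy with y on the upper ray.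
Then `cothC`(ibz) = 1 + 2 `kerC`(by), and 2 `kerC`(-iy) = -(1 + `cothC`(iy)), so the two factors
exchange roles and w = by yields R⁻(b) = A - b^{-n} e^{-iπn/2} (A + R⁺(1/b)). Here A is the Mellin
transform of the kernel, which equals Γ(n)η_p(n)/(2π)^n by expanding the kernel in a geometric
series (`Gamma_mul_eta`). Writing the contour relations and the functional equation for both b and
1/b and eliminating the ray integrals gives the theorem by linear algebra.

The analytic work is in the half-residue formula with infinitely many poles. The half-line is cut at
the points j/b, one pole per block. On each block Cauchy's theorem is applied in the coordinate s =
log z (`block_contour`); the arcs telescope and vanish at 0 and at infinity. For the principal value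
itself, the principal part is subtracted block by block: the remainder is absolutely integrable
(`norm_pvFun_sub_prin_le`), and the integral of each principal part outside a symmetric
neighbourhood of its pole does not depend on ε (`integral_prin_block`). The condition Re n > 2 makes
f_b, of size |z|^{Re n - 3} near 0, integrable there. -/

/-- The denominator `(p + u) e^{2πu} - (p - u)`. -/
noncomputable def den (p : ℝ) (u : ℂ) : ℂ :=
  (p + u) * Complex.exp (2 * Real.pi * u) - (p - u)

/-- The meromorphic extension of `kernel`. -/
noncomputable def kerC (p : ℝ) (u : ℂ) : ℂ := (p - u) / den p u

/-- `(σ(u) e^{2πu} + 1) / (σ(u) e^{2πu} - 1)`, an analogue of `coth (πu)`. -/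
noncomputable def cothC (p : ℝ) (u : ℂ) : ℂ :=
  ((p + u) * Complex.exp (2 * Real.pi * u) + (p - u)) / den p u

/-! ### Symmetries, zeros and bounds of the kernel and its coth analogue -/

theorem kernel_eq_kerC (p t : ℝ) : kernel p t = kerC p t := kernel_eq p t

theorem den_neg (p : ℝ) (u : ℂ) :
    den p (-u) = -(Complex.exp (-(2 * Real.pi * u)) * den p u) := by
  have h : Complex.exp (-(2 * Real.pi * u)) * Complex.exp (2 * Real.pi * u) = 1 := by
    rw [← Complex.exp_add]; simp
  have h2 : (2 : ℂ) * Real.pi * -u = -(2 * Real.pi * u) := by ring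
  unfold den
  rw [h2]
  linear_combination (p + u) * h

theorem den_neg_ne_zero {p : ℝ} {u : ℂ} (h : den p u ≠ 0) : den p (-u) ≠ 0 := by
  rw [den_neg]
  exact neg_ne_zero.2 (mul_ne_zero (Complex.exp_ne_zero _) h)

/-- Passing from u to -u inverts E = σ(u)e^{2πu}, and (E + 1)/(E - 1) is odd under E ↦ 1/E. This
oddness drives both the functional equation and the passage from the upper to the lower ray. -/
theorem cothC_neg (p : ℝ) (u : ℂ) : cothC p (-u) = -cothC p u := by
  have h : Complex.exp (-(2 * Real.pi * u)) * Complex.exp (2 * Real.pi * u) = 1 := by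
    rw [← Complex.exp_add]; simp
  have h2 : (2 : ℂ) * Real.pi * -u = -(2 * Real.pi * u) := by ring
  unfold cothC
  rw [den_neg, h2]
  have h3 : ((p : ℂ) + -u) * Complex.exp (-(2 * Real.pi * u)) + (p - -u) =
      Complex.exp (-(2 * Real.pi * u)) *
        ((p + u) * Complex.exp (2 * Real.pi * u) + (p - u)) := by
    linear_combination (-(p + u)) * h
  rw [h3, div_neg, mul_div_mul_left _ _ (Complex.exp_ne_zero _)]

theorem cothC_eq {p : ℝ} {u : ℂ} (h : den p u ≠ 0) : cothC p u = 1 + 2 * kerC p u := by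
  unfold cothC kerC
  have h1 : (p - u) / den p u * den p u = p - u := div_mul_cancel₀ _ h
  have h2 : den p u = (p + u) * Complex.exp (2 * Real.pi * u) - (p - u) := rfl
  rw [div_eq_iff h]
  linear_combination (-2) * h1 - h2

theorem norm_sub_le_norm_add {p : ℝ} (hp : 0 < p) {u : ℂ} (hu : 0 < u.re) :
    ‖(p : ℂ) - u‖ ≤ ‖(p : ℂ) + u‖ := by
  rw [Complex.norm_def, Complex.norm_def]
  apply Real.sqrt_le_sqrt
  simp only [Complex.normSq_apply, Complex.sub_re, Complex.add_re, Complex.sub_im, Complex.add_im,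
    Complex.ofReal_re, Complex.ofReal_im]
  nlinarith [mul_pos hp hu]

theorem norm_exp_two_pi_mul (u : ℂ) :
    ‖Complex.exp (2 * Real.pi * u)‖ = Real.exp (2 * Real.pi * u.re) := by
  rw [Complex.norm_exp]
  congr 1
  simp [Complex.mul_re]

/-- In the right half-plane |p - u| ≤ |p + u|, so the exponential term dominates. Consequently `den`
has no zeros there, and by reflection none in the left half-plane either: all zeros are on the
imaginary axis. -/
theorem norm_den_ge {p : ℝ} (hp : 0 < p) {u : ℂ} (hu : 0 < u.re) :
    ‖(p : ℂ) + u‖ * (Real.exp (2 * Real.pi * u.re) - 1) ≤ ‖den p u‖ := by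
  have h1 := norm_sub_norm_le (((p : ℂ) + u) * Complex.exp (2 * Real.pi * u)) (p - u)
  rw [norm_mul, norm_exp_two_pi_mul] at h1
  have h2 := norm_sub_le_norm_add hp hu
  unfold den
  linarith

theorem norm_add_pos {p : ℝ} (hp : 0 < p) {u : ℂ} (hu : 0 < u.re) : 0 < ‖(p : ℂ) + u‖ := by
  rw [norm_pos_iff]
  intro h
  have := congrArg Complex.re h
  simp at this
  linarith

theorem den_ne_zero {p : ℝ} (hp : 0 < p) {u : ℂ} (hu : 0 < u.re) : den p u ≠ 0 := by
  rw [← norm_pos_iff]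
  refine lt_of_lt_of_le (mul_pos (norm_add_pos hp hu) ?_) (norm_den_ge hp hu)
  have : 1 < Real.exp (2 * Real.pi * u.re) := Real.one_lt_exp_iff.2 (by positivity)
  linarith

theorem den_ne_zero_of_re_neg {p : ℝ} (hp : 0 < p) {u : ℂ} (hu : u.re < 0) : den p u ≠ 0 := by
  rw [← neg_neg u]
  exact den_neg_ne_zero (den_ne_zero hp (by simpa using hu))

theorem two_mul_exp_le (y : ℝ) (hy : 0 ≤ y) : 2 * y * Real.exp y ≤ Real.exp (2 * y) - 1 := by
  have h1 : y ≤ Real.sinh y := Real.self_le_sinh_iff.2 hy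
  rw [Real.sinh_eq] at h1
  have h2 : Real.exp (2 * y) = Real.exp y * Real.exp y := by rw [← Real.exp_add]; ring_nf
  have h3 : Real.exp (-y) * Real.exp y = 1 := by rw [← Real.exp_add]; simp
  nlinarith [Real.exp_pos y]

/-- The inequality e^{2y} - 1 ≥ 2y e^y, with y = π Re u, keeps in a single bound the 1/Re u blow-up
at the imaginary axis and exponential decay at infinity. -/
theorem norm_kerC_le {p : ℝ} (hp : 0 < p) {u : ℂ} (hu : 0 < u.re) :
    ‖kerC p u‖ ≤ Real.exp (-(Real.pi * u.re)) / (2 * Real.pi * u.re) := by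
  have hpi := Real.pi_pos
  have h1 := norm_den_ge hp hu
  have h2 := norm_sub_le_norm_add hp hu
  have h3 := two_mul_exp_le (Real.pi * u.re) (by positivity)
  have h0 := norm_add_pos hp hu
  rw [show 2 * (Real.pi * u.re) = 2 * Real.pi * u.re by ring] at h3
  unfold kerC
  rw [norm_div, Real.exp_neg, div_le_div_iff₀ (norm_pos_iff.2 (den_ne_zero hp hu)) (by positivity)]
  have h4 : ‖(p : ℂ) + u‖ * (2 * Real.pi * u.re * Real.exp (Real.pi * u.re)) ≤ ‖den p u‖ := by
    refine le_trans ?_ h1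
    gcongr
  have h5 : ‖(p : ℂ) - u‖ * (2 * Real.pi * u.re * Real.exp (Real.pi * u.re)) ≤ ‖den p u‖ :=
    le_trans (by gcongr) h4
  rw [inv_mul_eq_div, le_div_iff₀ (Real.exp_pos _)]
  linarith

theorem differentiable_den (p : ℝ) : Differentiable ℂ (den p) := by
  unfold den
  fun_prop

theorem differentiableAt_kerC {p : ℝ} {u : ℂ} (h : den p u ≠ 0) : DifferentiableAt ℂ (kerC p) u := by
  unfold kerC
  exact DifferentiableAt.div (by fun_prop) (differentiable_den p u) h

theorem measurable_kerC (p : ℝ) : Measurable (kerC p) := by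
  unfold kerC den
  fun_prop

theorem measurable_cothC (p : ℝ) : Measurable (cothC p) := by
  unfold cothC den
  fun_prop

theorem den_conj (p : ℝ) (u : ℂ) : den p (starRingEnd ℂ u) = starRingEnd ℂ (den p u) := by
  simp [den, ← Complex.exp_conj, Complex.conj_ofNat]

theorem kerC_conj (p : ℝ) (u : ℂ) : kerC p (starRingEnd ℂ u) = starRingEnd ℂ (kerC p u) := by
  simp [kerC, den_conj]

theorem cothC_conj (p : ℝ) (u : ℂ) : cothC p (starRingEnd ℂ u) = starRingEnd ℂ (cothC p u) := by
  simp [cothC, den_conj, ← Complex.exp_conj, Complex.conj_ofNat]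

/-- On the imaginary axis `den` is the function of the transcendental equation. -/
theorem den_I_mul (p w : ℝ) : den p (Complex.I * w) =
    2 * Complex.I * Complex.exp (Complex.I * (Real.pi * w)) *
      ((p * Real.sin (Real.pi * w) + w * Real.cos (Real.pi * w) : ℝ) : ℂ) := by
  have h1 : Complex.exp (2 * Real.pi * (Complex.I * w)) =
      Complex.exp (Complex.I * (Real.pi * w)) * Complex.exp (Complex.I * (Real.pi * w)) := by
    rw [← Complex.exp_add]; ring_nf
  have h2 : Complex.exp (-(Complex.I * (Real.pi * w))) *
      Complex.exp (Complex.I * (Real.pi * w)) = 1 := by rw [← Complex.exp_add]; simp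
  unfold den
  push_cast
  rw [h1, Complex.sin, Complex.cos, mul_comm (Real.pi * (w : ℂ)) Complex.I,
    neg_mul, mul_comm (Real.pi * (w : ℂ)) Complex.I]
  set E := Complex.exp (Complex.I * (Real.pi * w))
  set F := Complex.exp (-(Complex.I * (Real.pi * w)))
  linear_combination ((p : ℂ) - Complex.I * w) * h2 - (E * F - E ^ 2) * p * Complex.I_sq

/-- On the imaginary axis `cothC` is -i times a real cotangent-like function, so estimates of the
integrand on the positive axis become real trigonometry. -/
theorem cothC_I_mul (p w : ℝ) : cothC p (Complex.I * w) =
    -Complex.I * (((p * Real.cos (Real.pi * w) - w * Real.sin (Real.pi * w)) /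
      (p * Real.sin (Real.pi * w) + w * Real.cos (Real.pi * w)) : ℝ) : ℂ) := by
  have h1 : Complex.exp (2 * Real.pi * (Complex.I * w)) =
      Complex.exp (Complex.I * (Real.pi * w)) * Complex.exp (Complex.I * (Real.pi * w)) := by
    rw [← Complex.exp_add]; ring_nf
  have h2 : Complex.exp (-(Complex.I * (Real.pi * w))) *
      Complex.exp (Complex.I * (Real.pi * w)) = 1 := by rw [← Complex.exp_add]; simp
  have h3 : ((p : ℂ) + Complex.I * w) * Complex.exp (2 * Real.pi * (Complex.I * w)) +
      (p - Complex.I * w) = (2 * Complex.exp (Complex.I * (Real.pi * w))) *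
      ((p * Real.cos (Real.pi * w) - w * Real.sin (Real.pi * w) : ℝ) : ℂ) := by
    push_cast
    rw [h1, Complex.sin, Complex.cos, mul_comm (Real.pi * (w : ℂ)) Complex.I,
      neg_mul, mul_comm (Real.pi * (w : ℂ)) Complex.I]
    set E := Complex.exp (Complex.I * (Real.pi * w))
    set F := Complex.exp (-(Complex.I * (Real.pi * w)))
    linear_combination (-(p : ℂ) + Complex.I * w) * h2
  have hE : 2 * Complex.exp (Complex.I * (Real.pi * w)) ≠ 0 := by
    simp [Complex.exp_ne_zero]
  unfold cothC
  rw [den_I_mul, h3]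
  have : 2 * Complex.I * Complex.exp (Complex.I * (Real.pi * w)) *
      ((p * Real.sin (Real.pi * w) + w * Real.cos (Real.pi * w) : ℝ) : ℂ) =
      (2 * Complex.exp (Complex.I * (Real.pi * w))) * (Complex.I *
      ((p * Real.sin (Real.pi * w) + w * Real.cos (Real.pi * w) : ℝ) : ℂ)) := by ring
  rw [this, mul_div_mul_left _ _ hE, Complex.ofReal_div, div_mul_eq_div_div, Complex.div_I]
  ring

theorem den_I_mul_eq_zero_iff (p w : ℝ) : den p (Complex.I * w) = 0 ↔ IsRoot p w := by
  rw [den_I_mul, IsRoot]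
  simp only [mul_eq_zero, Complex.exp_ne_zero, Complex.I_ne_zero, or_false, false_or,
    OfNat.ofNat_ne_zero]
  norm_cast

/-! ### Decay and contour shifts in the coordinate s = log z -/

/-- This is the bound for z^c e^{-z} at z = e^x: the power decays as x → -∞, the double exponential
wins as x → +∞. The two-sided form e^{-δ|x|} serves both integrability and vanishing arcs. -/
theorem exp_mul_exp_neg_exp_le {c : ℝ} (hc : 0 < c) :
    ∃ δ > 0, ∃ M > 0, ∀ x : ℝ,
      Real.exp (c * x) * Real.exp (-Real.exp x) ≤ M * Real.exp (-(δ * |x|)) := by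
  -- The Taylor term e^{kx}/k! bounds e^{e^x} from below; k ≥ c + 1 leaves a spare factor e^{-x}.
  obtain ⟨k, hk⟩ := exists_nat_ge (c + 1)
  refine ⟨min c 1, by positivity, k.factorial, by positivity, fun x => ?_⟩
  have hk1 : (1 : ℝ) ≤ k.factorial := by exact_mod_cast Nat.one_le_iff_ne_zero.2 k.factorial_ne_zero
  rcases le_total x 0 with hx | hx
  · rw [abs_of_nonpos hx]
    have h1 : Real.exp (c * x) ≤ Real.exp (-(min c 1 * -x)) := by
      apply Real.exp_le_exp.2
      nlinarith [min_le_left c 1]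
    have h2 : Real.exp (-Real.exp x) ≤ 1 := Real.exp_le_one_iff.2 (by
      have := Real.exp_pos x; linarith)
    calc _ ≤ Real.exp (-(min c 1 * -x)) * 1 := by gcongr
      _ = 1 * Real.exp (-(min c 1 * -x)) := by ring
      _ ≤ _ := by gcongr
  · rw [abs_of_nonneg hx]
    have h1 := Real.pow_div_factorial_le_exp (Real.exp x) (Real.exp_pos x).le k
    rw [div_le_iff₀ (by positivity), ← Real.exp_nat_mul] at h1
    have h2 : Real.exp (c * x) ≤ Real.exp (k * x) * Real.exp (-(min c 1 * x)) := by
      rw [← Real.exp_add]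
      apply Real.exp_le_exp.2
      nlinarith [min_le_right c 1]
    calc _ ≤ Real.exp (k * x) * Real.exp (-(min c 1 * x)) * Real.exp (-Real.exp x) := by gcongr
      _ ≤ (Real.exp (Real.exp x) * k.factorial) * Real.exp (-(min c 1 * x)) *
          Real.exp (-Real.exp x) := by gcongr
      _ = (Real.exp (Real.exp x) * Real.exp (-Real.exp x)) *
          (k.factorial * Real.exp (-(min c 1 * x))) := by ring
      _ = _ := by rw [← Real.exp_add]; simp

theorem integrable_exp_neg_mul_abs {δ : ℝ} (hδ : 0 < δ) :
    Integrable (fun x : ℝ => Real.exp (-(δ * |x|))) := by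
  rw [← integrableOn_univ, ← Iic_union_Ioi (a := (0 : ℝ))]
  refine IntegrableOn.union ?_ ?_
  · refine (integrableOn_exp_mul_Iic hδ 0).congr_fun (fun x hx => ?_) measurableSet_Iic
    simp [abs_of_nonpos (show x ≤ 0 from hx)]
  · refine (integrableOn_exp_mul_Ioi (neg_lt_zero.2 hδ) 0).congr_fun (fun x hx => ?_)
      measurableSet_Ioi
    simp [abs_of_pos (show 0 < x from hx)]

/-- Shifting a horizontal line of integration. -/
theorem integral_horizontal_line_eq {G : ℂ → ℂ} {φ₁ φ₂ δ M : ℝ} (hδ : 0 < δ)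
    (hd : ∀ s : ℂ, s.im ∈ uIcc φ₁ φ₂ → DifferentiableAt ℂ G s)
    (hb : ∀ s : ℂ, s.im ∈ uIcc φ₁ φ₂ → ‖G s‖ ≤ M * Real.exp (-(δ * |s.re|))) :
    ∫ x : ℝ, G (x + φ₁ * Complex.I) = ∫ x : ℝ, G (x + φ₂ * Complex.I) := by
  have hint : ∀ φ ∈ uIcc φ₁ φ₂, Integrable (fun x : ℝ => G (x + φ * Complex.I)) := by
    intro φ hφ
    refine ((integrable_exp_neg_mul_abs hδ).const_mul M).mono' ?_ (Eventually.of_forall fun x => ?_)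
    · apply Continuous.aestronglyMeasurable
      rw [continuous_iff_continuousAt]
      intro x
      have h1 : ContinuousAt G (x + φ * Complex.I) := (hd _ (by simpa using hφ)).continuousAt
      exact ContinuousAt.comp (f := fun x : ℝ => (x : ℂ) + φ * Complex.I) h1 (by fun_prop)
    · simpa using hb (x + φ * Complex.I) (by simpa using hφ)
  have hlim : ∀ φ ∈ uIcc φ₁ φ₂, Tendsto (fun T : ℝ => ∫ x in (-T)..T, G (x + φ * Complex.I)) atTop
      (𝓝 (∫ x : ℝ, G (x + φ * Complex.I))) := fun φ hφ =>
    intervalIntegral_tendsto_integral (hint φ hφ) tendsto_neg_atTop_atBot tendsto_id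
  have hexp : Tendsto (fun T : ℝ => M * Real.exp (-(δ * |T|)) * |φ₂ - φ₁|) atTop (𝓝 0) := by
    have h1 : Tendsto (fun T : ℝ => Real.exp (-(δ * |T|))) atTop (𝓝 0) :=
      Real.tendsto_exp_neg_atTop_nhds_zero.comp
        ((tendsto_abs_atTop_atTop).const_mul_atTop hδ)
    simpa using (h1.const_mul M).mul_const |φ₂ - φ₁|
  have hV : ∀ ε : ℝ, |ε| = 1 → Tendsto (fun T : ℝ => ∫ y in φ₁..φ₂, G ((ε * T : ℝ) + y * Complex.I))
      atTop (𝓝 0) := by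
    intro ε hε
    refine squeeze_zero_norm (fun T => ?_) hexp
    refine intervalIntegral.norm_integral_le_of_norm_le_const fun y hy => ?_
    have := hb ((ε * T : ℝ) + y * Complex.I) (by simpa using uIoc_subset_uIcc hy)
    simpa [abs_mul, hε] using this
  have hrect : ∀ T : ℝ, (∫ x in (-T)..T, G (x + φ₁ * Complex.I)) -
      (∫ x in (-T)..T, G (x + φ₂ * Complex.I)) +
      Complex.I • (∫ y in φ₁..φ₂, G (((1 : ℝ) * T : ℝ) + y * Complex.I)) -
      Complex.I • (∫ y in φ₁..φ₂, G (((-1 : ℝ) * T : ℝ) + y * Complex.I)) = 0 := by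
    intro T
    have := Complex.integral_boundary_rect_eq_zero_of_differentiableOn G
      (⟨-T, φ₁⟩ : ℂ) ⟨T, φ₂⟩ (fun s hs => (hd s hs.2).differentiableWithinAt)
    simpa using this
  have hlim2 := (((hlim φ₁ left_mem_uIcc).sub (hlim φ₂ right_mem_uIcc)).add
    ((hV 1 (by simp)).const_smul Complex.I)).sub ((hV (-1) (by simp)).const_smul Complex.I)
  simp only [hrect] at hlim2
  have := tendsto_nhds_unique hlim2 tendsto_const_nhds
  simp only [smul_zero, add_zero, sub_zero] at this
  exact sub_eq_zero.1 this

/-! ### Estimates of the integrands in the sector |arg z| ≤ π/4 -/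

theorem norm_cothC_le {p : ℝ} (hp : 0 < p) {u : ℂ} (hu : u.re ≠ 0) :
    ‖cothC p u‖ ≤ 1 + 1 / |u.re| := by
  wlog h : 0 < u.re generalizing u
  · have h' : u.re < 0 := lt_of_le_of_ne (not_lt.1 h) hu
    have := this (u := -u) (by simpa using hu) (by simpa using h')
    rwa [cothC_neg, norm_neg, Complex.neg_re, abs_neg] at this
  rw [cothC_eq (den_ne_zero hp h), abs_of_pos h]
  have h1 := norm_kerC_le hp h
  have h2 : Real.exp (-(Real.pi * u.re)) / (2 * Real.pi * u.re) ≤ 1 / (2 * u.re) := by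
    have hpi := Real.pi_gt_three
    apply div_le_div₀ zero_le_one
    · apply Real.exp_le_one_iff.2; nlinarith
    · linarith
    · nlinarith
  calc ‖1 + 2 * kerC p u‖ ≤ ‖(1 : ℂ)‖ + ‖2 * kerC p u‖ := norm_add_le _ _
    _ = 1 + 2 * ‖kerC p u‖ := by simp
    _ ≤ 1 + 2 * (1 / (2 * u.re)) := by gcongr; linarith
    _ = _ := by field_simp

theorem cos_ge_of_abs_le {φ : ℝ} (h : |φ| ≤ Real.pi / 4) : 7 / 10 ≤ Real.cos φ := by
  have hpi := Real.pi_pos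
  rw [← Real.cos_abs]
  refine le_trans ?_ (Real.cos_le_cos_of_nonneg_of_le_pi (abs_nonneg _) (by linarith) h)
  rw [Real.cos_pi_div_four]
  have : (14 / 10 : ℝ) ≤ Real.sqrt 2 := Real.le_sqrt_of_sq_le (by norm_num)
  linarith

theorem exp_re_ge {s : ℂ} (h : |s.im| ≤ Real.pi / 4) :
    7 / 10 * Real.exp s.re ≤ (Complex.exp s).re := by
  rw [Complex.exp_re, mul_comm]
  gcongr
  exact cos_ge_of_abs_le h

theorem exp_re_pos {s : ℂ} (h : |s.im| ≤ Real.pi / 4) : 0 < (Complex.exp s).re :=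
  lt_of_lt_of_le (by positivity) (exp_re_ge h)

/-- In the sector Re z ≥ (7/10)|z|, and π · 7/10 > 2 turns the decay into e^{-2|z|}. The factor
e^{-Re s} = 1/|z| records the simple pole at 0. -/
theorem norm_kerC_exp_le {p : ℝ} (hp : 0 < p) {s : ℂ} (h : |s.im| ≤ Real.pi / 4) :
    ‖kerC p (Complex.exp s)‖ ≤ Real.exp (-(2 * Real.exp s.re)) * Real.exp (-s.re) := by
  have h1 := exp_re_ge h
  have hpi := Real.pi_gt_three
  have he := Real.exp_pos s.re
  refine (norm_kerC_le hp (exp_re_pos h)).trans ?_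
  rw [Real.exp_neg s.re, ← div_eq_mul_inv]
  apply div_le_div₀ (by positivity) _ he
  · nlinarith
  · apply Real.exp_le_exp.2
    nlinarith

theorem norm_exp_mul_le (n s : ℂ) (h : |s.im| ≤ Real.pi / 4) :
    ‖Complex.exp (n * s)‖ ≤ Real.exp |n.im| * Real.exp (n.re * s.re) := by
  rw [Complex.norm_exp, ← Real.exp_add, Real.exp_le_exp, Complex.mul_re]
  have hpi := Real.pi_le_four
  have : -(n.im * s.im) ≤ |n.im| * |s.im| := by rw [← abs_mul]; exact neg_le_abs _
  nlinarith [abs_nonneg n.im]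

/-- The integrand `z^n / (σ(z) e^{2πz} - 1)` at `z = e^s`. -/
noncomputable def kerExp (p : ℝ) (n s : ℂ) : ℂ := Complex.exp (n * s) * kerC p (Complex.exp s)

/-- `z` times the meromorphic extension of `pvIntegrand` at `z = e^s`. -/
noncomputable def pvExp (p : ℝ) (n : ℂ) (b : ℝ) (s : ℂ) : ℂ :=
  kerExp p n s * cothC p (Complex.I * b * Complex.exp s)

theorem norm_kerExp_le {p : ℝ} (hp : 0 < p) (n : ℂ) {s : ℂ} (h : |s.im| ≤ Real.pi / 4) :
    ‖kerExp p n s‖ ≤ Real.exp |n.im| *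
      (Real.exp ((n.re - 1) * s.re) * Real.exp (-(2 * Real.exp s.re))) := by
  unfold kerExp
  rw [norm_mul]
  calc _ ≤ (Real.exp |n.im| * Real.exp (n.re * s.re)) *
        (Real.exp (-(2 * Real.exp s.re)) * Real.exp (-s.re)) :=
        mul_le_mul (norm_exp_mul_le n s h) (norm_kerC_exp_le hp h) (norm_nonneg _) (by positivity)
    _ = _ := by
      rw [sub_mul, sub_eq_add_neg, Real.exp_add, one_mul]; ring

theorem differentiableAt_kerExp {p : ℝ} (hp : 0 < p) (n : ℂ) {s : ℂ} (h : |s.im| ≤ Real.pi / 4) :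
    DifferentiableAt ℂ (kerExp p n) s := by
  unfold kerExp
  have := (differentiableAt_kerC (den_ne_zero hp (exp_re_pos h))).comp s
    Complex.differentiable_exp.differentiableAt
  exact DifferentiableAt.mul (by fun_prop) this

theorem kerExp_decay {p : ℝ} (hp : 0 < p) {n : ℂ} (hn : 1 < n.re) :
    ∃ δ > 0, ∃ M > 0, ∀ s : ℂ, |s.im| ≤ Real.pi / 4 →
      ‖kerExp p n s‖ ≤ M * Real.exp (-(δ * |s.re|)) := by
  obtain ⟨δ, hδ, M, hM, h⟩ := exp_mul_exp_neg_exp_le (sub_pos.2 hn)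
  refine ⟨δ, hδ, Real.exp |n.im| * M, by positivity, fun s hs => ?_⟩
  refine (norm_kerExp_le hp n hs).trans ?_
  rw [mul_assoc]
  refine mul_le_mul_of_nonneg_left (le_trans ?_ (h s.re)) (Real.exp_pos _).le
  gcongr
  linarith [Real.exp_pos s.re]

theorem norm_pvExp_le {p : ℝ} (hp : 0 < p) (n : ℂ) {s : ℂ} (h : |s.im| ≤ Real.pi / 4)
    {b C : ℝ} (hC : ‖cothC p (Complex.I * b * Complex.exp s)‖ ≤ C * (1 + Real.exp (-s.re))) :
    ‖pvExp p n b s‖ ≤ Real.exp |n.im| * C * (Real.exp ((n.re - 1) * s.re) +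
      Real.exp ((n.re - 2) * s.re)) * Real.exp (-(2 * Real.exp s.re)) := by
  unfold pvExp
  rw [norm_mul]
  calc _ ≤ (Real.exp |n.im| *
      (Real.exp ((n.re - 1) * s.re) * Real.exp (-(2 * Real.exp s.re)))) *
        (C * (1 + Real.exp (-s.re))) :=
        mul_le_mul (norm_kerExp_le hp n h) hC (norm_nonneg _) (by positivity)
    _ = _ := by
      rw [show (n.re - 2) * s.re = (n.re - 1) * s.re + -s.re by ring, Real.exp_add]; ring

/-- At the origin `kerC` and `cothC` each cost one power of |z|, which is why Re n > 2 is needed.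
The bound on `cothC` is a hypothesis because it fails near the poles; it is supplied separately on
rays and on suitable arcs. -/
theorem pvExp_decay {p : ℝ} (hp : 0 < p) {n : ℂ} (hn : 2 < n.re) {b C : ℝ} (hC0 : 0 < C) :
    ∃ δ > 0, ∃ M > 0, ∀ s : ℂ, |s.im| ≤ Real.pi / 4 →
      ‖cothC p (Complex.I * b * Complex.exp s)‖ ≤ C * (1 + Real.exp (-s.re)) →
      ‖pvExp p n b s‖ ≤ M * Real.exp (-(δ * |s.re|)) := by
  obtain ⟨δ₁, hδ₁, M₁, hM₁, h₁⟩ := exp_mul_exp_neg_exp_le (show 0 < n.re - 1 by linarith)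
  obtain ⟨δ₂, hδ₂, M₂, hM₂, h₂⟩ := exp_mul_exp_neg_exp_le (show 0 < n.re - 2 by linarith)
  refine ⟨min δ₁ δ₂, by positivity, Real.exp |n.im| * C * (M₁ + M₂), by positivity,
    fun s hs hC => ?_⟩
  refine (norm_pvExp_le hp n hs hC).trans ?_
  rw [mul_assoc, mul_assoc _ (M₁ + M₂), add_mul, add_mul]
  have hE : Real.exp (-(2 * Real.exp s.re)) ≤ Real.exp (-Real.exp s.re) :=
    Real.exp_le_exp.2 (by linarith [Real.exp_pos s.re])
  refine mul_le_mul_of_nonneg_left (add_le_add ?_ ?_) (by positivity)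
  · refine (mul_le_mul_of_nonneg_left hE (Real.exp_pos _).le).trans ((h₁ s.re).trans ?_)
    gcongr
    exact min_le_left _ _
  · refine (mul_le_mul_of_nonneg_left hE (Real.exp_pos _).le).trans ((h₂ s.re).trans ?_)
    gcongr
    exact min_le_right _ _

theorem re_I_mul_mul_exp (b : ℝ) (s : ℂ) :
    (Complex.I * b * Complex.exp s).re = -(b * (Complex.exp s).im) := by
  simp [Complex.mul_re]

theorem abs_sin_pi_div_four_ge {φ : ℝ} (h : |φ| = Real.pi / 4) : 7 / 10 ≤ |Real.sin φ| := by
  have h2 : Real.sin (Real.pi / 4) = Real.cos (Real.pi / 4) := by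
    rw [Real.sin_pi_div_four, Real.cos_pi_div_four]
  have h3 := cos_ge_of_abs_le (φ := Real.pi / 4) (abs_of_pos (by positivity)).le
  rcases abs_choice φ with h1 | h1 <;> rw [h1] at h
  · rw [h, h2]; exact h3.trans (le_abs_self _)
  · rw [← neg_neg φ, h, Real.sin_neg, abs_neg, h2]; exact h3.trans (le_abs_self _)

/-- On the rays arg z = ±π/4 the point ibz keeps a distance proportional to |z| from the imaginary
axis, hence from the poles of `cothC`. The constant 2/b rounds up 10/(7b). -/
theorem norm_cothC_ray_le {p : ℝ} (hp : 0 < p) {b : ℝ} (hb : 0 < b) {s : ℂ}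
    (h : |s.im| = Real.pi / 4) :
    ‖cothC p (Complex.I * b * Complex.exp s)‖ ≤ (1 + 2 / b) * (1 + Real.exp (-s.re)) := by
  have h1 := abs_sin_pi_div_four_ge h
  have he := Real.exp_pos s.re
  have h2 : |(Complex.I * b * Complex.exp s).re| = b * (Real.exp s.re * |Real.sin s.im|) := by
    rw [re_I_mul_mul_exp, Complex.exp_im, abs_neg, abs_mul, abs_mul, abs_of_pos hb, abs_of_pos he]
  have h3 : b * (Real.exp s.re * (7 / 10)) ≤ |(Complex.I * b * Complex.exp s).re| := by
    rw [h2]; gcongr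
  have h4 : 0 < b * (Real.exp s.re * (7 / 10)) := by positivity
  refine (norm_cothC_le hp (abs_pos.1 (h4.trans_le h3))).trans ?_
  have h5 : 1 / |(Complex.I * b * Complex.exp s).re| ≤ 2 / b * Real.exp (-s.re) := by
    refine (one_div_le_one_div_of_le h4 h3).trans ?_
    rw [Real.exp_neg, div_le_iff₀ h4]
    field_simp
    norm_num
  have h6 : 0 < 2 / b := by positivity
  nlinarith [Real.exp_pos (-s.re)]

theorem integrable_kerExp {p : ℝ} (hp : 0 < p) {n : ℂ} (hn : 1 < n.re) {φ : ℝ}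
    (hφ : |φ| ≤ Real.pi / 4) : Integrable (fun x : ℝ => kerExp p n (x + φ * Complex.I)) := by
  obtain ⟨δ, hδ, M, hM, h⟩ := kerExp_decay hp hn
  refine ((integrable_exp_neg_mul_abs hδ).const_mul M).mono' ?_ (Eventually.of_forall fun x => ?_)
  · apply Measurable.aestronglyMeasurable
    unfold kerExp
    have := measurable_kerC p
    fun_prop
  · simpa using h (x + φ * Complex.I) (by simpa using hφ)

theorem integrable_pvExp {p : ℝ} (hp : 0 < p) {n : ℂ} (hn : 2 < n.re) {b : ℝ} (hb : 0 < b) {φ : ℝ}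
    (hφ : |φ| = Real.pi / 4) : Integrable (fun x : ℝ => pvExp p n b (x + φ * Complex.I)) := by
  obtain ⟨δ, hδ, M, hM, h⟩ := pvExp_decay hp hn (b := b) (show 0 < 1 + 2 / b by positivity)
  refine ((integrable_exp_neg_mul_abs hδ).const_mul M).mono' ?_ (Eventually.of_forall fun x => ?_)
  · apply Measurable.aestronglyMeasurable
    unfold pvExp kerExp
    have := measurable_kerC p
    have := measurable_cothC p
    fun_prop
  · have h1 : |((x : ℂ) + φ * Complex.I).im| = Real.pi / 4 := by simpa using hφ
    simpa using h (x + φ * Complex.I) h1.le (norm_cothC_ray_le hp hb h1)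

/-! ### Ray integrals and the functional equation -/

/-- The Mellin transform of the kernel. -/
noncomputable def kerMellin (p : ℝ) (n : ℂ) : ℂ := ∫ x : ℝ, kerExp p n x

/-- The integral of `pvExp` over a ray, in the coordinate `s = log z`. -/
noncomputable def rayInt (p : ℝ) (n : ℂ) (b φ : ℝ) : ℂ := ∫ x : ℝ, pvExp p n b (x + φ * Complex.I)

/-- `kerC` has no poles in the right half-plane, so the ray of integration can be turned freely
within the sector. -/
theorem integral_kerExp_ray {p : ℝ} (hp : 0 < p) {n : ℂ} (hn : 1 < n.re) {φ : ℝ}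
    (hφ : |φ| ≤ Real.pi / 4) :
    ∫ x : ℝ, kerExp p n (x + φ * Complex.I) = kerMellin p n := by
  obtain ⟨δ, hδ, M, hM, h⟩ := kerExp_decay hp hn
  have hs : ∀ s : ℂ, s.im ∈ uIcc φ 0 → |s.im| ≤ Real.pi / 4 := by
    intro s hs
    have := abs_sub_left_of_mem_uIcc (uIcc_comm φ 0 ▸ hs)
    simp at this
    exact this.trans hφ
  have := integral_horizontal_line_eq hδ (fun s h1 => differentiableAt_kerExp hp n (hs s h1))
    (fun s h1 => h s (hs s h1))
  rw [this]
  simp [kerMellin]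

/-- With z = -iy and y = e^t on the upper ray, `cothC`(ibz) = 1 + 2 `kerC`(by) and 2 `kerC`(-iy) =
-(1 + `cothC`(iy)). Thus 2 `kerC`(z) `kerC`(by) is `kerC`(by) times -(1 + `cothC`(i b⁻¹ · by)), an
integrand of the same type for 1/b at the point by. Scaling by b is translation by log b in the
variable x, and z^n supplies the factor e^{-iπn/2}. -/
theorem rayInt_functional {p : ℝ} (hp : 0 < p) {n : ℂ} (hn : 2 < n.re) {b : ℝ} (hb : 0 < b) :
    rayInt p n b (-(Real.pi / 4)) = kerMellin p n -
      Complex.exp (-(n * Real.log b)) * Complex.exp (-(n * (Real.pi / 2 * Complex.I))) *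
        (kerMellin p n + rayInt p n b⁻¹ (Real.pi / 4)) := by
  have hpi := Real.pi_pos
  have habs : |Real.pi / 4| = Real.pi / 4 := abs_of_pos (by positivity)
  have habs' : |-(Real.pi / 4)| = Real.pi / 4 := by rw [abs_neg, habs]
  set L := Real.log b
  have hbL : (b : ℂ) = Complex.exp L := by
    rw [← Complex.ofReal_exp, Real.exp_log hb]
  have hbL' : ((b⁻¹ : ℝ) : ℂ) = Complex.exp (-L) := by
    rw [Complex.exp_neg, ← hbL]; push_cast; rfl
  have hn1 : 1 < n.re := by linarith
  have key : ∀ x : ℝ, pvExp p n b (x + (-(Real.pi / 4) : ℝ) * Complex.I) =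
      kerExp p n (x + (-(Real.pi / 4) : ℝ) * Complex.I) -
      Complex.exp (-(n * L)) * Complex.exp (-(n * (Real.pi / 2 * Complex.I))) *
      (kerExp p n ((x + L : ℝ) + (Real.pi / 4 : ℝ) * Complex.I) +
        pvExp p n b⁻¹ ((x + L : ℝ) + (Real.pi / 4 : ℝ) * Complex.I)) := by
    intro x
    set t : ℂ := x + (Real.pi / 4 : ℝ) * Complex.I with ht
    have e1 : (x : ℂ) + (-(Real.pi / 4) : ℝ) * Complex.I = t - Real.pi / 2 * Complex.I := by
      rw [ht]; push_cast; ring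
    have e2 : ((x + L : ℝ) : ℂ) + (Real.pi / 4 : ℝ) * Complex.I = t + L := by
      rw [ht]; push_cast; ring
    have e3 : Complex.exp (t - Real.pi / 2 * Complex.I) = -(Complex.I * Complex.exp t) := by
      rw [Complex.exp_sub, Complex.exp_pi_div_two_mul_I, Complex.div_I]; ring
    have e4 : Complex.exp (t + L) = b * Complex.exp t := by
      rw [Complex.exp_add, ← hbL, mul_comm]
    have htim : t.im = Real.pi / 4 := by simp [ht]
    have hy : 0 < (Complex.exp t).re := exp_re_pos (by rw [htim, habs])
    have hyi : 0 < (Complex.exp t).im := by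
      rw [Complex.exp_im, htim]
      exact mul_pos (Real.exp_pos _) (Real.sin_pos_of_pos_of_lt_pi (by positivity) (by linarith))
    set y := Complex.exp t
    have d1 : den p (Complex.I * y) ≠ 0 := den_ne_zero_of_re_neg hp (by simpa using hyi)
    have d2 : den p (-(Complex.I * y)) ≠ 0 := den_neg_ne_zero d1
    have d3 : den p (b * y) ≠ 0 := den_ne_zero hp (by simpa using mul_pos hb hy)
    have f1 : cothC p (Complex.I * y) = -(1 + 2 * kerC p (-(Complex.I * y))) := by
      rw [← cothC_eq d2, cothC_neg, neg_neg]
    have f2 : cothC p (Complex.I * b * -(Complex.I * y)) = 1 + 2 * kerC p (b * y) := by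
      rw [← cothC_eq d3]; congr 1; linear_combination (-b * y) * Complex.I_sq
    have f3 : Complex.I * (b⁻¹ : ℝ) * (b * y) = Complex.I * y := by
      have : (b : ℂ) ≠ 0 := by exact_mod_cast hb.ne'
      push_cast; field_simp
    have g1 : Complex.exp (n * (t - Real.pi / 2 * Complex.I)) =
        Complex.exp (n * t) * Complex.exp (-(n * (Real.pi / 2 * Complex.I))) := by
      rw [← Complex.exp_add]; ring_nf
    have g2 : Complex.exp (-(n * L)) * Complex.exp (n * (t + L)) = Complex.exp (n * t) := by
      rw [← Complex.exp_add]; ring_nf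
    rw [e1, e2]
    unfold pvExp kerExp
    rw [e3, e4, f2, f3, f1, g1]
    linear_combination (-2 * Complex.exp (-(n * (Real.pi / 2 * Complex.I))) * kerC p (b * y) *
      kerC p (-(Complex.I * y))) * g2
  have i1 := integrable_kerExp hp hn1 habs'.le
  have i2 := (integrable_kerExp hp hn1 habs.le).comp_add_right L
  have i3 := (integrable_pvExp hp hn (inv_pos.2 hb) habs).comp_add_right L
  have i4 : Integrable (fun x : ℝ => kerExp p n ((x + L : ℝ) + (Real.pi / 4 : ℝ) * Complex.I) +
      pvExp p n b⁻¹ ((x + L : ℝ) + (Real.pi / 4 : ℝ) * Complex.I)) := i2.add i3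
  unfold rayInt
  simp only [key]
  rw [integral_sub i1 (i4.const_mul _), integral_const_mul, integral_add i2 i3,
    integral_kerExp_ray hp hn1 habs'.le,
    integral_add_right_eq_self (fun x : ℝ => kerExp p n (x + (Real.pi / 4 : ℝ) * Complex.I)) L,
    integral_add_right_eq_self (fun x : ℝ => pvExp p n b⁻¹ (x + (Real.pi / 4 : ℝ) * Complex.I)) L,
    integral_kerExp_ray hp hn1 habs.le]

/-! ### The principal value integrand and its residues -/

/-- The meromorphic extension of `pvIntegrand`, with `b = β / 2π`. -/
noncomputable def pvFun (p : ℝ) (n : ℂ) (b : ℝ) (z : ℂ) : ℂ :=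
  z ^ (n - 1) * kerC p z * cothC p (Complex.I * b * z)

/-- With E = σ(u)e^{2πu} the left side is (1/E - E)/((E - 1)(1/E - 1)), which reduces to (E + 1)/(E
- 1). -/
theorem sigma_quotient_eq_cothC {p : ℝ} {u : ℂ} (h1 : (p : ℂ) + u ≠ 0) (h2 : (p : ℂ) - u ≠ 0) :
    (sigma p (-u) * Complex.exp (-(2 * Real.pi * u)) -
      sigma p u * Complex.exp (2 * Real.pi * u)) /
    ((sigma p u * Complex.exp (2 * Real.pi * u) - 1) *
      (sigma p (-u) * Complex.exp (-(2 * Real.pi * u)) - 1)) = cothC p u := by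
  have hs : sigma p (-u) * Complex.exp (-(2 * Real.pi * u)) =
      (sigma p u * Complex.exp (2 * Real.pi * u))⁻¹ := by
    rw [Complex.exp_neg, mul_inv]
    unfold sigma
    rw [inv_div, sub_neg_eq_add, ← sub_eq_add_neg]
  have hE : sigma p u * Complex.exp (2 * Real.pi * u) ≠ 0 :=
    mul_ne_zero (div_ne_zero h1 h2) (Complex.exp_ne_zero _)
  have hc : cothC p u = (sigma p u * Complex.exp (2 * Real.pi * u) + 1) /
      (sigma p u * Complex.exp (2 * Real.pi * u) - 1) := by
    unfold cothC den sigma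
    rw [div_mul_eq_mul_div, div_add_one h2, div_sub_one h2, div_div_div_cancel_right₀ h2]
  rw [hs, hc]
  set E := sigma p u * Complex.exp (2 * Real.pi * u)
  rcases eq_or_ne E 1 with h | h
  -- At a pole both quotients have denominator 0 and so take the default value 0.
  · simp [h]
  · have h3 : E - 1 ≠ 0 := sub_ne_zero.2 h
    have h4 : E⁻¹ - 1 ≠ 0 := by
      rw [sub_ne_zero]; exact fun h' => h (inv_eq_one.1 h')
    rw [div_eq_div_iff (mul_ne_zero h3 h4) h3]
    have h5 : E * E⁻¹ = 1 := mul_inv_cancel₀ hE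
    linear_combination (1 - E) * h5

theorem pvIntegrand_eq_pvFun {p : ℝ} (hp : 0 < p) (β : ℝ) (n : ℂ) (z : ℝ) :
    pvIntegrand p β n z = pvFun p n (β / (2 * Real.pi)) z := by
  have hpi : (Real.pi : ℂ) ≠ 0 := by exact_mod_cast Real.pi_ne_zero
  have hu : ∀ w : ℝ, (p : ℂ) + Complex.I * w ≠ 0 := fun w h => by
    have := congrArg Complex.re h
    simp at this
    exact hp.ne' this
  set w : ℝ := β / (2 * Real.pi) * z with hw
  have e1 : Complex.I * β * z / (2 * Real.pi) = Complex.I * w := by rw [hw]; push_cast; ring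
  have e2 : Complex.I * β * z = 2 * Real.pi * (Complex.I * w) := by
    rw [hw]; push_cast; field_simp
  have e3 : Complex.I * (β / (2 * Real.pi) : ℝ) * z = Complex.I * w := by
    rw [hw]; push_cast; ring
  have h2 : (p : ℂ) - Complex.I * w ≠ 0 := by
    have := hu (-w)
    push_cast at this
    rwa [mul_neg, ← sub_eq_add_neg] at this
  unfold pvIntegrand pvFun
  rw [e1, e2, e3, sigma_quotient_eq_cothC (hu w) h2, kernel_eq_kerC]

theorem abs_im_lt_pi {s : ℂ} (h : |s.im| ≤ Real.pi / 4) : -Real.pi < s.im ∧ s.im ≤ Real.pi := by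
  have hpi := Real.pi_pos
  have := abs_le.1 h
  constructor <;> linarith

theorem pvExp_eq (p : ℝ) (n : ℂ) (b : ℝ) {s : ℂ} (h : |s.im| ≤ Real.pi / 4) :
    pvExp p n b s = pvFun p n b (Complex.exp s) * Complex.exp s := by
  have h' := abs_im_lt_pi h
  have : Complex.exp (n * s) = Complex.exp s ^ (n - 1) * Complex.exp s := by
    rw [Complex.cpow_def_of_ne_zero (Complex.exp_ne_zero s), Complex.log_exp h'.1 h'.2,
      ← Complex.exp_add]
    ring_nf
  unfold pvExp kerExp pvFun
  rw [this]
  ring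

/-- The residue of `pvFun` at its pole `λ_j / b`. -/
noncomputable def res (p : ℝ) (n : ℂ) (b : ℝ) (j : ℕ) : ℂ :=
  -(Complex.I / (Real.pi * b)) * weight p j *
    (((lam p j / b : ℝ) : ℂ) ^ (n - 1) * kerC p ((lam p j / b : ℝ) : ℂ))

theorem hasDerivAt_den (p : ℝ) (u : ℂ) : HasDerivAt (den p)
    (Complex.exp (2 * Real.pi * u) + (p + u) * (Complex.exp (2 * Real.pi * u) * (2 * Real.pi)) + 1)
    u := by
  have h1 : HasDerivAt (fun u : ℂ => (p : ℂ) + u) 1 u := (hasDerivAt_id u).const_add _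
  have h2 : HasDerivAt (fun u : ℂ => Complex.exp (2 * Real.pi * u))
      (Complex.exp (2 * Real.pi * u) * (2 * Real.pi)) u := by
    simpa using ((hasDerivAt_id u).const_mul (2 * (Real.pi : ℂ))).cexp
  have h3 : HasDerivAt (fun u : ℂ => (p : ℂ) - u) (-1) u := (hasDerivAt_id u).const_sub _
  convert! (h1.mul h2).sub h3 using 1
  ring

/-- At a zero, (p + u)e^{2πu} can be replaced by p - u, and the derivative times p + u collapses to
2p + 2π(p² - u²). This real positive value shows that the zeros iλ_j are simple and produces the
denominator of w_j. -/
theorem deriv_den_mul {p lam : ℝ} (h : den p (Complex.I * lam) = 0) :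
    deriv (den p) (Complex.I * lam) * (p + Complex.I * lam) =
      2 * ((p + Real.pi * (p ^ 2 + lam ^ 2) : ℝ) : ℂ) := by
  rw [(hasDerivAt_den p _).deriv]
  unfold den at h
  push_cast
  linear_combination (1 + 2 * Real.pi * (p + Complex.I * lam)) * h -
    2 * Real.pi * lam ^ 2 * Complex.I_sq

theorem lam_pos {p : ℝ} (hp : 0 < p) {j : ℕ} (hj : 1 ≤ j) : 0 < lam p j := by
  have h := (lam_spec hp hj).1
  have : (1 : ℝ) ≤ j := by exact_mod_cast hj
  linarith

theorem den_lam {p : ℝ} (hp : 0 < p) {j : ℕ} (hj : 1 ≤ j) : den p (Complex.I * lam p j) = 0 :=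
  (den_I_mul_eq_zero_iff p _).2 (lam_spec hp hj).2.2

/-- Each root λ_k lies in (k - 1/2, k), so even the closed block [j - 1, j] contains only λ_j among
the positive roots. -/
theorem eq_lam_of_isRoot {p : ℝ} (hp : 0 < p) {j : ℕ} {w : ℝ} (hw : 0 < w)
    (h1 : (j : ℝ) - 1 ≤ w) (h2 : w ≤ j) (h : IsRoot p w) : w = lam p j := by
  obtain ⟨k, hk, rfl⟩ := exists_lam_eq hp hw h
  obtain ⟨h3, h4, -⟩ := lam_spec hp hk
  have h5 : k < j + 1 := by
    have : (k : ℝ) < j + 1 := by linarith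
    exact_mod_cast this
  have h6 : j < k + 1 := by
    have : (j : ℝ) < k + 1 := by linarith
    exact_mod_cast this
  rw [show k = j by omega]

/-- At iλ_j the numerator of `cothC` is 2(p - iλ_j); dividing by the derivative from `deriv_den_mul`
leaves (p² + λ_j²)/(p + π(p² + λ_j²)), which is w_j/π. -/
theorem residue_quotient {p : ℝ} (hp : 0 < p) {b : ℝ} (hb : 0 < b) {j : ℕ} (hj : 1 ≤ j) :
    deriv (den p) (Complex.I * lam p j) ≠ 0 ∧
    ((p + Complex.I * lam p j) * Complex.exp (2 * Real.pi * (Complex.I * lam p j)) +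
      (p - Complex.I * lam p j)) / (Complex.I * b * deriv (den p) (Complex.I * lam p j)) =
      -(Complex.I / (Real.pi * b)) * weight p j := by
  have h := den_lam hp hj
  have hd := deriv_den_mul h
  have hl := lam_pos hp hj
  have hpi := Real.pi_pos
  set l := lam p j with hl'
  have hpos : 0 < p + Real.pi * (p ^ 2 + l ^ 2) := by positivity
  have hne : ((p + Real.pi * (p ^ 2 + l ^ 2) : ℝ) : ℂ) ≠ 0 := by exact_mod_cast hpos.ne'
  have hd0 : deriv (den p) (Complex.I * l) ≠ 0 := by
    intro h0
    rw [h0, zero_mul] at hd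
    exact (mul_ne_zero two_ne_zero hne) hd.symm
  refine ⟨hd0, ?_⟩
  have hw : (weight p j : ℂ) = Real.pi * ((p ^ 2 + l ^ 2 : ℝ) : ℂ) /
      ((p + Real.pi * (p ^ 2 + l ^ 2) : ℝ) : ℂ) := by
    rw [weight, ← hl']
    norm_cast
    have : 0 < p * (p + 1 / Real.pi) + l ^ 2 := by positivity
    rw [div_eq_div_iff this.ne' hpos.ne']
    field_simp
    ring
  have hbC : (b : ℂ) ≠ 0 := by exact_mod_cast hb.ne'
  have hpiC : (Real.pi : ℂ) ≠ 0 := by exact_mod_cast hpi.ne'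
  have hnum : (p + Complex.I * l) * Complex.exp (2 * Real.pi * (Complex.I * l)) +
      (p - Complex.I * l) = 2 * (p - Complex.I * l) := by
    unfold den at h
    linear_combination h
  rw [hnum, hw, div_eq_iff (mul_ne_zero (mul_ne_zero Complex.I_ne_zero hbC) hd0)]
  have hpl : (p : ℂ) + Complex.I * l ≠ 0 := by
    intro h0
    rw [h0, mul_zero] at hd
    exact (mul_ne_zero two_ne_zero hne) hd.symm
  apply mul_right_cancel₀ hpl
  have e : -(Complex.I / (Real.pi * b)) * (Real.pi * ((p ^ 2 + l ^ 2 : ℝ) : ℂ) /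
      ((p + Real.pi * (p ^ 2 + l ^ 2) : ℝ) : ℂ)) *
      (Complex.I * b * deriv (den p) (Complex.I * l)) * (p + Complex.I * l) =
      -(Complex.I ^ 2) * ((p ^ 2 + l ^ 2 : ℝ) : ℂ) / ((p + Real.pi * (p ^ 2 + l ^ 2) : ℝ) : ℂ) *
      (deriv (den p) (Complex.I * l) * (p + Complex.I * l)) := by
    field_simp
  rw [e, hd, mul_comm 2 ((p + Real.pi * (p ^ 2 + l ^ 2) : ℝ) : ℂ), ← mul_assoc,
    div_mul_cancel₀ _ hne]
  push_cast
  linear_combination 2 * (p : ℂ) ^ 2 * Complex.I_sq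

/-- Near the block of the sector between the radii `(j - 1) / b` and `j / b` the function `pvFun`
is the sum of its principal part at `λ_j / b` and a holomorphic function. -/
theorem exists_regular_part {p : ℝ} (hp : 0 < p) (n : ℂ) {b : ℝ} (hb : 0 < b) {j : ℕ}
    (hj : 1 ≤ j) :
    ∃ (g : ℂ → ℂ) (U : Set ℂ), IsOpen U ∧ DifferentiableOn ℂ g U ∧
      (∀ s : ℂ, 0 ≤ s.im → s.im ≤ Real.pi / 4 → ((j : ℝ) - 1) / b ≤ Real.exp s.re →
        Real.exp s.re ≤ j / b → Complex.exp s ∈ U) ∧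
      ∀ z ∈ U, z ≠ (lam p j / b : ℝ) →
        pvFun p n b z = res p n b j / (z - (lam p j / b : ℝ)) + g z := by
  have hl := lam_pos hp hj
  obtain ⟨hd0, hres⟩ := residue_quotient hp hb hj
  have hbC : (b : ℂ) ≠ 0 := by exact_mod_cast hb.ne'
  set μ : ℂ := ((lam p j / b : ℝ) : ℂ) with hμ
  have hbμ : Complex.I * b * μ = Complex.I * lam p j := by
    rw [hμ]; push_cast; field_simp
  set dd : ℂ → ℂ := fun z => den p (Complex.I * b * z) with hdd
  have hddd : Differentiable ℂ dd := (differentiable_den p).comp (by fun_prop)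
  have hddμ : dd μ = 0 := by rw [hdd]; simp only [hbμ]; exact den_lam hp hj
  have hdd' : deriv dd μ = Complex.I * b * deriv (den p) (Complex.I * lam p j) := by
    have h1 : HasDerivAt (fun z : ℂ => Complex.I * b * z) (Complex.I * b) μ := by
      simpa using (hasDerivAt_id μ).const_mul (Complex.I * (b : ℂ))
    have h2 : HasDerivAt (den p) (deriv (den p) (Complex.I * b * μ)) (Complex.I * b * μ) :=
      (differentiable_den p _).hasDerivAt
    have := (h2.comp μ h1).deriv
    rw [hbμ] at this
    exact this.trans (mul_comm _ _)
  -- S is the denominator with its simple zero at μ divided out; it is entire, and q below is the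
  -- integrand times z - μ. A second `dslope`, applied to q, is then the holomorphic remainder.
  set S : ℂ → ℂ := dslope dd μ with hS
  have hSμ : S μ ≠ 0 := by
    rw [hS, dslope_same, hdd']
    exact mul_ne_zero (mul_ne_zero Complex.I_ne_zero hbC) hd0
  have hSd : Differentiable ℂ S := by
    rw [← differentiableOn_univ]
    exact (Complex.differentiableOn_dslope univ_mem).2 hddd.differentiableOn
  have hSne : ∀ z, z ≠ μ → (z - μ) * S z = dd z := by
    intro z hz
    rw [hS, dslope_of_ne _ hz, slope_def_field, hddμ, sub_zero,
      mul_div_cancel₀ _ (sub_ne_zero.2 hz)]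
  set U : Set ℂ := {z | 0 < z.re ∧ S z ≠ 0} with hU
  have hUo : IsOpen U := by
    apply IsOpen.inter
    · exact isOpen_lt continuous_const Complex.continuous_re
    · exact isOpen_ne_fun hSd.continuous continuous_const
  have hμU : μ ∈ U := ⟨by rw [hμ, Complex.ofReal_re]; positivity, hSμ⟩
  set q : ℂ → ℂ := fun z => z ^ (n - 1) * kerC p z *
    ((p + Complex.I * b * z) * Complex.exp (2 * Real.pi * (Complex.I * b * z)) +
      (p - Complex.I * b * z)) / S z with hq
  have hqd : DifferentiableOn ℂ q U := by
    intro z hz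
    have h1 : DifferentiableAt ℂ (fun z : ℂ => z ^ (n - 1)) z :=
      differentiableAt_id.cpow_const (Or.inl hz.1)
    have h2 := differentiableAt_kerC (den_ne_zero hp hz.1)
    exact ((((h1.mul h2).mul (by fun_prop)).div (hSd z) hz.2)).differentiableWithinAt
  have hqμ : q μ = res p n b j := by
    rw [hq]
    simp only [hbμ]
    rw [hS, dslope_same, hdd', mul_div_assoc, hres, res]
    ring
  refine ⟨dslope q μ, U, hUo, (Complex.differentiableOn_dslope (hUo.mem_nhds hμU)).2 hqd, ?_, ?_⟩
  · intro s h0 h1 h2 h3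
    have hab : |s.im| ≤ Real.pi / 4 := abs_le.2 ⟨by linarith [Real.pi_pos], h1⟩
    refine ⟨exp_re_pos hab, ?_⟩
    rcases eq_or_ne (Complex.exp s) μ with he | he
    · rw [he]; exact hSμ
    intro hS0
    have hz := hSne _ he
    rw [hS0, mul_zero] at hz
    -- No other zero meets the block: on the real side the root is unique, and strictly above it
    -- Re(ibz) < 0, where `den` does not vanish.
    rcases h0.eq_or_lt with h0 | h0
    · have e1 : Complex.exp s = (Real.exp s.re : ℝ) := by
        rw [Complex.ofReal_exp]
        congr 1
        exact Complex.ext rfl (by simpa using h0.symm)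
      have e2 : Complex.I * b * Complex.exp s = Complex.I * (b * Real.exp s.re : ℝ) := by
        rw [e1]; push_cast; ring
      have hr : IsRoot p (b * Real.exp s.re) := by
        rw [← den_I_mul_eq_zero_iff, ← e2]; exact hz.symm
      have := eq_lam_of_isRoot hp (by positivity) (j := j)
        (by rw [div_le_iff₀ hb] at h2; linarith) (by rw [le_div_iff₀ hb] at h3; linarith) hr
      apply he
      rw [e1, hμ, ← this]
      congr 1
      field_simp
    · refine den_ne_zero_of_re_neg hp ?_ hz.symm
      rw [re_I_mul_mul_exp, neg_lt_zero, Complex.exp_im]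
      exact mul_pos hb (mul_pos (Real.exp_pos _)
        (Real.sin_pos_of_pos_of_lt_pi h0 (by linarith [Real.pi_pos])))
  · intro z hz hzμ
    have hzμ' := sub_ne_zero.2 hzμ
    rw [dslope_of_ne _ hzμ, slope_def_field, ← hqμ, ← add_div, add_sub_cancel, hq]
    simp only
    unfold pvFun cothC
    rw [show den p (Complex.I * b * z) = (z - μ) * S z from (hSne z hzμ).symm]
    field_simp

/-! ### Cauchy's theorem on one block -/

/-- The part of the ray integral between the radii `a` and `c`. -/
noncomputable def rayPart (p : ℝ) (n : ℂ) (b a c : ℝ) : ℂ :=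
  ∫ x in Real.log a..Real.log c, pvExp p n b (x + (Real.pi / 4 : ℝ) * Complex.I)

/-- The integral of `pvFun` over the arc of radius `R` from argument `0` to argument `π / 4`. -/
noncomputable def arcInt (p : ℝ) (n : ℂ) (b R : ℝ) : ℂ :=
  Complex.I * ∫ y in (0 : ℝ)..Real.pi / 4, pvExp p n b (Real.log R + y * Complex.I)

/-- The factor -i rotates the closed upper half-plane into the closed right half-plane, away from
the cut of the principal logarithm. One branch therefore serves as primitive of the principal part
along all sides used. -/
theorem hasDerivAt_log_exp_sub {μ : ℝ} {s : ℂ} (h0 : 0 ≤ (Complex.exp s).im)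
    (h : Complex.exp s ≠ μ) :
    HasDerivAt (fun s : ℂ => Complex.log (-Complex.I * (Complex.exp s - μ)))
      (Complex.exp s / (Complex.exp s - μ)) s := by
  have h1 : HasDerivAt (fun s : ℂ => -Complex.I * (Complex.exp s - μ))
      (-Complex.I * Complex.exp s) s :=
    ((Complex.hasDerivAt_exp s).sub_const _).const_mul _
  have h2 : -Complex.I * (Complex.exp s - μ) ∈ Complex.slitPlane := by
    rw [Complex.mem_slitPlane_iff]
    simp only [neg_mul, Complex.neg_re, Complex.neg_im, Complex.mul_re, Complex.mul_im,
      Complex.I_re, Complex.I_im, Complex.sub_re, Complex.sub_im, Complex.ofReal_re,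
      Complex.ofReal_im]
    rcases h0.eq_or_lt with h3 | h3
    · right
      intro h4
      apply h
      apply Complex.ext
      · simp only [Complex.ofReal_re]; linarith
      · simp [← h3]
    · left; linarith
  convert! h1.clog h2 using 1
  rw [mul_div_mul_left _ _ (neg_ne_zero.2 Complex.I_ne_zero)]

theorem log_neg_I_mul_of_pos {x : ℝ} (hx : 0 < x) :
    Complex.log (-Complex.I * x) = Real.log x - Real.pi / 2 * Complex.I := by
  rw [mul_comm, Complex.log_ofReal_mul hx (neg_ne_zero.2 Complex.I_ne_zero), Complex.log_neg_I]
  ring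

theorem log_neg_I_mul_of_neg {x : ℝ} (hx : x < 0) :
    Complex.log (-Complex.I * x) = Real.log (-x) + Real.pi / 2 * Complex.I := by
  rw [show -Complex.I * (x : ℂ) = ((-x : ℝ) : ℂ) * Complex.I by push_cast; ring,
    Complex.log_ofReal_mul (neg_pos.2 hx) Complex.I_ne_zero, Complex.log_I]

/-- Cauchy's theorem for a block of the sector with one pole on its real side. -/
theorem block_contour {p : ℝ} (hp : 0 < p) (n : ℂ) {b : ℝ} (hb : 0 < b) {j : ℕ}
    (hj : 1 ≤ j) {a c : ℝ} (ha : 0 < a) (h1 : ((j : ℝ) - 1) / b ≤ a) (h2 : a < lam p j / b)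
    (h3 : lam p j / b < c) (h4 : c ≤ j / b) :
    (∫ x in a..c, (pvFun p n b x - res p n b j / (x - (lam p j / b : ℝ)))) +
      res p n b j * (Real.log ((c - lam p j / b) / (lam p j / b - a)) - Real.pi * Complex.I) =
    rayPart p n b a c + arcInt p n b a - arcInt p n b c := by
  obtain ⟨g, U, hU, hg, hmem, hdec⟩ := exists_regular_part hp n hb hj
  have hpi := Real.pi_pos
  set μ : ℝ := lam p j / b with hμ
  set r := res p n b j
  have hμ0 : 0 < μ := ha.trans h2
  have hc : 0 < c := hμ0.trans h3
  have hac : a < c := h2.trans h3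
  have hlog : Real.log a ≤ Real.log c := Real.log_le_log ha hac.le
  set R : Set ℂ := uIcc (Real.log a) (Real.log c) ×ℂ uIcc 0 (Real.pi / 4) with hR
  have hRim : ∀ s ∈ R, 0 ≤ s.im ∧ s.im ≤ Real.pi / 4 := by
    intro s hs
    have := hs.2
    rwa [mem_preimage, uIcc_of_le (by positivity)] at this
  have hRabs : ∀ s ∈ R, |s.im| ≤ Real.pi / 4 := fun s hs => by
    rw [abs_of_nonneg (hRim s hs).1]; exact (hRim s hs).2
  have hRU : ∀ s ∈ R, Complex.exp s ∈ U := by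
    intro s hs
    obtain ⟨h5, h6⟩ := hRim s hs
    have h7 := hs.1
    rw [mem_preimage, uIcc_of_le hlog] at h7
    refine hmem s h5 h6 (h1.trans ?_) (le_trans ?_ h4)
    · rw [← Real.exp_log ha]; exact Real.exp_le_exp.2 h7.1
    · rw [← Real.exp_log hc]; exact Real.exp_le_exp.2 h7.2
  set G : ℂ → ℂ := fun s => g (Complex.exp s) * Complex.exp s with hG
  have hGd : ∀ s ∈ R, DifferentiableAt ℂ G s := by
    intro s hs
    have h5 : DifferentiableAt ℂ g (Complex.exp s) :=
      (hg _ (hRU s hs)).differentiableAt (hU.mem_nhds (hRU s hs))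
    exact (h5.comp s Complex.differentiable_exp.differentiableAt).mul
      Complex.differentiable_exp.differentiableAt
  set L : ℂ → ℂ := fun s => Complex.log (-Complex.I * (Complex.exp s - μ)) with hL
  -- On the top and the two vertical sides the principal part is integrated exactly by the primitive
  -- L, leaving the holomorphic part G for Cauchy's theorem.
  have seg : ∀ (γ : ℝ → ℂ) (v : ℂ) (t₀ t₁ : ℝ), (∀ t, HasDerivAt γ v t) →
      (∀ t ∈ uIcc t₀ t₁, γ t ∈ R) → (∀ t ∈ uIcc t₀ t₁, Complex.exp (γ t) ≠ μ) →
      v * ∫ t in t₀..t₁, pvExp p n b (γ t) =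
        v * (∫ t in t₀..t₁, G (γ t)) + r * (L (γ t₁) - L (γ t₀)) := by
    intro γ v t₀ t₁ hγ hγR hγμ
    have hγc : Continuous γ := continuous_iff_continuousAt.2 fun t => (hγ t).continuousAt
    have him : ∀ t ∈ uIcc t₀ t₁, 0 ≤ (Complex.exp (γ t)).im := by
      intro t ht
      obtain ⟨h5, h6⟩ := hRim _ (hγR t ht)
      rw [Complex.exp_im]
      exact mul_nonneg (Real.exp_pos _).le (Real.sin_nonneg_of_nonneg_of_le_pi h5 (by linarith))
    have hGi : IntervalIntegrable (fun t => G (γ t)) volume t₀ t₁ := by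
      apply ContinuousOn.intervalIntegrable
      intro t ht
      exact (ContinuousAt.comp (hGd _ (hγR t ht)).continuousAt hγc.continuousAt).continuousWithinAt
    have hPi : IntervalIntegrable (fun t => Complex.exp (γ t) / (Complex.exp (γ t) - μ) * v)
        volume t₀ t₁ := by
      apply ContinuousOn.intervalIntegrable
      intro t ht
      apply ContinuousAt.continuousWithinAt
      have := sub_ne_zero.2 (hγμ t ht)
      have h6 : ContinuousAt γ t := hγc.continuousAt
      exact ((h6.cexp.div (h6.cexp.sub continuousAt_const) this)).mul continuousAt_const
    have hFTC := intervalIntegral.integral_eq_sub_of_hasDerivAt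
      (f := fun t => L (γ t)) (fun t ht =>
        (hasDerivAt_log_exp_sub (him t ht) (hγμ t ht)).comp t (hγ t)) hPi
    rw [← hFTC, ← intervalIntegral.integral_const_mul, ← intervalIntegral.integral_const_mul,
      ← intervalIntegral.integral_const_mul,
      ← intervalIntegral.integral_add (hGi.const_mul _) (hPi.const_mul _)]
    apply intervalIntegral.integral_congr
    intro t ht
    simp only
    rw [pvExp_eq p n b (hRabs _ (hγR t ht)), hdec _ (hRU _ (hγR t ht)) (hγμ t ht), hG]
    simp only
    ring
  have hrect := Complex.integral_boundary_rect_eq_zero_of_differentiableOn G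
      (⟨Real.log a, 0⟩ : ℂ) ⟨Real.log c, Real.pi / 4⟩ (fun s hs => (hGd s hs).differentiableWithinAt)
  simp only [smul_eq_mul] at hrect
  have top := seg (fun x : ℝ => (x : ℂ) + (Real.pi / 4 : ℝ) * Complex.I) 1 (Real.log a)
    (Real.log c) (fun t => (Complex.ofRealCLM.hasDerivAt (x := t)).add_const _)
    (fun t ht => ⟨by simpa using ht, by simp [right_mem_uIcc]⟩)
    (fun t _ h => by
      have := congrArg Complex.im h
      rw [Complex.exp_im, Complex.ofReal_im] at this
      simp at this)
  have side : ∀ x ∈ uIcc (Real.log a) (Real.log c), Real.exp x ≠ μ →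
      Complex.I * ∫ y in (0 : ℝ)..Real.pi / 4, pvExp p n b (x + y * Complex.I) =
      Complex.I * (∫ y in (0 : ℝ)..Real.pi / 4, G (x + y * Complex.I)) +
        r * (L (x + (Real.pi / 4 : ℝ) * Complex.I) - L (x + (0 : ℝ) * Complex.I)) := by
    intro x hx hxμ
    refine seg (fun y : ℝ => (x : ℂ) + y * Complex.I) Complex.I 0 (Real.pi / 4)
      (fun t => by
        simpa using ((Complex.ofRealCLM.hasDerivAt (x := t)).mul_const Complex.I).const_add (x : ℂ))
      (fun t ht => ⟨by simpa using hx, by simpa using ht⟩) (fun t _ h => ?_)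
    have := congrArg norm h
    rw [Complex.norm_exp, Complex.norm_real, Real.norm_eq_abs, abs_of_pos hμ0] at this
    simp at this
    exact hxμ this
  have left := side (Real.log a) left_mem_uIcc (by rw [Real.exp_log ha]; exact h2.ne)
  have right := side (Real.log c) right_mem_uIcc (by rw [Real.exp_log hc]; exact h3.ne')
  have bot : ∫ x in Real.log a..Real.log c, G ((x : ℂ) + ((0 : ℝ) : ℂ) * Complex.I) =
      ∫ x in a..c, (pvFun p n b x - r / (x - μ)) := by
    have hgc : ∀ x ∈ Icc a c, (x : ℂ) ∈ U := by
      intro x hx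
      have hx0 : 0 < x := ha.trans_le hx.1
      have := hmem (Real.log x : ℝ) (by simp) (by simp; positivity)
        (by rw [Complex.ofReal_re, Real.exp_log hx0]; exact h1.trans hx.1)
        (by rw [Complex.ofReal_re, Real.exp_log hx0]; exact hx.2.trans h4)
      rwa [← Complex.ofReal_exp, Real.exp_log hx0] at this
    have h5 : ∫ x in a..c, (pvFun p n b x - r / (x - μ)) = ∫ x in a..c, g x := by
      apply intervalIntegral.integral_congr_ae
      -- On the bottom side the decomposition may fail at the pole itself, a null set.
      have : ∀ᵐ x : ℝ, x ≠ μ := by simp [ae_iff]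
      filter_upwards [this] with x hx hx2
      rw [uIoc_of_le hac.le] at hx2
      rw [hdec x (hgc x ⟨hx2.1.le, hx2.2⟩) (by exact_mod_cast hx)]
      ring
    have h6 := intervalIntegral.integral_deriv_smul_comp'' (a := Real.log a) (b := Real.log c)
      (f := Real.exp) (f' := Real.exp) (g := fun x : ℝ => g x) Real.continuous_exp.continuousOn
      (fun x _ => (Real.hasDerivAt_exp x).hasDerivWithinAt) Real.continuous_exp.continuousOn (by
        have himg : Real.exp '' uIcc (Real.log a) (Real.log c) ⊆ Icc a c := by
          rintro _ ⟨x, hx, rfl⟩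
          rw [uIcc_of_le hlog] at hx
          constructor
          · rw [← Real.exp_log ha]; exact Real.exp_le_exp.2 hx.1
          · rw [← Real.exp_log hc]; exact Real.exp_le_exp.2 hx.2
        intro x hx
        have h7 := hgc x (himg hx)
        have h8 : ContinuousAt g x := ((hg _ h7).differentiableAt (hU.mem_nhds h7)).continuousAt
        exact (ContinuousAt.comp (f := fun x : ℝ => (x : ℂ)) h8
          Complex.continuous_ofReal.continuousAt).continuousWithinAt)
    rw [h5, ← Real.exp_log ha, ← Real.exp_log hc, Real.log_exp, Real.log_exp, ← h6]
    apply intervalIntegral.integral_congr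
    intro x _
    simp [hG, mul_comm]
  have LR : L (Real.log c + (0 : ℝ) * Complex.I) = Real.log (c - μ) - Real.pi / 2 * Complex.I := by
    rw [← log_neg_I_mul_of_pos (sub_pos.2 h3), hL]
    simp only [Complex.ofReal_zero, zero_mul, add_zero]
    rw [← Complex.ofReal_exp, Real.exp_log hc]
    push_cast; rfl
  have LL : L (Real.log a + (0 : ℝ) * Complex.I) = Real.log (μ - a) + Real.pi / 2 * Complex.I := by
    rw [← neg_sub a μ, ← log_neg_I_mul_of_neg (sub_neg.2 h2), hL]
    simp only [Complex.ofReal_zero, zero_mul, add_zero]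
    rw [← Complex.ofReal_exp, Real.exp_log ha]
    push_cast; rfl
  have hlogdiv : ((Real.log ((c - μ) / (μ - a)) : ℝ) : ℂ) =
      (Real.log (c - μ) : ℂ) - Real.log (μ - a) := by
    rw [Real.log_div (sub_pos.2 h3).ne' (sub_pos.2 h2).ne']; push_cast; rfl
  rw [← bot, hlogdiv]
  rw [LR] at right
  rw [LL] at left
  unfold rayPart arcInt
  -- The values of L at the lower corners have imaginary parts +π/2 on the left of the pole and -π/2
  -- on the right; their difference is the half residue -πi.
  linear_combination hrect - top - left + right

/-! ### Vanishing of the arcs at infinity and at the origin -/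

/-- The circles |u| = N avoid the poles. If Re u ≥ 1/2 the general bound applies. Otherwise |Im u|
is within 1/4 of N, so E = e^{2πu} has Re E ≥ 0 and |E + 1| ≥ |E|; with 4p ≤ N the term u(E + 1)
dominates p(E - 1) in `den`. The resulting ratio is (5/2)/(1/2). -/
theorem norm_cothC_le_of_norm_eq_nat {p : ℝ} (hp : 0 < p) {N : ℕ} (h1 : 1 ≤ N) (h4 : 4 * p ≤ N)
    {u : ℂ} (hu : ‖u‖ = N) (hre : 0 ≤ u.re) : ‖cothC p u‖ ≤ 5 := by
  have hpi := Real.pi_pos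
  have hN : (1 : ℝ) ≤ N := by exact_mod_cast h1
  rcases le_or_gt (1 / 2) u.re with h | h
  · refine (norm_cothC_le hp (by linarith)).trans ?_
    rw [abs_of_nonneg hre]
    have : 1 / u.re ≤ 1 / (1 / 2) := one_div_le_one_div_of_le (by norm_num) h
    linarith
  have hsq : u.re ^ 2 + |u.im| ^ 2 = N ^ 2 := by
    rw [← hu, Complex.sq_norm, Complex.normSq_apply, sq_abs]; ring
  have him0 := abs_nonneg u.im
  have him1 : |u.im| ≤ N := by nlinarith
  have him2 : N - |u.im| ≤ 1 / 4 := by nlinarith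
  have hcos : 0 ≤ Real.cos (2 * Real.pi * u.im) := by
    rw [← Real.cos_abs, abs_mul, abs_of_pos (by positivity : 0 < 2 * Real.pi), ← Real.cos_neg,
      ← Real.cos_add_nat_mul_two_pi _ N]
    apply Real.cos_nonneg_of_mem_Icc
    constructor <;> nlinarith
  set E := Complex.exp (2 * Real.pi * u) with hE
  have hEn : ‖E‖ = Real.exp (2 * Real.pi * u.re) := norm_exp_two_pi_mul u
  have hE1 : 1 ≤ ‖E‖ := by rw [hEn]; apply Real.one_le_exp; positivity
  have hEre : 0 ≤ E.re := by
    rw [hE, Complex.exp_re]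
    have : (2 * (Real.pi : ℂ) * u).im = 2 * Real.pi * u.im := by simp [Complex.mul_im]
    rw [this]
    exact mul_nonneg (Real.exp_pos _).le hcos
  have hE2 : ‖E‖ ≤ ‖E + 1‖ := by
    rw [Complex.norm_def, Complex.norm_def]
    apply Real.sqrt_le_sqrt
    simp only [Complex.normSq_apply, Complex.add_re, Complex.add_im, Complex.one_re,
      Complex.one_im]
    nlinarith
  have hE3 : ‖E + 1‖ ≤ 2 * ‖E‖ := (norm_add_le _ _).trans (by rw [norm_one]; linarith)
  have hE4 : ‖E - 1‖ ≤ 2 * ‖E‖ := (norm_sub_le _ _).trans (by rw [norm_one]; linarith)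
  have hpn : ‖(p : ℂ)‖ = p := by rw [Complex.norm_real, Real.norm_eq_abs, abs_of_pos hp]
  have hnum : ‖(p + u) * E + (p - u)‖ ≤ 5 / 2 * N * ‖E‖ := by
    have : (p + u) * E + (p - u) = p * (E + 1) + u * (E - 1) := by ring
    rw [this]
    refine (norm_add_le _ _).trans ?_
    rw [norm_mul, norm_mul, hpn, hu]
    nlinarith
  have hden : 1 / 2 * N * ‖E‖ ≤ ‖den p u‖ := by
    have h5 : den p u = u * (E + 1) - -(p * (E - 1)) := by unfold den; ring
    have h6 := norm_sub_norm_le (u * (E + 1)) (-(p * (E - 1)))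
    rw [← h5, norm_neg, norm_mul, norm_mul, hpn, hu] at h6
    nlinarith
  unfold cothC
  have hpos : 0 < 1 / 2 * N * ‖E‖ := by positivity
  rw [norm_div, div_le_iff₀ (hpos.trans_le hden)]
  linarith

/-- `den` has a simple zero at 0, with derivative 2 + 2πp, so `cothC` has at most a simple pole
there. -/
theorem norm_cothC_le_near_zero {p : ℝ} (hp : 0 < p) :
    ∃ δ > 0, ∃ M > 0, ∀ u : ℂ, u ≠ 0 → ‖u‖ < δ → ‖cothC p u‖ ≤ M / ‖u‖ := by
  have hd := hasDerivAt_den p 0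
  simp only [mul_zero, Complex.exp_zero, add_zero, one_mul] at hd
  set d : ℂ := 1 + p * (2 * Real.pi) + 1 with hdd
  have hd0 : 0 < ‖d‖ := by
    rw [norm_pos_iff]
    have : d = ((1 + p * (2 * Real.pi) + 1 : ℝ) : ℂ) := by rw [hdd]; push_cast; ring
    rw [this]
    have : 0 < 1 + p * (2 * Real.pi) + 1 := by positivity
    exact_mod_cast this.ne'
  have h1 : ∀ᶠ u in 𝓝[≠] (0 : ℂ), ‖d‖ / 2 < ‖slope (den p) 0 u‖ :=
    (hasDerivAt_iff_tendsto_slope.1 hd).norm.eventually_const_lt (by linarith)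
  set num : ℂ → ℂ := fun u => (p + u) * Complex.exp (2 * Real.pi * u) + (p - u) with hnum
  have h2 : ∀ᶠ u in 𝓝[≠] (0 : ℂ), ‖num u‖ < ‖num 0‖ + 1 := by
    have hc : ContinuousAt num 0 := by rw [hnum]; fun_prop
    exact (hc.norm.eventually_lt_const (lt_add_one _)).filter_mono nhdsWithin_le_nhds
  obtain ⟨δ, hδ, h⟩ := Metric.eventually_nhds_iff.1 (eventually_nhdsWithin_iff.1 (h1.and h2))
  refine ⟨δ, hδ, (‖num 0‖ + 1) / (‖d‖ / 2), by positivity, fun u hu hu2 => ?_⟩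
  obtain ⟨h3, h4⟩ := h (y := u) (by simpa using hu2) hu
  have hu0 : 0 < ‖u‖ := norm_pos_iff.2 hu
  have hden0 : den p 0 = 0 := by simp [den]
  rw [slope_def_field, hden0, sub_zero, sub_zero, norm_div, lt_div_iff₀ hu0] at h3
  unfold cothC
  rw [norm_div, div_div]
  exact div_le_div₀ (by positivity) h4.le (by positivity) h3.le

theorem norm_arcInt_le {p : ℝ} {n : ℂ} {b R B : ℝ}
    (h : ∀ y : ℝ, 0 ≤ y → y ≤ Real.pi / 4 → ‖pvExp p n b (Real.log R + y * Complex.I)‖ ≤ B) :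
    ‖arcInt p n b R‖ ≤ B * (Real.pi / 4) := by
  have hpi := Real.pi_pos
  unfold arcInt
  rw [norm_mul, Complex.norm_I, one_mul]
  refine (intervalIntegral.norm_integral_le_of_norm_le_const (C := B) fun y hy => ?_).trans ?_
  · rw [uIoc_of_le (by positivity)] at hy
    exact h y hy.1.le hy.2
  · rw [sub_zero, abs_of_pos (by positivity)]

theorem norm_I_mul_mul_exp {b : ℝ} (hb : 0 < b) (s : ℂ) :
    ‖Complex.I * b * Complex.exp s‖ = b * Real.exp s.re := by
  rw [norm_mul, norm_mul, Complex.norm_I, one_mul, Complex.norm_exp, Complex.norm_real,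
    Real.norm_eq_abs, abs_of_pos hb]

theorem tendsto_arcInt_atTop {p : ℝ} (hp : 0 < p) {n : ℂ} (hn : 2 < n.re) {b : ℝ} (hb : 0 < b) :
    Tendsto (fun N : ℕ => arcInt p n b (N / b)) atTop (𝓝 0) := by
  have hpi := Real.pi_pos
  obtain ⟨δ, hδ, M, hM, h⟩ := pvExp_decay hp hn (b := b) (show (0 : ℝ) < 5 by norm_num)
  have hlim : Tendsto (fun N : ℕ => M * Real.exp (-(δ * |Real.log (N / b)|)) * (Real.pi / 4))
      atTop (𝓝 0) := by
    have h1 : Tendsto (fun N : ℕ => |Real.log (N / b)|) atTop atTop :=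
      tendsto_abs_atTop_atTop.comp (Real.tendsto_log_atTop.comp
        (tendsto_natCast_atTop_atTop.atTop_div_const hb))
    have h2 := (Real.tendsto_exp_neg_atTop_nhds_zero.comp (h1.const_mul_atTop hδ))
    simpa using (h2.const_mul M).mul_const (Real.pi / 4)
  refine squeeze_zero_norm' ?_ hlim
  filter_upwards [eventually_ge_atTop 1, tendsto_natCast_atTop_atTop.eventually_ge_atTop (4 * p)]
    with N hN1 hN4
  have hN : (0 : ℝ) < N := by exact_mod_cast hN1
  refine norm_arcInt_le fun y hy0 hy1 => ?_
  have him : |((Real.log (N / b) : ℂ) + y * Complex.I).im| ≤ Real.pi / 4 := by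
    simpa [abs_of_nonneg hy0] using hy1
  have := h (Real.log (N / b) + y * Complex.I) him ?_
  · simpa using this
  -- Oddness moves ibz, which lies in the left half-plane, to the right one.
  · rw [← norm_neg, ← cothC_neg]
    have h5 : ‖cothC p (-(Complex.I * b * Complex.exp (Real.log (N / b) + y * Complex.I)))‖ ≤ 5 := by
      refine norm_cothC_le_of_norm_eq_nat hp hN1 hN4 ?_ ?_
      · rw [norm_neg, norm_I_mul_mul_exp hb]
        simp only [Complex.add_re, Complex.ofReal_re, Complex.mul_re, Complex.I_re, mul_zero,
          Complex.ofReal_im, Complex.I_im, zero_mul, sub_zero, add_zero]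
        rw [Real.exp_log (by positivity)]
        field_simp
      · rw [Complex.neg_re, re_I_mul_mul_exp, neg_neg, Complex.exp_im]
        refine mul_nonneg hb.le (mul_nonneg (Real.exp_pos _).le
          (Real.sin_nonneg_of_nonneg_of_le_pi ?_ ?_))
        · simpa using hy0
        · simp; linarith
    have h6 := Real.exp_pos (-((Real.log (N / b) : ℂ) + y * Complex.I).re)
    linarith

theorem tendsto_arcInt_zero {p : ℝ} (hp : 0 < p) {n : ℂ} (hn : 2 < n.re) {b : ℝ} (hb : 0 < b) :
    Tendsto (fun R : ℝ => arcInt p n b R) (𝓝[>] 0) (𝓝 0) := by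
  have hpi := Real.pi_pos
  obtain ⟨δ₀, hδ₀, M₀, hM₀, h₀⟩ := norm_cothC_le_near_zero hp
  obtain ⟨δ, hδ, M, hM, h⟩ := pvExp_decay hp hn (b := b) (show 0 < M₀ / b by positivity)
  have hlim : Tendsto (fun R : ℝ => M * Real.exp (-(δ * |Real.log R|)) * (Real.pi / 4))
      (𝓝[>] 0) (𝓝 0) := by
    have h1 : Tendsto (fun R : ℝ => |Real.log R|) (𝓝[>] 0) atTop :=
      tendsto_abs_atBot_atTop.comp Real.tendsto_log_nhdsGT_zero
    have h2 := (Real.tendsto_exp_neg_atTop_nhds_zero.comp (h1.const_mul_atTop hδ))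
    simpa using (h2.const_mul M).mul_const (Real.pi / 4)
  refine squeeze_zero_norm' ?_ hlim
  filter_upwards [Ioo_mem_nhdsGT (show 0 < δ₀ / b by positivity)] with R hR
  refine norm_arcInt_le fun y hy0 hy1 => ?_
  have him : |((Real.log R : ℂ) + y * Complex.I).im| ≤ Real.pi / 4 := by
    simpa [abs_of_nonneg hy0] using hy1
  have hre : ((Real.log R : ℂ) + y * Complex.I).re = Real.log R := by simp
  have := h (Real.log R + y * Complex.I) him ?_
  · rwa [hre] at this
  · have hnorm := norm_I_mul_mul_exp hb (Real.log R + y * Complex.I)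
    rw [hre, Real.exp_log hR.1] at hnorm
    have h3 : 0 < b * R := mul_pos hb hR.1
    refine (h₀ _ (norm_pos_iff.1 (by rw [hnorm]; exact h3)) ?_).trans ?_
    · rw [hnorm, mul_comm, ← lt_div_iff₀ hb]; exact hR.2
    · rw [hnorm, hre, Real.exp_neg, Real.exp_log hR.1, ← div_div, mul_add, mul_one,
        ← div_eq_mul_inv]
      have : 0 < M₀ / b := by positivity
      linarith

/-! ### Removing the principal parts, with bounds uniform in the pole -/

theorem abs_mul_cos_sub_sin_le (x : ℝ) : |x * Real.cos x - Real.sin x| ≤ |x| ^ 3 := by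
  wlog h : 0 ≤ x generalizing x
  · have := this (-x) (by linarith)
    rw [Real.cos_neg, Real.sin_neg, abs_neg] at this
    rwa [show -x * Real.cos x - -Real.sin x = -(x * Real.cos x - Real.sin x) by ring,
      abs_neg] at this
  have h1 := Real.one_sub_sq_div_two_le_cos (x := x)
  have h2 := Real.sin_le h
  have h3 := Real.sin_ge_sub_cube h
  have h4 := Real.cos_le_one x
  have h5 : x * (1 - x ^ 2 / 2) ≤ x * Real.cos x := by gcongr
  have h6 : x * Real.cos x ≤ x * 1 := by gcongr
  have h7 : 0 ≤ x ^ 3 := by positivity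
  rw [abs_of_nonneg h, abs_le]
  constructor <;> nlinarith

/-- Here C and S stand for cos(πt) and sin(πt). Over a common denominator the first-order terms
cancel because D = p + πB; what is left is of order t², like the denominator. The final bound
depends on p alone, which gives uniformity in the pole l. -/
theorem abs_div_sub_div_le {p l t B Q D C S : ℝ} (hp : 0 < p) (hl : 0 < l) (ht0 : t ≠ 0)
    (ht : |t| ≤ 1 / 2) (hB : B = p ^ 2 + l ^ 2) (hQ : Q = B + l * t) (hQp : p ^ 2 ≤ Q)
    (hD : D = p + Real.pi * B) (hC : |C| ≤ 1) (hS : |S| ≤ 1)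
    (hden : 2 * Q * |t| ≤ |Q * S + t * p * C|)
    (hcub : |Real.pi * t * C - S| ≤ |Real.pi * t| ^ 3) :
    |(Q * C - t * p * S) / (Q * S + t * p * C) - B / D / t| ≤ 1 / p ^ 2 + 16 + 1 / p := by
  have hpi3 := Real.pi_gt_three
  have hpi4 := Real.pi_le_four
  have hBpos : 0 < B := by rw [hB]; positivity
  have hQpos : 0 < Q := lt_of_lt_of_le (by positivity) hQp
  have hDpos : 0 < D := by rw [hD]; positivity
  have htpos : 0 < |t| := abs_pos.2 ht0
  have hden0 : Q * S + t * p * C ≠ 0 := by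
    rw [← abs_pos]; exact lt_of_lt_of_le (by positivity) hden
  have e : (Q * C - t * p * S) / (Q * S + t * p * C) - B / D / t =
      (t ^ 2 * (p * l * C) + B * Q * (Real.pi * t * C - S) - t ^ 2 * (p * D * S)) /
        ((Q * S + t * p * C) * (D * t)) := by
    rw [div_div, div_sub_div _ _ hden0 (mul_ne_zero hDpos.ne' ht0)]
    congr 1
    rw [hQ, hD]
    ring
  have hcub' : |Real.pi * t * C - S| ≤ 32 * t ^ 2 := by
    refine hcub.trans ?_
    rw [abs_mul, abs_of_pos (by linarith : 0 < Real.pi), mul_pow, ← sq_abs t]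
    have h1 : Real.pi ^ 3 ≤ 4 ^ 3 := by gcongr
    have h2 : |t| ^ 3 ≤ 1 / 2 * |t| ^ 2 := by
      rw [pow_succ']; gcongr
    calc _ ≤ 4 ^ 3 * (1 / 2 * |t| ^ 2) := by gcongr
      _ = _ := by ring
  have hnum : |t ^ 2 * (p * l * C) + B * Q * (Real.pi * t * C - S) - t ^ 2 * (p * D * S)| ≤
      t ^ 2 * (p * l + 32 * (B * Q) + p * D) := by
    have h1 : |t ^ 2 * (p * l * C)| ≤ t ^ 2 * (p * l) := by
      rw [abs_mul, abs_mul, abs_of_nonneg (sq_nonneg t), abs_of_pos (mul_pos hp hl)]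
      exact mul_le_mul_of_nonneg_left (mul_le_of_le_one_right (mul_pos hp hl).le hC) (sq_nonneg t)
    have h2 : |B * Q * (Real.pi * t * C - S)| ≤ t ^ 2 * (32 * (B * Q)) := by
      rw [abs_mul, abs_of_pos (mul_pos hBpos hQpos)]
      nlinarith [mul_pos hBpos hQpos]
    have h3 : |t ^ 2 * (p * D * S)| ≤ t ^ 2 * (p * D) := by
      rw [abs_mul, abs_mul, abs_of_nonneg (sq_nonneg t), abs_of_pos (mul_pos hp hDpos)]
      exact mul_le_mul_of_nonneg_left (mul_le_of_le_one_right (mul_pos hp hDpos).le hS)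
        (sq_nonneg t)
    refine (abs_sub _ _).trans ?_
    have := abs_add_le (t ^ 2 * (p * l * C)) (B * Q * (Real.pi * t * C - S))
    linarith
  have hden2 : t ^ 2 * (2 * Q * D) ≤ |(Q * S + t * p * C) * (D * t)| := by
    rw [abs_mul, abs_mul, abs_of_pos hDpos, ← sq_abs t]
    calc |t| ^ 2 * (2 * Q * D) = 2 * Q * |t| * (D * |t|) := by ring
      _ ≤ _ := by gcongr
  have ht2 : 0 < t ^ 2 := by positivity
  rw [e, abs_div]
  calc _ ≤ t ^ 2 * (p * l + 32 * (B * Q) + p * D) / (t ^ 2 * (2 * Q * D)) :=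
        div_le_div₀ (by positivity) hnum (by positivity) hden2
    _ = p * l / (2 * Q * D) + 16 * (B / D) + p / (2 * Q) := by
        field_simp
        ring
    _ ≤ 1 / p ^ 2 + 16 + 1 / p := by
        have hBD : B ≤ D := by rw [hD]; nlinarith
        have hplD : p * l ≤ D := by
          refine le_trans ?_ hBD
          rw [hB]; nlinarith [sq_nonneg (p - l)]
        have i1 : p * l / (2 * Q * D) ≤ 1 / p ^ 2 := by
          rw [div_le_div_iff₀ (by positivity) (by positivity), one_mul]
          calc p * l * p ^ 2 ≤ D * Q := by gcongr
            _ ≤ 2 * Q * D := by nlinarith [mul_pos hQpos hDpos]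
        have i2 : B / D ≤ 1 := (div_le_one hDpos).2 hBD
        have i3 : p / (2 * Q) ≤ 1 / p := by
          rw [div_le_div_iff₀ (by positivity) hp]
          nlinarith
        linarith

/-- The expansion of the cotangent-like function at one of its poles, uniformly in the pole. -/
theorem abs_cot_sub_principal_le {p : ℝ} (hp : 0 < p) {l t : ℝ} (hl : 0 < l) (hr : IsRoot p l)
    (ht0 : t ≠ 0) (ht : |t| ≤ 1 / 2) (hw : 0 < l + t) :
    |(p * Real.cos (Real.pi * (l + t)) - (l + t) * Real.sin (Real.pi * (l + t))) /
      (p * Real.sin (Real.pi * (l + t)) + (l + t) * Real.cos (Real.pi * (l + t))) -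
      (p ^ 2 + l ^ 2) / (p + Real.pi * (p ^ 2 + l ^ 2)) / t| ≤ 1 / p ^ 2 + 16 + 1 / p := by
  have hpi := Real.pi_pos
  -- At a root the vector (sin πl, cos πl) is proportional to (-l, p); the factor k cancels from the
  -- quotient.
  obtain ⟨k, hk1, hk2⟩ : ∃ k, Real.sin (Real.pi * l) = -l * k ∧ Real.cos (Real.pi * l) = p * k := by
    refine ⟨Real.cos (Real.pi * l) / p, ?_, by field_simp⟩
    unfold IsRoot at hr
    field_simp
    linarith
  have hk : k ≠ 0 := by
    rintro rfl
    have := Real.sin_sq_add_cos_sq (Real.pi * l)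
    rw [hk1, hk2] at this
    simp at this
  have hQp : p ^ 2 ≤ p ^ 2 + l ^ 2 + l * t := by nlinarith [mul_pos hl hw]
  have hQpos : 0 < p ^ 2 + l ^ 2 + l * t := lt_of_lt_of_le (by positivity) hQp
  have hcub := abs_mul_cos_sub_sin_le (Real.pi * t)
  have hta := abs_le.1 ht
  have hC0 : 0 ≤ Real.cos (Real.pi * t) :=
    Real.cos_nonneg_of_mem_Icc ⟨by nlinarith, by nlinarith⟩
  have hSabs : 2 * |t| ≤ |Real.sin (Real.pi * t)| := by
    have := Real.mul_abs_le_abs_sin (x := Real.pi * t) (by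
      rw [abs_mul, abs_of_pos hpi]; nlinarith)
    rw [abs_mul, abs_of_pos hpi] at this
    rwa [← mul_assoc, div_mul_cancel₀ _ hpi.ne'] at this
  have hst : 0 ≤ Real.sin (Real.pi * t) * t := by
    rcases le_total 0 t with h | h
    · exact mul_nonneg (Real.sin_nonneg_of_nonneg_of_le_pi (by positivity) (by nlinarith)) h
    · exact mul_nonneg_of_nonpos_of_nonpos
        (Real.sin_nonpos_of_nonpos_of_neg_pi_le (by nlinarith) (by nlinarith)) h
  have hC1 := Real.abs_cos_le_one (Real.pi * t)
  have hS1 := Real.abs_sin_le_one (Real.pi * t)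
  have e1 : p * Real.cos (Real.pi * (l + t)) - (l + t) * Real.sin (Real.pi * (l + t)) =
      k * ((p ^ 2 + l ^ 2 + l * t) * Real.cos (Real.pi * t) - t * p * Real.sin (Real.pi * t)) := by
    rw [mul_add, Real.sin_add, Real.cos_add, hk1, hk2]
    ring
  have e2 : p * Real.sin (Real.pi * (l + t)) + (l + t) * Real.cos (Real.pi * (l + t)) =
      k * ((p ^ 2 + l ^ 2 + l * t) * Real.sin (Real.pi * t) + t * p * Real.cos (Real.pi * t)) := by
    rw [mul_add, Real.sin_add, Real.cos_add, hk1, hk2]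
    ring
  rw [e1, e2, mul_div_mul_left _ _ hk]
  refine abs_div_sub_div_le hp hl ht0 ht rfl rfl hQp rfl hC1 hS1 ?_ hcub
  generalize p ^ 2 + l ^ 2 + l * t = Q at *
  generalize Real.sin (Real.pi * t) = S at *
  generalize Real.cos (Real.pi * t) = C at *
  -- S and t have the same sign and C ≥ 0, so the two summands cannot cancel.
  have h1 : |Q * S| ≤ |Q * S + t * p * C| := by
    apply sq_le_sq.1
    have h2 : 0 ≤ (S * t) * (Q * p * C) := mul_nonneg hst (by positivity)
    have h3 : (Q * S + t * p * C) ^ 2 =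
      (Q * S) ^ 2 + 2 * ((S * t) * (Q * p * C)) + (t * p * C) ^ 2 := by ring
    rw [h3]
    linarith [sq_nonneg (t * p * C)]
  refine le_trans ?_ h1
  rw [abs_mul, abs_of_pos hQpos]
  calc 2 * Q * |t| = Q * (2 * |t|) := by ring
    _ ≤ _ := by gcongr

/-- The function `z^(n-1) / (σ(z) e^{2πz} - 1)`. -/
noncomputable def kerPow (p : ℝ) (n z : ℂ) : ℂ := z ^ (n - 1) * kerC p z

theorem exists_rpow_mul_exp_neg_le {c : ℝ} (hc : 0 < c) :
    ∃ M > 0, ∀ x : ℝ, 0 < x → x ^ c * Real.exp (-x) ≤ M := by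
  obtain ⟨δ, hδ, M, hM, h⟩ := exp_mul_exp_neg_exp_le hc
  refine ⟨M, hM, fun x hx => ?_⟩
  have := h (Real.log x)
  rw [Real.exp_log hx, mul_comm c, ← Real.rpow_def_of_pos hx] at this
  refine this.trans (mul_le_of_le_one_right hM.le (Real.exp_le_one_iff.2 ?_))
  have := mul_nonneg hδ.le (abs_nonneg (Real.log x))
  linarith

theorem norm_kerPow_le {p : ℝ} (hp : 0 < p) {n : ℂ} (hn : 1 ≤ n.re) :
    ∃ M > 0, ∀ z : ℂ, 0 < z.re → |z.im| ≤ z.re →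
      ‖kerPow p n z‖ ≤ M * (z.re ^ (n.re - 2) * Real.exp (-(2 * z.re))) := by
  have hpi := Real.pi_gt_three
  refine ⟨2 ^ (n.re - 1) * Real.exp (Real.pi * |n.im|), by positivity, fun z hz him => ?_⟩
  have h1 : ‖z ^ (n - 1)‖ ≤ 2 ^ (n.re - 1) * Real.exp (Real.pi * |n.im|) * z.re ^ (n.re - 1) := by
    refine (Complex.norm_cpow_le z (n - 1)).trans ?_
    have h2 : ‖z‖ ≤ 2 * z.re := by
      refine (Complex.norm_le_abs_re_add_abs_im z).trans ?_
      rw [abs_of_pos hz]; linarith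
    have h3 : ‖z‖ ^ (n - 1).re ≤ 2 ^ (n.re - 1) * z.re ^ (n.re - 1) := by
      rw [← Real.mul_rpow (by norm_num) hz.le]
      simp only [Complex.sub_re, Complex.one_re]
      exact Real.rpow_le_rpow (norm_nonneg _) h2 (by linarith)
    have h4 : -(Real.pi * |n.im|) ≤ Complex.arg z * (n - 1).im := by
      have : |Complex.arg z * n.im| ≤ Real.pi * |n.im| := by
        rw [abs_mul]; gcongr; exact Complex.abs_arg_le_pi z
      simp only [Complex.sub_im, Complex.one_im, sub_zero]
      exact (abs_le.1 this).1
    rw [div_eq_mul_inv, ← Real.exp_neg]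
    calc _ ≤ (2 ^ (n.re - 1) * z.re ^ (n.re - 1)) * Real.exp (Real.pi * |n.im|) := by
          gcongr; linarith
      _ = _ := by ring
  have h2 : ‖kerC p z‖ ≤ Real.exp (-(2 * z.re)) / z.re := by
    refine (norm_kerC_le hp hz).trans (div_le_div₀ (Real.exp_pos _).le ?_ hz ?_)
    · apply Real.exp_le_exp.2; nlinarith
    · nlinarith
  unfold kerPow
  rw [norm_mul]
  calc _ ≤ (2 ^ (n.re - 1) * Real.exp (Real.pi * |n.im|) * z.re ^ (n.re - 1)) *
        (Real.exp (-(2 * z.re)) / z.re) := by gcongr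
    _ = 2 ^ (n.re - 1) * Real.exp (Real.pi * |n.im|) *
        (z.re ^ (n.re - 1) / z.re * Real.exp (-(2 * z.re))) := by ring
    _ = _ := by
      rw [show n.re - 2 = n.re - 1 - 1 by ring, Real.rpow_sub_one hz.ne' (n.re - 1)]

/-- Half of the decay e^{-2 Re z} is spent on absorbing the power, whose exponent is positive since
Re n > 2. -/
theorem norm_kerPow_le_exp {p : ℝ} (hp : 0 < p) {n : ℂ} (hn : 2 < n.re) :
    ∃ M > 0, ∀ z : ℂ, 0 < z.re → |z.im| ≤ z.re → ‖kerPow p n z‖ ≤ M * Real.exp (-z.re) := by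
  obtain ⟨M, hM, h⟩ := norm_kerPow_le hp (n := n) (by linarith)
  obtain ⟨M₁, hM₁, h₁⟩ := exists_rpow_mul_exp_neg_le (sub_pos.2 hn)
  refine ⟨M * M₁, by positivity, fun z hz him => (h z hz him).trans ?_⟩
  rw [mul_assoc]
  refine mul_le_mul_of_nonneg_left ?_ hM.le
  rw [show -(2 * z.re) = -z.re + -z.re by ring, Real.exp_add, ← mul_assoc]
  exact mul_le_mul_of_nonneg_right (h₁ _ hz) (Real.exp_pos _).le

theorem differentiableAt_kerPow {p : ℝ} (hp : 0 < p) (n : ℂ) {z : ℂ} (hz : 0 < z.re) :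
    DifferentiableAt ℂ (kerPow p n) z := by
  have h1 : DifferentiableAt ℂ (fun z : ℂ => z ^ (n - 1)) z :=
    differentiableAt_id.cpow_const (Or.inl hz)
  exact h1.mul (differentiableAt_kerC (den_ne_zero hp hz))

/-- Schwarz's lemma on the ball of radius ρ about μ gives a Lipschitz bound; μ ≥ 2ρ keeps that ball
in the cone |Im z| ≤ Re z. When |x - μ| ≥ ρ, the triangle inequality suffices because |x - μ|/ρ ≥ 1.
-/
theorem norm_kerPow_sub_le {p : ℝ} (hp : 0 < p) {n : ℂ} (hn : 2 < n.re) {ρ : ℝ} (hρ : 0 < ρ) :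
    ∃ M > 0, ∀ x μ : ℝ, 2 * ρ ≤ μ → 0 < x → |x - μ| ≤ 2 * ρ →
      ‖kerPow p n x - kerPow p n μ‖ ≤ M * Real.exp (-x) * |x - μ| := by
  obtain ⟨M, hM, h⟩ := norm_kerPow_le_exp hp hn
  refine ⟨2 * M * Real.exp (2 * ρ) / ρ, by positivity, fun x μ hμ hx hxμ => ?_⟩
  have hexp : Real.exp (-μ) ≤ Real.exp (2 * ρ) * Real.exp (-x) := by
    rw [← Real.exp_add]; apply Real.exp_le_exp.2; linarith [(abs_le.1 hxμ).2]
  have hμ0 : 0 < μ := by linarith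
  rcases lt_or_ge |x - μ| ρ with h1 | h1
  · have hball : ∀ z ∈ Metric.ball (μ : ℂ) ρ, μ - ρ ≤ z.re ∧ |z.im| ≤ ρ := by
      intro z hz
      rw [Metric.mem_ball, dist_eq_norm] at hz
      have h2 := (Complex.abs_re_le_norm (z - μ)).trans hz.le
      have h3 := (Complex.abs_im_le_norm (z - μ)).trans hz.le
      simp only [Complex.sub_re, Complex.sub_im, Complex.ofReal_re, Complex.ofReal_im,
        sub_zero] at h2 h3
      exact ⟨by linarith [(abs_le.1 h2).1], h3⟩
    have hb2 : ∀ z ∈ Metric.ball (μ : ℂ) ρ, ‖kerPow p n z‖ ≤ M * Real.exp (-(μ - ρ)) := by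
      intro z hz
      obtain ⟨h2, h3⟩ := hball z hz
      refine (h z (by linarith) (by linarith)).trans ?_
      gcongr
    have hd : DifferentiableOn ℂ (kerPow p n) (Metric.ball (μ : ℂ) ρ) := fun z hz =>
      (differentiableAt_kerPow hp n (by linarith [(hball z hz).1])).differentiableWithinAt
    have hmaps : MapsTo (kerPow p n) (Metric.ball (μ : ℂ) ρ)
        (Metric.closedBall (kerPow p n μ) (2 * M * Real.exp (-(μ - ρ)))) := by
      intro z hz
      rw [Metric.mem_closedBall, dist_eq_norm]
      have := hb2 z hz
      have := hb2 μ (Metric.mem_ball_self hρ)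
      exact (norm_sub_le _ _).trans (by linarith)
    have hxb : (x : ℂ) ∈ Metric.ball (μ : ℂ) ρ := by
      rw [Metric.mem_ball, dist_eq_norm, ← Complex.ofReal_sub, Complex.norm_real]
      exact h1
    have := Complex.dist_le_div_mul_dist_of_mapsTo_ball hd hmaps hxb
    rw [dist_eq_norm, dist_eq_norm, ← Complex.ofReal_sub, Complex.norm_real,
      Real.norm_eq_abs] at this
    refine this.trans ?_
    have hexp2 : Real.exp (-(μ - ρ)) ≤ Real.exp (2 * ρ) * Real.exp (-x) := by
      rw [← Real.exp_add]; apply Real.exp_le_exp.2; linarith [(abs_lt.1 h1).2]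
    refine mul_le_mul_of_nonneg_right ?_ (abs_nonneg _)
    rw [div_mul_eq_mul_div, mul_assoc (2 * M) (Real.exp (2 * ρ))]
    exact div_le_div_of_nonneg_right (mul_le_mul_of_nonneg_left hexp2 (by positivity)) hρ.le
  · have h2 := h x (by simpa using hx) (by simpa using hx.le)
    have h3 := h μ (by simpa using hμ0) (by simpa using hμ0.le)
    simp only [Complex.ofReal_re] at h2 h3
    refine (norm_sub_le _ _).trans ((add_le_add h2 h3).trans ?_)
    have h4 : 1 ≤ Real.exp (2 * ρ) := Real.one_le_exp (by linarith)
    have h5 : 1 ≤ |x - μ| / ρ := (one_le_div hρ).2 h1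
    have h6 : 0 < Real.exp (-x) := Real.exp_pos _
    calc M * Real.exp (-x) + M * Real.exp (-μ) ≤
          M * (Real.exp (2 * ρ) * Real.exp (-x)) + M * (Real.exp (2 * ρ) * Real.exp (-x)) := by
          gcongr
          exact le_mul_of_one_le_left h6.le h4
      _ = 2 * M * Real.exp (2 * ρ) * Real.exp (-x) * 1 := by ring
      _ ≤ 2 * M * Real.exp (2 * ρ) * Real.exp (-x) * (|x - μ| / ρ) := by gcongr
      _ = _ := by ring

theorem weight_div_pi (p : ℝ) (j : ℕ) : weight p j / Real.pi =
    (p ^ 2 + lam p j ^ 2) / (p + Real.pi * (p ^ 2 + lam p j ^ 2)) := by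
  have hpi := Real.pi_pos
  unfold weight
  rw [div_div]
  congr 1
  field_simp
  ring

theorem weight_div_pi_mem {p : ℝ} (hp : 0 < p) (j : ℕ) :
    0 ≤ weight p j / Real.pi ∧ weight p j / Real.pi ≤ 1 := by
  have hpi := Real.pi_gt_three
  rw [weight_div_pi]
  have h : 0 < p ^ 2 + lam p j ^ 2 := by positivity
  refine ⟨by positivity, ?_⟩
  rw [div_le_one (by positivity)]
  nlinarith

theorem res_eq (p : ℝ) (n : ℂ) (b : ℝ) (j : ℕ) : res p n b j =
    -Complex.I * ((weight p j / Real.pi / b : ℝ) : ℂ) * kerPow p n ((lam p j / b : ℝ) : ℂ) := by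
  unfold res kerPow
  push_cast
  ring

theorem norm_res {p : ℝ} (hp : 0 < p) (n : ℂ) {b : ℝ} (hb : 0 < b) (j : ℕ) :
    ‖res p n b j‖ ≤ 1 / b * ‖kerPow p n ((lam p j / b : ℝ) : ℂ)‖ := by
  obtain ⟨h1, h2⟩ := weight_div_pi_mem hp j
  rw [res_eq, norm_mul, norm_mul, norm_neg, Complex.norm_I, one_mul, Complex.norm_real,
    Real.norm_eq_abs, abs_of_nonneg (div_nonneg h1 hb.le)]
  gcongr

/-- Away from its poles on the blocks, the cotangent-like function is bounded. -/
theorem abs_cot_le {p : ℝ} (hp : 0 < p) {j : ℕ} (hj : 1 ≤ j) {w : ℝ} (h1 : (j : ℝ) - 1 < w)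
    (h2 : w ≤ j - 1 / 2) :
    |(p * Real.cos (Real.pi * w) - w * Real.sin (Real.pi * w)) /
      (p * Real.sin (Real.pi * w) + w * Real.cos (Real.pi * w))| ≤ (p + w) * (1 / p + 1 / w) := by
  have hpi := Real.pi_pos
  have hj1 : (1 : ℝ) ≤ j := by exact_mod_cast hj
  have hw : 0 < w := by linarith
  set s := Real.pi * (w - (j - 1 : ℕ)) with hs
  have hcast : ((j - 1 : ℕ) : ℝ) = j - 1 := by push_cast [hj]; rfl
  have hs0 : 0 ≤ s := by rw [hs, hcast]; apply mul_nonneg hpi.le; linarith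
  have hs1 : s ≤ Real.pi / 2 := by rw [hs, hcast]; nlinarith
  have hsin : 0 ≤ Real.sin s := Real.sin_nonneg_of_nonneg_of_le_pi hs0 (by linarith)
  have hcos : 0 ≤ Real.cos s := Real.cos_nonneg_of_mem_Icc ⟨by linarith, hs1⟩
  have hsc : 1 ≤ Real.sin s + Real.cos s := by
    nlinarith [Real.sin_sq_add_cos_sq s, mul_nonneg hsin hcos]
  have e : Real.pi * w = s + (j - 1 : ℕ) * Real.pi := by rw [hs]; ring
  rw [e, Real.sin_add_nat_mul_pi, Real.cos_add_nat_mul_pi]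
  set ε : ℝ := (-1) ^ (j - 1) with hε
  have hε0 : ε ≠ 0 := pow_ne_zero _ (by norm_num)
  have e1 : p * (ε * Real.cos s) - w * (ε * Real.sin s) =
      ε * (p * Real.cos s - w * Real.sin s) := by ring
  have e2 : p * (ε * Real.sin s) + w * (ε * Real.cos s) =
      ε * (p * Real.sin s + w * Real.cos s) := by ring
  rw [e1, e2, mul_div_mul_left _ _ hε0]
  have hden : p * w / (p + w) ≤ p * Real.sin s + w * Real.cos s := by
    rw [div_le_iff₀ (by positivity)]
    have : 0 < p * w := mul_pos hp hw
    nlinarith [mul_nonneg (mul_nonneg hp.le hp.le) hsin, mul_nonneg (mul_nonneg hw.le hw.le) hcos]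
  have hnum : |p * Real.cos s - w * Real.sin s| ≤ p + w := by
    have h3 := Real.cos_le_one s
    have h4 := Real.sin_le_one s
    rw [abs_le]; constructor <;> nlinarith
  have hd0 : 0 < p * w / (p + w) := by positivity
  rw [abs_div, abs_of_pos (hd0.trans_le hden)]
  calc _ ≤ (p + w) / (p * w / (p + w)) := div_le_div₀ (by positivity) hnum hd0 hden
    _ = _ := by field_simp; ring

/-- The principal part of `pvFun` on the block containing `x`. -/
noncomputable def prin (p : ℝ) (n : ℂ) (b x : ℝ) : ℂ :=
  res p n b ⌈b * x⌉₊ / ((x : ℂ) - (lam p ⌈b * x⌉₊ / b : ℝ))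

/-- The index ⌈bx⌉ names the block ((j - 1)/b, j/b] that contains x, so the pole assigned to x is at
distance less than 1/b. -/
theorem lam_ceil {p : ℝ} (hp : 0 < p) {b x : ℝ} (hb : 0 < b) (hx : 0 < x) :
    1 ≤ ⌈b * x⌉₊ ∧ (⌈b * x⌉₊ : ℝ) - 1 < b * x ∧ b * x ≤ ⌈b * x⌉₊ ∧
      1 / (2 * b) ≤ lam p ⌈b * x⌉₊ / b ∧ |x - lam p ⌈b * x⌉₊ / b| < 1 / b ∧
      x < lam p ⌈b * x⌉₊ / b + 1 / (2 * b) := by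
  have hbx : 0 < b * x := mul_pos hb hx
  have h1 : 1 ≤ ⌈b * x⌉₊ := Nat.one_le_ceil_iff.2 hbx
  have h2 := Nat.le_ceil (b * x)
  have h3 := Nat.ceil_lt_add_one hbx.le
  obtain ⟨h4, h5, -⟩ := lam_spec hp h1
  have h1' : (1 : ℝ) ≤ ⌈b * x⌉₊ := by exact_mod_cast h1
  refine ⟨h1, by linarith, h2, ?_, ?_, ?_⟩
  · rw [div_le_div_iff₀ (by positivity) hb]; nlinarith
  · have : x - lam p ⌈b * x⌉₊ / b = (b * x - lam p ⌈b * x⌉₊) / b := by field_simp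
    rw [this, abs_div, abs_of_pos hb]
    refine div_lt_div_of_pos_right ?_ hb
    rw [abs_lt]; constructor <;> linarith
  · have : lam p ⌈b * x⌉₊ / b + 1 / (2 * b) = (lam p ⌈b * x⌉₊ + 1 / 2) / b := by field_simp
    rw [this, lt_div_iff₀ hb]; linarith

theorem norm_res_ceil_le {p : ℝ} (hp : 0 < p) {n : ℂ} (hn : 2 < n.re) {b : ℝ} (hb : 0 < b) :
    ∃ M > 0, ∀ x : ℝ, 0 < x → ‖res p n b ⌈b * x⌉₊‖ ≤ M * Real.exp (-x) := by
  obtain ⟨M, hM, h⟩ := norm_kerPow_le_exp hp hn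
  refine ⟨1 / b * (M * Real.exp (1 / (2 * b))), by positivity, fun x hx => ?_⟩
  obtain ⟨h1, -, -, h4, -, h6⟩ := lam_ceil hp hb hx
  have hμ : 0 < lam p ⌈b * x⌉₊ / b := lt_of_lt_of_le (by positivity) h4
  have h7 := h (lam p ⌈b * x⌉₊ / b : ℝ) (by simpa using hμ) (by simpa using hμ.le)
  rw [Complex.ofReal_re] at h7
  refine (norm_res hp n hb _).trans ?_
  rw [mul_assoc]
  refine mul_le_mul_of_nonneg_left (h7.trans ?_) (by positivity)
  rw [mul_assoc, ← Real.exp_add]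
  gcongr
  linarith

theorem pvFun_eq_kerPow_mul (p : ℝ) (n : ℂ) (b x : ℝ) : pvFun p n b x =
    kerPow p n x * (-Complex.I * (((p * Real.cos (Real.pi * (b * x)) -
      (b * x) * Real.sin (Real.pi * (b * x))) / (p * Real.sin (Real.pi * (b * x)) +
      (b * x) * Real.cos (Real.pi * (b * x))) : ℝ) : ℂ)) := by
  rw [← cothC_I_mul]
  unfold pvFun kerPow
  push_cast
  ring_nf

/-- With H = `kerPow`, c = w_j/π, μ the pole and T the cotangent-like factor, within distance 1/2 of
the pole (measured in bx) the difference is -i times H(x)(T - c/(bx - λ_j)) + (c/b)(H(x) - H(μ))/(x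
- μ): the first term is controlled by the uniform expansion of T, the second by the Lipschitz bound.
Farther away the integrand and the principal part are bounded separately; the power x^{Re n - 3} is
needed for the singularity at 0. -/
theorem norm_pvFun_sub_prin_le {p : ℝ} (hp : 0 < p) {n : ℂ} (hn : 2 < n.re) {b : ℝ}
    (hb : 0 < b) : ∃ M > 0, ∀ x : ℝ, 0 < x → ‖pvFun p n b x - prin p n b x‖ ≤
      M * (Real.exp (-x) * (x ^ (n.re - 3) + 1)) := by
  obtain ⟨M, hM, hH⟩ := norm_kerPow_le hp (n := n) (by linarith)
  obtain ⟨M₁, hM₁, h₁⟩ := exists_rpow_mul_exp_neg_le (show 0 < n.re - 2 by linarith)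
  obtain ⟨M₂, hM₂, h₂⟩ := exists_rpow_mul_exp_neg_le (show 0 < n.re - 1 by linarith)
  obtain ⟨M₃, hM₃, h₃⟩ := norm_kerPow_sub_le hp hn (show 0 < 1 / (4 * b) by positivity)
  obtain ⟨M₄, hM₄, h₄⟩ := norm_res_ceil_le hp hn hb
  set K : ℝ := 1 / p ^ 2 + 16 + 1 / p with hK
  have hK0 : 0 < K := by positivity
  refine ⟨M * M₁ * K + M₃ / b + M * (2 * M₁ + b / p * M₂ + p / b) + M₄ * (2 * b),
    by positivity, fun x hx => ?_⟩
  obtain ⟨hj, hc1, hc2, hc3, hc4, hc5⟩ := lam_ceil hp hb hx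
  have hHx := hH x (by simpa using hx) (by simpa using hx.le)
  rw [Complex.ofReal_re] at hHx
  have hrx := h₄ x hx
  unfold prin
  set j := ⌈b * x⌉₊
  set μ := lam p j / b with hμ
  have he := Real.exp_pos (-x)
  have hx3 : 0 < x ^ (n.re - 3) := by positivity
  have hbx : 0 < b * x := by positivity
  have hl := lam_pos hp hj
  have h2x : Real.exp (-(2 * x)) = Real.exp (-x) * Real.exp (-x) := by
    rw [← Real.exp_add]; ring_nf
  have e1le : Real.exp (-x) ≤ 1 := Real.exp_le_one_iff.2 (by linarith)
  have hHx1 : ‖kerPow p n x‖ ≤ M * M₁ * Real.exp (-x) := by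
    refine hHx.trans ?_
    rw [h2x, mul_assoc M M₁]
    refine mul_le_mul_of_nonneg_left ?_ hM.le
    rw [← mul_assoc]
    exact mul_le_mul_of_nonneg_right (h₁ x hx) he.le
  have hgrow : Real.exp (-x) ≤ Real.exp (-x) * (x ^ (n.re - 3) + 1) :=
    le_mul_of_one_le_right he.le (by linarith)
  rcases le_or_gt |b * x - lam p j| (1 / 2) with hcore | hcore
  · have hxμ : |x - μ| ≤ 2 * (1 / (4 * b)) := by
      have : x - μ = (b * x - lam p j) / b := by rw [hμ]; field_simp
      rw [this, abs_div, abs_of_pos hb, div_le_iff₀ hb]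
      refine hcore.trans (le_of_eq ?_)
      field_simp
      norm_num
    have hdiff := h₃ x μ (le_trans (le_of_eq (by field_simp; norm_num)) hc3) hx hxμ
    -- At the pole itself both terms have the default value 0 of a division by zero.
    rcases eq_or_ne x μ with hxe | hxe
    · have : den p (Complex.I * b * x) = 0 := by
        have h5 : Complex.I * b * x = Complex.I * lam p j := by
          have : (b : ℂ) ≠ 0 := by exact_mod_cast hb.ne'
          rw [hxe, hμ]; push_cast; field_simp
        rw [h5, den_lam hp hj]
      have h0 : pvFun p n b x = 0 := by simp [pvFun, cothC, this]
      rw [h0, ← hxe]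
      simp only [sub_self, div_zero, norm_zero]
      positivity
    have ht0 : b * x - lam p j ≠ 0 := by
      intro h; apply hxe; rw [hμ, eq_div_iff hb.ne']; linarith
    have hxμ0 : (x : ℂ) - (μ : ℝ) ≠ 0 := by
      rw [← Complex.ofReal_sub]; exact_mod_cast sub_ne_zero.2 hxe
    have hcot := abs_cot_sub_principal_le hp hl (lam_spec hp hj).2.2 ht0 hcore (by linarith)
    rw [add_sub_cancel, ← weight_div_pi] at hcot
    obtain ⟨hc0, hc1'⟩ := weight_div_pi_mem hp j
    have hxeq := pvFun_eq_kerPow_mul p n b x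
    set c := weight p j / Real.pi with hc
    set T := (p * Real.cos (Real.pi * (b * x)) - (b * x) * Real.sin (Real.pi * (b * x))) /
      (p * Real.sin (Real.pi * (b * x)) + (b * x) * Real.cos (Real.pi * (b * x)))
    have hb0 : (b : ℂ) ≠ 0 := by exact_mod_cast hb.ne'
    have key : pvFun p n b x - res p n b j / ((x : ℂ) - (μ : ℝ)) =
        -Complex.I * (kerPow p n x * ((T - c / (b * x - lam p j) : ℝ) : ℂ) +
          ((c / b : ℝ) : ℂ) * ((kerPow p n x - kerPow p n μ) / ((x : ℂ) - (μ : ℝ)))) := by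
      have h5 : c / (b * x - lam p j) = c / b / (x - μ) := by
        have h6 : b * x - lam p j = b * (x - μ) := by rw [hμ]; field_simp
        rw [h6, div_div c b]
      have h7 : res p n b j = -Complex.I * ((c / b : ℝ) : ℂ) * kerPow p n (μ : ℝ) :=
        res_eq p n b j
      rw [hxeq, h7, h5]
      push_cast
      field_simp
      ring
    rw [key, norm_mul, norm_neg, Complex.norm_I, one_mul]
    refine (norm_add_le _ _).trans ?_
    rw [norm_mul, norm_mul, norm_div, Complex.norm_real, Complex.norm_real, ← Complex.ofReal_sub,
      Complex.norm_real, Real.norm_eq_abs, Real.norm_eq_abs, Real.norm_eq_abs]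
    have t1 : ‖kerPow p n x‖ * |T - c / (b * x - lam p j)| ≤ M * M₁ * Real.exp (-x) * K := by
      gcongr
    have t2 : ‖kerPow p n x - kerPow p n μ‖ / |x - μ| ≤ M₃ * Real.exp (-x) :=
      (div_le_iff₀ (abs_pos.2 (sub_ne_zero.2 hxe))).2 hdiff
    have t3 : |c / b| ≤ 1 / b := by
      rw [abs_of_nonneg (div_nonneg hc0 hb.le)]; gcongr
    have t4 : |c / b| * (‖kerPow p n x - kerPow p n μ‖ / |x - μ|) ≤
        1 / b * (M₃ * Real.exp (-x)) := by gcongr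
    have t5 : 0 ≤ M * (2 * M₁ + b / p * M₂ + p / b) + M₄ * (2 * b) := by positivity
    calc _ ≤ (M * M₁ * K + M₃ / b) * Real.exp (-x) := by
          have : 1 / b * (M₃ * Real.exp (-x)) = M₃ / b * Real.exp (-x) := by ring
          linarith
      _ ≤ (M * M₁ * K + M₃ / b + M * (2 * M₁ + b / p * M₂ + p / b) + M₄ * (2 * b)) *
          Real.exp (-x) := mul_le_mul_of_nonneg_right (by linarith) he.le
      _ ≤ _ := by gcongr
  · obtain ⟨hs1, hs2, -⟩ := lam_spec hp hj
    -- Since λ_j > j - 1/2 and bx ≤ j, a point of the block far from the pole can only lie to its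
    -- left, where `abs_cot_le` applies.
    have hneg : b * x - lam p j < -(1 / 2) := by
      rcases lt_abs.1 hcore with h | h <;> linarith
    have hcot := abs_cot_le hp hj hc1 (by linarith : b * x ≤ (j : ℝ) - 1 / 2)
    have hf : ‖pvFun p n b x‖ ≤ M * (2 * M₁ + b / p * M₂ + p / b) *
        (Real.exp (-x) * (x ^ (n.re - 3) + 1)) := by
      rw [pvFun_eq_kerPow_mul, norm_mul, norm_mul, norm_neg, Complex.norm_I, one_mul,
        Complex.norm_real, Real.norm_eq_abs]
      have p1 : x ^ (n.re - 1) = x ^ (n.re - 2) * x := by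
        rw [show n.re - 1 = n.re - 2 + 1 by ring, Real.rpow_add_one hx.ne']
      have p2 : x ^ (n.re - 2) = x ^ (n.re - 3) * x := by
        rw [show n.re - 2 = n.re - 3 + 1 by ring, Real.rpow_add_one hx.ne']
      have q1 := h₁ x hx
      have q2 := h₂ x hx
      calc _ ≤ M * (x ^ (n.re - 2) * Real.exp (-(2 * x))) *
            ((p + b * x) * (1 / p + 1 / (b * x))) := by gcongr
        _ = M * Real.exp (-x) * (2 * (x ^ (n.re - 2) * Real.exp (-x)) +
            b / p * (x ^ (n.re - 1) * Real.exp (-x)) +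
            p / b * (x ^ (n.re - 3) * Real.exp (-x))) := by
            rw [h2x, p1, p2]; field_simp; ring
        _ ≤ M * Real.exp (-x) * (2 * M₁ + b / p * M₂ + p / b * (x ^ (n.re - 3) * 1)) := by gcongr
        _ ≤ M * Real.exp (-x) *
            ((2 * M₁ + b / p * M₂ + p / b) * (x ^ (n.re - 3) + 1)) := by
            gcongr
            have : 0 < (2 * M₁ + b / p * M₂) := by positivity
            have : 0 < p / b := by positivity
            nlinarith
        _ = _ := by ring
    have hr : ‖res p n b j / ((x : ℂ) - (μ : ℝ))‖ ≤ M₄ * (2 * b) *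
        (Real.exp (-x) * (x ^ (n.re - 3) + 1)) := by
      rw [norm_div, ← Complex.ofReal_sub, Complex.norm_real, Real.norm_eq_abs]
      have hfar : 1 / (2 * b) ≤ |x - μ| := by
        have : x - μ = (b * x - lam p j) / b := by rw [hμ]; field_simp
        rw [this, abs_div, abs_of_pos hb, le_div_iff₀ hb]
        refine le_trans (le_of_eq ?_) hcore.le
        field_simp
      calc _ ≤ M₄ * Real.exp (-x) / (1 / (2 * b)) :=
            div_le_div₀ (by positivity) hrx (by positivity) hfar
        _ = M₄ * (2 * b) * Real.exp (-x) := by field_simp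
        _ ≤ _ := by gcongr
    refine (norm_sub_le _ _).trans ((add_le_add hf hr).trans ?_)
    rw [← add_mul]
    have : 0 < M * M₁ * K + M₃ / b := by positivity
    gcongr
    linarith

theorem integrableOn_exp_neg_mul_rpow_add_one {a : ℝ} (ha : 2 < a) :
    IntegrableOn (fun x : ℝ => Real.exp (-x) * (x ^ (a - 3) + 1)) (Ioi 0) := by
  have h1 := Real.GammaIntegral_convergent (sub_pos.2 ha)
  have h2 := integrableOn_exp_neg_Ioi 0
  refine (h1.add h2).congr_fun (fun x _ => ?_) measurableSet_Ioi
  simp only [Pi.add_apply]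
  rw [show a - 2 - 1 = a - 3 by ring]
  ring

theorem measurable_pvFun (p : ℝ) (n : ℂ) (b : ℝ) : Measurable (fun x : ℝ => pvFun p n b x) := by
  have h1 := measurable_kerC p
  have h2 := measurable_cothC p
  unfold pvFun
  fun_prop

theorem measurable_prin (p : ℝ) (n : ℂ) (b : ℝ) : Measurable (prin p n b) := by
  unfold prin
  have h : Measurable (fun x : ℝ => ⌈b * x⌉₊) := Nat.measurable_ceil.comp (by fun_prop)
  have h1 : Measurable (fun x : ℝ => res p n b ⌈b * x⌉₊) :=
    (measurable_from_nat (f := res p n b)).comp h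
  have h2 : Measurable (fun x : ℝ => (((lam p ⌈b * x⌉₊) / b : ℝ) : ℂ)) :=
    (measurable_from_nat (f := fun j => ((lam p j / b : ℝ) : ℂ))).comp h
  fun_prop

/-- `pvFun` with the principal parts at its poles removed. -/
noncomputable def reg (p : ℝ) (n : ℂ) (b x : ℝ) : ℂ := pvFun p n b x - prin p n b x

theorem integrableOn_reg {p : ℝ} (hp : 0 < p) {n : ℂ} (hn : 2 < n.re) {b : ℝ} (hb : 0 < b) :
    IntegrableOn (reg p n b) (Ioi 0) := by
  obtain ⟨M, hM, h⟩ := norm_pvFun_sub_prin_le hp hn hb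
  refine ((integrableOn_exp_neg_mul_rpow_add_one hn).const_mul M).mono'
    ((measurable_pvFun p n b).sub (measurable_prin p n b)).aestronglyMeasurable ?_
  exact (ae_restrict_mem measurableSet_Ioi).mono fun x hx => h x hx

theorem intervalIntegrable_reg {p : ℝ} (hp : 0 < p) {n : ℂ} (hn : 2 < n.re) {b : ℝ} (hb : 0 < b)
    {a c : ℝ} (ha : 0 ≤ a) (hac : a ≤ c) : IntervalIntegrable (reg p n b) volume a c := by
  rw [intervalIntegrable_iff_integrableOn_Ioc_of_le hac]
  exact (integrableOn_reg hp hn hb).mono_set fun x hx => ha.trans_lt hx.1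

theorem ceil_eq_of_mem {b : ℝ} (hb : 0 < b) {j : ℕ} (hj : 1 ≤ j) {x : ℝ}
    (h1 : ((j : ℝ) - 1) / b < x) (h2 : x ≤ j / b) : ⌈b * x⌉₊ = j := by
  rw [Nat.ceil_eq_iff (by omega)]
  rw [div_lt_iff₀ hb] at h1
  rw [le_div_iff₀ hb] at h2
  push_cast [hj]
  constructor <;> linarith

theorem prin_eq_of_mem (p : ℝ) (n : ℂ) {b : ℝ} (hb : 0 < b) {j : ℕ} (hj : 1 ≤ j) {x : ℝ}
    (h1 : ((j : ℝ) - 1) / b < x) (h2 : x ≤ j / b) :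
    prin p n b x = res p n b j / ((x : ℂ) - (lam p j / b : ℝ)) := by
  unfold prin
  rw [ceil_eq_of_mem hb hj h1 h2]

/-! ### Assembling the blocks -/

/-- The principal value of `1 / (x - λ_j / b)` over the `j`-th block. -/
noncomputable def logRatio (p b : ℝ) (j : ℕ) : ℝ :=
  Real.log ((j / b - lam p j / b) / (lam p j / b - (j - 1) / b))

/-- The integral over the ray up to radius `c`. -/
noncomputable def rayUpTo (p : ℝ) (n : ℂ) (b c : ℝ) : ℂ :=
  ∫ x in Iic (Real.log c), pvExp p n b (x + (Real.pi / 4 : ℝ) * Complex.I)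

theorem abs_pi_div_four : |Real.pi / 4| = Real.pi / 4 := abs_of_pos (by positivity)

theorem lam_div_mem {p : ℝ} (hp : 0 < p) {b : ℝ} (hb : 0 < b) {j : ℕ} (hj : 1 ≤ j) :
    ((j : ℝ) - 1) / b < lam p j / b ∧ lam p j / b < j / b := by
  obtain ⟨h1, h2, -⟩ := lam_spec hp hj
  exact ⟨div_lt_div_of_pos_right (by linarith) hb, div_lt_div_of_pos_right h2 hb⟩

theorem block_contour_reg {p : ℝ} (hp : 0 < p) (n : ℂ) {b : ℝ} (hb : 0 < b) {j : ℕ}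
    (hj : 1 ≤ j) {a : ℝ} (ha : 0 < a) (h1 : ((j : ℝ) - 1) / b ≤ a) (h2 : a < lam p j / b) :
    (∫ x in a..(j / b), reg p n b x) +
      res p n b j * (Real.log ((j / b - lam p j / b) / (lam p j / b - a)) - Real.pi * Complex.I) =
    rayPart p n b a (j / b) + arcInt p n b a - arcInt p n b (j / b) := by
  obtain ⟨h3, h4⟩ := lam_div_mem hp hb hj
  rw [← block_contour hp n hb hj ha h1 h2 h4 le_rfl]
  congr 1
  apply intervalIntegral.integral_congr_ae
  refine Eventually.of_forall fun x hx => ?_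
  rw [uIoc_of_le (h2.trans h4).le] at hx
  rw [reg, prin_eq_of_mem p n hb hj (h1.trans_lt hx.1) hx.2]

/-- This block reaches down to the singular point 0, so its contour identity is the limit a → 0+ of
the truncated ones; the inner arc vanishes. -/
theorem first_block {p : ℝ} (hp : 0 < p) {n : ℂ} (hn : 2 < n.re) {b : ℝ} (hb : 0 < b) :
    (∫ x in (0 : ℝ)..((1 : ℕ) / b), reg p n b x) +
      res p n b 1 * (logRatio p b 1 - Real.pi * Complex.I) =
    rayUpTo p n b ((1 : ℕ) / b) - arcInt p n b ((1 : ℕ) / b) := by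
  obtain ⟨h3, h4⟩ := lam_div_mem hp hb le_rfl
  have hμ : 0 < lam p 1 / b := div_pos (lam_pos hp le_rfl) hb
  set c : ℝ := (1 : ℕ) / b with hc
  have hc0 : 0 < c := hμ.trans h4
  have hev : ∀ᶠ a in 𝓝[>] (0 : ℝ), (∫ x in a..c, reg p n b x) +
      res p n b 1 * (Real.log ((c - lam p 1 / b) / (lam p 1 / b - a)) - Real.pi * Complex.I) =
      rayPart p n b a c + arcInt p n b a - arcInt p n b c := by
    filter_upwards [Ioo_mem_nhdsGT hμ] with a ha
    exact block_contour_reg hp n hb le_rfl ha.1 (by simp [ha.1.le]) ha.2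
  have l1 : Tendsto (fun a => ∫ x in a..c, reg p n b x) (𝓝[>] 0)
      (𝓝 (∫ x in (0 : ℝ)..c, reg p n b x)) := by
    have hi := intervalIntegrable_reg hp hn hb le_rfl hc0.le
    have h5 : ContinuousOn (fun x => ∫ t in x..c, reg p n b t) (uIcc 0 c) := by
      apply intervalIntegral.continuousOn_primitive_interval_left
      rw [uIcc_of_le hc0.le, integrableOn_Icc_iff_integrableOn_Ioc]
      exact (intervalIntegrable_iff_integrableOn_Ioc_of_le hc0.le).1 hi
    have h6 := h5 0 left_mem_uIcc
    rw [uIcc_of_le hc0.le] at h6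
    exact h6.tendsto.mono_left (nhdsWithin_le_of_mem (by
      filter_upwards [Ioo_mem_nhdsGT hc0] with a ha using ⟨ha.1.le, ha.2.le⟩))
  have l2 : Tendsto (fun a : ℝ => res p n b 1 * ((Real.log ((c - lam p 1 / b) /
      (lam p 1 / b - a)) : ℂ) - Real.pi * Complex.I)) (𝓝[>] 0)
      (𝓝 (res p n b 1 * (logRatio p b 1 - Real.pi * Complex.I))) := by
    have h5 : ContinuousAt (fun a : ℝ => Real.log ((c - lam p 1 / b) / (lam p 1 / b - a))) 0 := by
      apply ContinuousAt.log
      · exact continuousAt_const.div (by fun_prop) (by simpa using hμ.ne')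
      · rw [sub_zero]; exact (div_pos (sub_pos.2 h4) hμ).ne'
    have h6 : logRatio p b 1 = Real.log ((c - lam p 1 / b) / (lam p 1 / b - 0)) := by
      simp [logRatio, hc]
    rw [h6]
    exact ((((Complex.continuous_ofReal.continuousAt.comp h5).tendsto).sub_const _).const_mul
      _).mono_left nhdsWithin_le_nhds
  have l3 : Tendsto (fun a => rayPart p n b a c) (𝓝[>] 0) (𝓝 (rayUpTo p n b c)) :=
    intervalIntegral_tendsto_integral_Iic _ (integrable_pvExp hp hn hb abs_pi_div_four).integrableOn
      Real.tendsto_log_nhdsGT_zero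
  have l4 := (l3.add (tendsto_arcInt_zero hp hn hb)).sub_const (arcInt p n b c)
  rw [add_zero] at l4
  exact tendsto_nhds_unique (((l1.add l2).congr' hev)) l4

/-- The outer arc of each block cancels the inner arc of the next, leaving a single arc at the last
radius. -/
theorem finite_blocks {p : ℝ} (hp : 0 < p) {n : ℂ} (hn : 2 < n.re) {b : ℝ} (hb : 0 < b) (N : ℕ) :
    (∫ x in (0 : ℝ)..((N + 1 : ℕ) / b), reg p n b x) +
      ∑ j ∈ Finset.range (N + 1), res p n b (j + 1) * (logRatio p b (j + 1) - Real.pi * Complex.I) =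
    rayUpTo p n b ((N + 1 : ℕ) / b) - arcInt p n b ((N + 1 : ℕ) / b) := by
  induction N with
  | zero => simpa using first_block hp hn hb
  | succ N ih =>
    have hN : (0 : ℝ) < (N + 1 : ℕ) := by positivity
    have ha : 0 < ((N + 1 : ℕ) : ℝ) / b := div_pos hN hb
    have hcast : (((N + 1 + 1 : ℕ) : ℝ) - 1) / b = ((N + 1 : ℕ) : ℝ) / b := by push_cast; ring
    obtain ⟨h1, h2⟩ := lam_div_mem hp hb (j := N + 1 + 1) (by omega)
    have hblock := block_contour_reg hp n hb (j := N + 1 + 1) (by omega) ha hcast.le (hcast ▸ h1)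
    have hac : ((N + 1 : ℕ) : ℝ) / b ≤ ((N + 1 + 1 : ℕ) : ℝ) / b := by
      rw [← hcast]; exact (h1.trans h2).le
    have hsplit := intervalIntegral.integral_add_adjacent_intervals
      (intervalIntegrable_reg hp hn hb le_rfl ha.le) (intervalIntegrable_reg hp hn hb ha.le hac)
    have hI := (integrable_pvExp hp hn hb abs_pi_div_four)
    have hray : rayUpTo p n b ((N + 1 + 1 : ℕ) / b) - rayUpTo p n b ((N + 1 : ℕ) / b) =
        rayPart p n b ((N + 1 : ℕ) / b) ((N + 1 + 1 : ℕ) / b) :=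
      intervalIntegral.integral_Iic_sub_Iic hI.integrableOn hI.integrableOn
    have hlr : logRatio p b (N + 1 + 1) = Real.log ((((N + 1 + 1 : ℕ) : ℝ) / b -
        lam p (N + 1 + 1) / b) / (lam p (N + 1 + 1) / b - ((N + 1 : ℕ) : ℝ) / b)) := by
      rw [logRatio, hcast]
    rw [Finset.sum_range_succ, ← hsplit, hlr]
    linear_combination ih + hblock - hray

/-! ### Existence and value of the principal value -/

/-- For u = j - λ_j the equation reads λ_j cos πu = p sin πu. From λ_j > 1/2, cos πu ≥ 1 - 2u and
sin πu ≤ πu one gets 1/2 - u ≤ πpu. The gap does not depend on j, so one ε keeps every removed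
interval inside its own block. -/
theorem lam_gap {p : ℝ} (hp : 0 < p) {j : ℕ} (hj : 1 ≤ j) :
    1 / (2 * (Real.pi * p + 1)) ≤ j - lam p j := by
  obtain ⟨h1, h2, h3⟩ := lam_spec hp hj
  have hpi := Real.pi_pos
  have hj1 : (1 : ℝ) ≤ j := by exact_mod_cast hj
  rw [isRoot_iff_shift p _ j] at h3
  set u := j - lam p j with hu
  have e : Real.pi * (lam p j - j) = -(Real.pi * u) := by rw [hu]; ring
  rw [e, Real.sin_neg, Real.cos_neg] at h3
  have hu0 : 0 < u := by rw [hu]; linarith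
  have hu1 : u < 1 / 2 := by rw [hu]; linarith
  have hsin : Real.sin (Real.pi * u) ≤ Real.pi * u := Real.sin_le (by positivity)
  have hcos : 1 - 2 * u ≤ Real.cos (Real.pi * u) := by
    have := Real.one_sub_mul_le_cos (x := Real.pi * u) (by positivity) (by nlinarith)
    have h5 : 2 / Real.pi * (Real.pi * u) = 2 * u := by field_simp
    linarith
  have hl : 1 / 2 < lam p j := by linarith
  rw [div_le_iff₀ (by positivity)]
  have h6 : p * Real.sin (Real.pi * u) ≤ p * (Real.pi * u) := by gcongr
  have h7 : 1 / 2 * (1 - 2 * u) ≤ lam p j * Real.cos (Real.pi * u) := by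
    apply mul_le_mul hl.le hcos <;> linarith
  nlinarith

/-- The half-line with closed neighbourhoods of the poles removed. -/
def pvDomain (p b ε : ℝ) : Set ℝ := {x | 0 < x ∧ ∀ j : ℕ, 1 ≤ j → ε < |x - lam p j / b|}

theorem measurableSet_pvDomain (p b ε : ℝ) : MeasurableSet (pvDomain p b ε) := by
  have : pvDomain p b ε = Ioi 0 ∩ ⋂ j : ℕ, {x | 1 ≤ j → ε < |x - lam p j / b|} := by
    ext x; simp [pvDomain]
  rw [this]
  refine measurableSet_Ioi.inter (MeasurableSet.iInter fun j => ?_)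
  refine MeasurableSet.imp (MeasurableSet.const _) ?_
  exact measurableSet_lt measurable_const (by fun_prop)

/-- For ε below the uniform gap, poles of other blocks impose no condition: an earlier pole is at
least the gap away, a later one at least 1/(2b). -/
theorem mem_pvDomain_iff {p : ℝ} (hp : 0 < p) {b : ℝ} (hb : 0 < b) {ε : ℝ}
    (hε : ε < 1 / (2 * (Real.pi * p + 1)) / b) {j : ℕ} (hj : 1 ≤ j) {x : ℝ} (hx : 0 < x)
    (h1 : ((j : ℝ) - 1) / b < x) (h2 : x ≤ j / b) :
    x ∈ pvDomain p b ε ↔ ε < |x - lam p j / b| := by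
  have hpi := Real.pi_pos
  refine ⟨fun h => h.2 j hj, fun h => ⟨hx, fun k hk => ?_⟩⟩
  have hc2 : 1 / (2 * (Real.pi * p + 1)) ≤ 1 / 2 := by
    apply one_div_le_one_div_of_le (by norm_num)
    nlinarith [mul_pos hpi hp]
  set c := 1 / (2 * (Real.pi * p + 1))
  have hgap := lam_gap hp hk
  obtain ⟨h3, h4, -⟩ := lam_spec hp hk
  rw [div_lt_iff₀ hb] at h1
  rw [le_div_iff₀ hb] at h2
  rw [lt_div_iff₀ hb] at hε
  have e : x - lam p k / b = (x * b - lam p k) / b := by field_simp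
  rcases lt_trichotomy k j with hkj | rfl | hkj
  · have hkj' : (k : ℝ) + 1 ≤ j := by exact_mod_cast hkj
    rw [e, abs_div, abs_of_pos hb, lt_div_iff₀ hb]
    exact lt_of_lt_of_le (by linarith) (le_abs_self _)
  · exact h
  · have hkj' : (j : ℝ) + 1 ≤ k := by exact_mod_cast hkj
    rw [e, abs_div, abs_of_pos hb, lt_div_iff₀ hb]
    exact lt_of_lt_of_le (by linarith) (neg_le_abs _)

theorem integral_inv_sub {μ a c : ℝ} (h : μ ∉ uIcc a c) :
    ∫ x in a..c, ((x : ℂ) - μ)⁻¹ = (Real.log ((c - μ) / (a - μ)) : ℝ) := by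
  have h1 : ∀ x : ℝ, ((x : ℂ) - μ)⁻¹ = (((x - μ)⁻¹ : ℝ) : ℂ) := fun x => by push_cast; rfl
  simp only [h1]
  rw [intervalIntegral.integral_ofReal, intervalIntegral.integral_comp_sub_right (fun x => x⁻¹),
    integral_inv]
  intro h0
  apply h
  rw [mem_uIcc] at h0 ⊢
  rcases h0 with h0 | h0
  · left; constructor <;> linarith
  · right; constructor <;> linarith

/-- The principal value of the principal part on a block does not depend on the width of the
symmetric neighbourhood that is removed. -/
theorem integral_prin_block {p : ℝ} (hp : 0 < p) (n : ℂ) {b : ℝ} (hb : 0 < b) {ε : ℝ}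
    (hε0 : 0 < ε) (hε : ε < 1 / (2 * (Real.pi * p + 1)) / b) {j : ℕ} (hj : 1 ≤ j) :
    ∫ x in pvDomain p b ε ∩ Ioc (((j : ℝ) - 1) / b) (j / b), prin p n b x =
      res p n b j * logRatio p b j := by
  have hpi := Real.pi_pos
  have hc2 : 1 / (2 * (Real.pi * p + 1)) ≤ 1 / 2 := by
    apply one_div_le_one_div_of_le (by norm_num)
    nlinarith [mul_pos hpi hp]
  have hj1 : (1 : ℝ) ≤ j := by exact_mod_cast hj
  obtain ⟨h1, h2, -⟩ := lam_spec hp hj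
  have hgap := lam_gap hp hj
  have hεb := (lt_div_iff₀ hb).1 hε
  have hj0 : 0 ≤ ((j : ℝ) - 1) / b := div_nonneg (by linarith) hb.le
  have i1 : ((j : ℝ) - 1) / b < lam p j / b - ε := by
    rw [lt_sub_iff_add_lt, div_add' _ _ _ hb.ne', div_lt_div_iff_of_pos_right hb]; linarith
  have i2 : lam p j / b + ε < j / b := by
    rw [div_add' _ _ _ hb.ne', div_lt_div_iff_of_pos_right hb]; linarith
  set μ := lam p j / b with hμ
  set a := ((j : ℝ) - 1) / b with ha
  set c := (j : ℝ) / b with hc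
  have hset : pvDomain p b ε ∩ Ioc a c = Ioo a (μ - ε) ∪ Ioc (μ + ε) c := by
    ext x
    constructor
    · rintro ⟨hx, hx1, hx2⟩
      have := (mem_pvDomain_iff hp hb hε hj (hj0.trans_lt hx1) hx1 hx2).1 hx
      rcases lt_abs.1 this with h | h
      · right; exact ⟨by linarith, hx2⟩
      · left; exact ⟨hx1, by linarith⟩
    · intro hx
      have hx' : x ∈ Ioc a c ∧ ε < |x - μ| := by
        rcases hx with hx | hx
        · exact ⟨⟨hx.1, by linarith [hx.2]⟩, lt_abs.2 (Or.inr (by linarith [hx.2]))⟩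
        · exact ⟨⟨by linarith [hx.1], hx.2⟩, lt_abs.2 (Or.inl (by linarith [hx.1]))⟩
      exact ⟨(mem_pvDomain_iff hp hb hε hj (hj0.trans_lt hx'.1.1) hx'.1.1 hx'.1.2).2 hx'.2, hx'.1⟩
  have hcongr : ∫ x in Ioo a (μ - ε) ∪ Ioc (μ + ε) c, prin p n b x =
      ∫ x in Ioo a (μ - ε) ∪ Ioc (μ + ε) c, res p n b j * ((x : ℂ) - μ)⁻¹ := by
    apply setIntegral_congr_fun (measurableSet_Ioo.union measurableSet_Ioc)
    intro x hx
    rw [← hset] at hx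
    show prin p n b x = res p n b j * ((x : ℂ) - μ)⁻¹
    rw [← div_eq_mul_inv]
    exact prin_eq_of_mem p n hb hj hx.2.1 hx.2.2
  have n1 : μ ∉ uIcc a (μ - ε) := by
    rw [uIcc_of_le i1.le]; intro h; linarith [h.2]
  have n2 : μ ∉ uIcc (μ + ε) c := by
    rw [uIcc_of_le i2.le]; intro h; linarith [h.1]
  have hint : ∀ {u v : ℝ}, u ≤ v → μ ∉ uIcc u v →
      IntegrableOn (fun x : ℝ => res p n b j * ((x : ℂ) - μ)⁻¹) (Ioc u v) := by
    intro u v huv hn'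
    rw [← intervalIntegrable_iff_integrableOn_Ioc_of_le huv]
    apply ContinuousOn.intervalIntegrable
    refine ContinuousOn.mul continuousOn_const (ContinuousOn.inv₀ (by fun_prop) fun x hx h0 => ?_)
    rw [sub_eq_zero] at h0
    have : x = μ := by exact_mod_cast h0
    exact hn' (this ▸ hx)
  rw [hset, hcongr, setIntegral_union _ measurableSet_Ioc
      ((hint i1.le n1).mono_set Ioo_subset_Ioc_self) (hint i2.le n2),
    ← integral_Ioc_eq_integral_Ioo, ← intervalIntegral.integral_of_le i1.le,
    ← intervalIntegral.integral_of_le i2.le, intervalIntegral.integral_const_mul,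
    intervalIntegral.integral_const_mul, integral_inv_sub n1, integral_inv_sub n2, ← mul_add,
    ← Complex.ofReal_add, ← Real.log_mul, logRatio]
  · congr 3
    rw [← ha, ← hc, ← hμ]
    have d1 : a - μ ≠ 0 := by linarith
    have d2 : μ - a ≠ 0 := by linarith
    -- The arguments of the two logarithms are -ε/(a - μ) and (c - μ)/ε; in their product ε
    -- disappears.
    have d3 : μ - ε - μ = -ε := by ring
    have d4 : μ + ε - μ = ε := by ring
    rw [d3, d4]
    field_simp
    ring
  · exact div_ne_zero (by linarith) (by linarith)
  · exact div_ne_zero (by linarith) (by linarith)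
  · rw [disjoint_left]
    intro x hx hx'
    linarith [hx.2, hx'.1]

theorem integrableOn_prin {p : ℝ} (hp : 0 < p) {n : ℂ} (hn : 2 < n.re) {b : ℝ} (hb : 0 < b)
    {ε : ℝ} (hε : 0 < ε) : IntegrableOn (prin p n b) (pvDomain p b ε) := by
  obtain ⟨M, hM, h⟩ := norm_res_ceil_le hp hn hb
  have h0 : IntegrableOn (fun x : ℝ => M / ε * Real.exp (-x)) (Ioi 0) :=
    (integrableOn_exp_neg_Ioi 0).const_mul _
  have h1 : IntegrableOn (fun x : ℝ => M / ε * Real.exp (-x)) (pvDomain p b ε) :=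
    h0.mono_set fun x hx => hx.1
  refine h1.mono' (measurable_prin p n b).aestronglyMeasurable ?_
  refine (ae_restrict_mem (measurableSet_pvDomain p b ε)).mono fun x hx => ?_
  have h2 := hx.2 _ (lam_ceil hp hb hx.1).1
  unfold prin
  rw [norm_div, ← Complex.ofReal_sub, Complex.norm_real, Real.norm_eq_abs, div_mul_eq_mul_div]
  exact div_le_div₀ (by positivity) (h x hx.1) hε h2.le

theorem hasSum_integral_prin {p : ℝ} (hp : 0 < p) {n : ℂ} (hn : 2 < n.re) {b : ℝ} (hb : 0 < b)
    {ε : ℝ} (hε0 : 0 < ε) (hε : ε < 1 / (2 * (Real.pi * p + 1)) / b) :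
    HasSum (fun j : ℕ => res p n b (j + 1) * logRatio p b (j + 1))
      (∫ x in pvDomain p b ε, prin p n b x) := by
  set s : ℕ → Set ℝ := fun j =>
    pvDomain p b ε ∩ Ioc ((((j + 1 : ℕ) : ℝ) - 1) / b) ((j + 1 : ℕ) / b) with hs
  have hU : ⋃ j, s j = pvDomain p b ε := by
    refine Subset.antisymm (iUnion_subset fun j => inter_subset_left) fun x hx => ?_
    obtain ⟨h1, h2, h3, -⟩ := lam_ceil hp hb hx.1
    obtain ⟨k, hk⟩ : ∃ k, ⌈b * x⌉₊ = k + 1 := ⟨⌈b * x⌉₊ - 1, by omega⟩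
    rw [hk] at h2 h3
    refine mem_iUnion.2 ⟨k, hx, ?_, ?_⟩
    · rw [div_lt_iff₀ hb]; linarith
    · rw [le_div_iff₀ hb]; linarith
  have hd : Pairwise (Function.onFun Disjoint s) := by
    intro i j hij
    rw [Function.onFun, disjoint_left]
    rintro x ⟨-, hx1, hx2⟩ ⟨-, hx3, hx4⟩
    have e1 := ceil_eq_of_mem hb (by omega) hx1 hx2
    have e2 := ceil_eq_of_mem hb (by omega) hx3 hx4
    omega
  have := hasSum_integral_iUnion (f := prin p n b) (μ := volume) (s := s)
    (fun j => (measurableSet_pvDomain p b ε).inter measurableSet_Ioc) hd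
    (by rw [hU]; exact integrableOn_prin hp hn hb hε0)
  rw [hU] at this
  have e : (fun j => ∫ x in s j, prin p n b x) = fun j => res p n b (j + 1) * logRatio p b (j + 1) :=
    funext fun j => integral_prin_block hp n hb hε0 hε (by omega)
  rwa [e] at this

/-- Dominated convergence: every point outside the countable set of poles eventually belongs to the
truncated domain. -/
theorem tendsto_integral_reg {p : ℝ} (hp : 0 < p) {n : ℂ} (hn : 2 < n.re) {b : ℝ} (hb : 0 < b) :
    Tendsto (fun ε : ℝ => ∫ x in pvDomain p b ε, reg p n b x) (𝓝[>] 0)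
      (𝓝 (∫ x in Ioi (0 : ℝ), reg p n b x)) := by
  have hsub : ∀ ε, pvDomain p b ε ⊆ Ioi 0 := fun ε x hx => hx.1
  have hi := integrableOn_reg hp hn hb
  have e : ∀ ε, ∫ x in pvDomain p b ε, reg p n b x =
      ∫ x in Ioi 0, (pvDomain p b ε).indicator (reg p n b) x := by
    intro ε
    rw [setIntegral_indicator (measurableSet_pvDomain p b ε), inter_eq_self_of_subset_right (hsub ε)]
  simp only [e]
  refine tendsto_integral_filter_of_dominated_convergence (fun x => ‖reg p n b x‖) ?_ ?_ hi.norm ?_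
  · exact Eventually.of_forall fun ε =>
      hi.aestronglyMeasurable.indicator (measurableSet_pvDomain p b ε)
  · exact Eventually.of_forall fun ε => Eventually.of_forall fun x =>
      norm_indicator_le_norm_self _ _
  · have hcount : (range fun j : ℕ => lam p j / b).Countable := countable_range _
    have hae : ∀ᵐ x ∂(volume.restrict (Ioi (0 : ℝ))), x ∉ range fun j : ℕ => lam p j / b :=
      ae_restrict_of_ae (hcount.ae_notMem _)
    filter_upwards [ae_restrict_mem measurableSet_Ioi, hae] with x hx hxp
    have hx0 : 0 < x := hx
    obtain ⟨h1, h2, h3, -⟩ := lam_ceil hp hb hx0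
    have hne : 0 < |x - lam p ⌈b * x⌉₊ / b| := by
      rw [abs_pos, sub_ne_zero]
      exact fun h => hxp ⟨_, h.symm⟩
    have hpi := Real.pi_pos
    apply tendsto_const_nhds.congr'
    filter_upwards [Ioo_mem_nhdsGT hne,
      Ioo_mem_nhdsGT (show 0 < 1 / (2 * (Real.pi * p + 1)) / b by positivity)] with ε he1 he2
    rw [indicator_of_mem]
    refine (mem_pvDomain_iff hp hb he2.2 h1 hx0 ?_ ?_).2 he1.2
    · rw [div_lt_iff₀ hb]; linarith
    · rw [le_div_iff₀ hb]; linarith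

theorem integrableOn_pvFun {p : ℝ} (hp : 0 < p) {n : ℂ} (hn : 2 < n.re) {b : ℝ} (hb : 0 < b)
    {ε : ℝ} (hε : 0 < ε) : IntegrableOn (fun x : ℝ => pvFun p n b x) (pvDomain p b ε) := by
  have h1 : IntegrableOn (reg p n b) (pvDomain p b ε) :=
    (integrableOn_reg hp hn hb).mono_set fun x hx => hx.1
  refine (h1.add (integrableOn_prin hp hn hb hε)).congr (Eventually.of_forall fun x => ?_)
  simp [reg]

/-- The principal parts contribute a constant S for all small ε, so the limit exists and equals ∫
`reg` + S. Letting N → ∞ in `finite_blocks` identifies this number: the arcs vanish and each block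
leaves its half residue. -/
theorem tendsto_integral_pvFun {p : ℝ} (hp : 0 < p) {n : ℂ} (hn : 2 < n.re) {b : ℝ} (hb : 0 < b)
    (hsum : Summable fun j : ℕ => res p n b (j + 1)) :
    Tendsto (fun ε : ℝ => ∫ x in pvDomain p b ε, pvFun p n b x) (𝓝[>] 0)
      (𝓝 (rayInt p n b (Real.pi / 4) + Real.pi * Complex.I * ∑' j : ℕ, res p n b (j + 1))) := by
  have hpi := Real.pi_pos
  have hc : 0 < 1 / (2 * (Real.pi * p + 1)) / b := by positivity
  set c := 1 / (2 * (Real.pi * p + 1)) / b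
  -- Half the gap is just one admissible ε; uniqueness of sums transfers S to the others.
  have hS := hasSum_integral_prin hp hn hb (half_pos hc) (half_lt_self hc)
  set S := ∫ x in pvDomain p b (c / 2), prin p n b x
  have h1 : Tendsto (fun ε : ℝ => ∫ x in pvDomain p b ε, pvFun p n b x) (𝓝[>] 0)
      (𝓝 ((∫ x in Ioi (0 : ℝ), reg p n b x) + S)) := by
    refine ((tendsto_integral_reg hp hn hb).add_const S).congr' ?_
    filter_upwards [Ioo_mem_nhdsGT hc] with ε hε
    rw [hS.unique (hasSum_integral_prin hp hn hb hε.1 hε.2)]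
    rw [← integral_add ((integrableOn_reg hp hn hb).mono_set fun x hx => hx.1)
      (integrableOn_prin hp hn hb hε.1)]
    congr 1
    ext x
    simp [reg]
  have hNb : Tendsto (fun N : ℕ => ((N + 1 : ℕ) : ℝ) / b) atTop atTop :=
    (tendsto_natCast_atTop_atTop.comp (tendsto_add_atTop_nat 1)).atTop_div_const hb
  have l1 : Tendsto (fun N : ℕ => ∫ x in (0 : ℝ)..((N + 1 : ℕ) / b), reg p n b x) atTop
      (𝓝 (∫ x in Ioi (0 : ℝ), reg p n b x)) :=
    intervalIntegral_tendsto_integral_Ioi 0 (integrableOn_reg hp hn hb) hNb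
  have l2 : Tendsto (fun N : ℕ => ∑ j ∈ Finset.range (N + 1), res p n b (j + 1) *
      (logRatio p b (j + 1) - Real.pi * Complex.I)) atTop
      (𝓝 (S - Real.pi * Complex.I * ∑' j : ℕ, res p n b (j + 1))) := by
    have h2 := (hS.sub (hsum.hasSum.mul_left (Real.pi * Complex.I))).tendsto_sum_nat
    refine (h2.comp (tendsto_add_atTop_nat 1)).congr fun N => ?_
    exact Finset.sum_congr rfl fun j _ => by ring
  have l3 : Tendsto (fun N : ℕ => rayUpTo p n b ((N + 1 : ℕ) / b)) atTop
      (𝓝 (rayInt p n b (Real.pi / 4))) :=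
    (aecover_Iic (Real.tendsto_log_atTop.comp hNb)).integral_tendsto_of_countably_generated
      (integrable_pvExp hp hn hb abs_pi_div_four)
  have l4 : Tendsto (fun N : ℕ => arcInt p n b ((N + 1 : ℕ) / b)) atTop (𝓝 0) :=
    (tendsto_arcInt_atTop hp hn hb).comp (tendsto_add_atTop_nat 1)
  have key := tendsto_nhds_unique ((l1.add l2).congr (finite_blocks hp hn hb)) (l3.sub l4)
  have : rayInt p n b (Real.pi / 4) + Real.pi * Complex.I * ∑' j : ℕ, res p n b (j + 1) =
      (∫ x in Ioi (0 : ℝ), reg p n b x) + S := by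
    linear_combination -key
  rw [this]
  exact h1

/-! ### Koshliakov's zeta function as a Mellin transform -/

theorem kerMellin_eq_integral (p : ℝ) (n : ℂ) :
    kerMellin p n = ∫ x in Ioi (0 : ℝ), kerPow p n x := by
  have h := integral_image_eq_integral_abs_deriv_smul (s := univ) MeasurableSet.univ
    (fun x _ => (Real.hasDerivAt_exp x).hasDerivWithinAt) Real.exp_injective.injOn
    (fun x : ℝ => kerPow p n x)
  rw [image_univ, Real.range_exp, setIntegral_univ] at h
  rw [h, kerMellin]
  congr 1
  ext x
  have e : Complex.exp (n * x) = Complex.exp x ^ (n - 1) * Complex.exp x := by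
    rw [Complex.cpow_def_of_ne_zero (Complex.exp_ne_zero _), ← Complex.ofReal_exp,
      ← Complex.ofReal_log (Real.exp_pos x).le, Real.log_exp, Complex.ofReal_exp, ← Complex.exp_add]
    ring_nf
  rw [abs_of_pos (Real.exp_pos x), Complex.real_smul, kerExp, kerPow, e, Complex.ofReal_exp]
  ring

/-- The ratio of the geometric series that expands `1 / (σ(z) e^{2πz} - 1)`. -/
noncomputable def geomRatio (p x : ℝ) : ℝ := Real.exp (-(2 * Real.pi * x)) * ((p - x) / (p + x))

theorem abs_geomRatio_le {p x : ℝ} (hp : 0 < p) (hx : 0 < x) :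
    |geomRatio p x| ≤ Real.exp (-(2 * Real.pi * x)) := by
  rw [geomRatio, abs_mul, abs_of_pos (Real.exp_pos _), abs_div, abs_of_pos (add_pos hp hx)]
  refine mul_le_of_le_one_right (Real.exp_pos _).le ?_
  rw [div_le_one (add_pos hp hx), abs_le]
  constructor <;> linarith

theorem hasSum_geomRatio {p x : ℝ} (hp : 0 < p) (hx : 0 < x) :
    HasSum (fun k : ℕ => ((geomRatio p x : ℝ) : ℂ) ^ (k + 1)) (kerC p x) := by
  have hpi := Real.pi_pos
  have h1 : |geomRatio p x| < 1 := (abs_geomRatio_le hp hx).trans_lt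
    (Real.exp_zero ▸ Real.exp_lt_exp.2 (by have := mul_pos hpi hx; linarith))
  have h2 : ‖((geomRatio p x : ℝ) : ℂ)‖ < 1 := by rwa [Complex.norm_real]
  have h3 := (hasSum_geometric_of_norm_lt_one h2).mul_left ((geomRatio p x : ℝ) : ℂ)
  have h4 : kerC p x = ((geomRatio p x : ℝ) : ℂ) * (1 - ((geomRatio p x : ℝ) : ℂ))⁻¹ := by
    have hpx : (p : ℂ) + x ≠ 0 := by
      rw [← Complex.ofReal_add]; exact_mod_cast (add_pos hp hx).ne'
    have hd : den p x ≠ 0 := den_ne_zero hp (by simpa using hx)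
    have hE : Complex.exp (2 * Real.pi * x) ≠ 0 := Complex.exp_ne_zero _
    have hq : ((geomRatio p x : ℝ) : ℂ) = (p - x) / ((p + x) * Complex.exp (2 * Real.pi * x)) := by
      unfold geomRatio
      push_cast
      rw [Complex.exp_neg]
      field_simp
    have hq1 : 1 - ((geomRatio p x : ℝ) : ℂ) = den p x /
        ((p + x) * Complex.exp (2 * Real.pi * x)) := by
      rw [hq, den]; field_simp
    rw [hq1, hq, kerC, inv_div, div_mul_div_cancel₀ (mul_ne_zero hpx hE)]
  rw [h4]
  refine h3.congr_fun fun k => ?_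
  rw [pow_succ']

/-- The substitution x ↦ 2πkx turns (2πpk - x)/(2πpk + x) into (p - x)/(p + x), so e^{-x} and the
quotient merge into a k-th power. -/
theorem etaTerm_eq {p : ℝ} (n : ℂ) {k : ℕ} (hk : 1 ≤ k) :
    etaTerm p n k = (2 * Real.pi) ^ n / Complex.Gamma n *
      ∫ x in Ioi (0 : ℝ), (x : ℂ) ^ (n - 1) * ((geomRatio p x : ℝ) : ℂ) ^ k := by
  have hpi := Real.pi_pos
  have hk0 : (0 : ℝ) < k := by exact_mod_cast hk
  have hc : 0 < 2 * Real.pi * k := by positivity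
  have hkC : (k : ℂ) ≠ 0 := by exact_mod_cast hk0.ne'
  have hcC : ((2 * Real.pi * k : ℝ) : ℂ) ≠ 0 := by exact_mod_cast hc.ne'
  have h := integral_comp_mul_left_Ioi (fun x : ℝ => Complex.exp (-x) *
    (((2 * Real.pi * p * k - x) / (2 * Real.pi * p * k + x) : ℝ) : ℂ) ^ k * (x : ℂ) ^ (n - 1)) 0 hc
  rw [mul_zero] at h
  have h2 : ∫ x in Ioi (0 : ℝ), Complex.exp (-x) *
      (((2 * Real.pi * p * k - x) / (2 * Real.pi * p * k + x) : ℝ) : ℂ) ^ k * (x : ℂ) ^ (n - 1) =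
      ((2 * Real.pi * k : ℝ) : ℂ) ^ n *
        ∫ x in Ioi (0 : ℝ), (x : ℂ) ^ (n - 1) * ((geomRatio p x : ℝ) : ℂ) ^ k := by
    rw [eq_inv_smul_iff₀ hc.ne'] at h
    rw [← h, Complex.real_smul, ← integral_const_mul, ← integral_const_mul]
    refine setIntegral_congr_fun measurableSet_Ioi fun x hx => ?_
    have hx0 : (0 : ℝ) < x := hx
    have e1 : (2 * Real.pi * p * k - 2 * Real.pi * k * x) /
        (2 * Real.pi * p * k + 2 * Real.pi * k * x) = (p - x) / (p + x) := by
      rw [← mul_div_mul_left (p - x) (p + x) hc.ne']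
      ring_nf
    have e2 : ((2 * Real.pi * k : ℝ) : ℂ) ^ n =
        ((2 * Real.pi * k : ℝ) : ℂ) ^ (n - 1) * ((2 * Real.pi * k : ℝ) : ℂ) := by
      rw [Complex.cpow_sub _ _ hcC, Complex.cpow_one, div_mul_cancel₀ _ hcC]
    have e3 : Complex.exp (-((2 * Real.pi * k * x : ℝ) : ℂ)) =
        ((Real.exp (-(2 * Real.pi * x)) : ℝ) : ℂ) ^ k := by
      rw [← Complex.ofReal_pow, ← Real.exp_nat_mul, Complex.ofReal_exp]
      push_cast
      ring_nf
    simp only [e1, e3]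
    rw [Complex.ofReal_mul (2 * Real.pi * k) x, Complex.mul_cpow_ofReal_nonneg hc.le hx0.le, e2,
      geomRatio, Complex.ofReal_mul (Real.exp _), mul_pow]
    ring
  have h3 : ((2 * Real.pi * k : ℝ) : ℂ) ^ n = (2 * Real.pi) ^ n * (k : ℂ) ^ n := by
    rw [Complex.ofReal_mul, Complex.mul_cpow_ofReal_nonneg (by positivity) hk0.le]
    push_cast
    rfl
  have hkn : (k : ℂ) ^ n ≠ 0 := by rw [Complex.cpow_ne_zero_iff]; exact Or.inl hkC
  rw [etaTerm, etaCoeff, h2, h3]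
  field_simp

/-- Sum and integral may be exchanged because the k-th integral of norms is at most Γ(Re
n)/(2πk)^{Re n}, summable for Re n > 1. -/
theorem hasSum_integral_geomRatio {p : ℝ} (hp : 0 < p) {n : ℂ} (hn : 1 < n.re) :
    HasSum (fun k : ℕ => ∫ x in Ioi (0 : ℝ),
      (x : ℂ) ^ (n - 1) * ((geomRatio p x : ℝ) : ℂ) ^ (k + 1)) (kerMellin p n) := by
  have hpi := Real.pi_pos
  have hbound : ∀ k : ℕ, ∀ x : ℝ, 0 < x →
      ‖(x : ℂ) ^ (n - 1) * ((geomRatio p x : ℝ) : ℂ) ^ (k + 1)‖ ≤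
        x ^ (n.re - 1) * Real.exp (-((2 * Real.pi * (k + 1)) * x)) := by
    intro k x hx
    rw [norm_mul, norm_pow, Complex.norm_real, Complex.norm_cpow_eq_rpow_re_of_pos hx,
      Complex.sub_re, Complex.one_re]
    refine mul_le_mul_of_nonneg_left ?_ (by positivity)
    calc _ ≤ Real.exp (-(2 * Real.pi * x)) ^ (k + 1) :=
          pow_le_pow_left₀ (abs_nonneg _) (abs_geomRatio_le hp hx) _
      _ = _ := by rw [← Real.exp_nat_mul]; push_cast; ring_nf
  have hint : ∀ k : ℕ, IntegrableOn
      (fun x : ℝ => x ^ (n.re - 1) * Real.exp (-((2 * Real.pi * (k + 1)) * x))) (Ioi 0) := by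
    intro k
    refine Integrable.of_integral_ne_zero ?_
    rw [Real.integral_rpow_mul_exp_neg_mul_Ioi (by linarith) (by positivity)]
    exact (mul_pos (by positivity) (Real.Gamma_pos_of_pos (by linarith))).ne'
  have hmeas : ∀ k : ℕ, Measurable
      fun x : ℝ => (x : ℂ) ^ (n - 1) * ((geomRatio p x : ℝ) : ℂ) ^ (k + 1) := by
    intro k
    unfold geomRatio
    fun_prop
  have hint' : ∀ k : ℕ, IntegrableOn
      (fun x : ℝ => (x : ℂ) ^ (n - 1) * ((geomRatio p x : ℝ) : ℂ) ^ (k + 1)) (Ioi 0) := fun k =>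
    (hint k).mono' (hmeas k).aestronglyMeasurable
      ((ae_restrict_mem measurableSet_Ioi).mono fun x hx => hbound k x hx)
  have hsum : Summable fun k : ℕ => ∫ x in Ioi (0 : ℝ),
      ‖(x : ℂ) ^ (n - 1) * ((geomRatio p x : ℝ) : ℂ) ^ (k + 1)‖ := by
    refine Summable.of_nonneg_of_le (fun k => integral_nonneg fun x => norm_nonneg _)
      (fun k => ?_) (f := fun k : ℕ => (1 / (2 * Real.pi)) ^ n.re * Real.Gamma n.re *
        (1 / ((k + 1 : ℕ) : ℝ) ^ n.re)) ?_
    · refine (setIntegral_mono_on (hint' k).norm (hint k) measurableSet_Ioi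
        fun x hx => hbound k x hx).trans (le_of_eq ?_)
      rw [Real.integral_rpow_mul_exp_neg_mul_Ioi (by linarith) (by positivity)]
      push_cast
      rw [← one_div_mul_one_div, Real.mul_rpow (by positivity) (by positivity),
        Real.div_rpow zero_le_one (by positivity : (0 : ℝ) ≤ k + 1), Real.one_rpow]
      ring
    · exact (((summable_nat_add_iff 1).2 (Real.summable_one_div_nat_rpow.2 hn)).mul_left _)
  have h := hasSum_integral_of_summable_integral_norm hint' hsum
  rw [kerMellin_eq_integral]
  convert! h using 1
  refine setIntegral_congr_fun measurableSet_Ioi fun x hx => ?_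
  exact ((hasSum_geomRatio hp hx).mul_left _).tsum_eq.symm

theorem hasSum_etaTerm {p : ℝ} (hp : 0 < p) {n : ℂ} (hn : 1 < n.re) :
    HasSum (fun k : ℕ => etaTerm p n (k + 1))
      ((2 * Real.pi) ^ n / Complex.Gamma n * kerMellin p n) := by
  refine ((hasSum_integral_geomRatio hp hn).mul_left _).congr_fun fun k => ?_
  exact etaTerm_eq n (by omega)

theorem Gamma_mul_eta {p : ℝ} (hp : 0 < p) {n : ℂ} (hn : 1 < n.re) :
    Complex.Gamma n * eta p n / (2 * Real.pi) ^ n = kerMellin p n := by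
  have h1 : Complex.Gamma n ≠ 0 := Complex.Gamma_ne_zero_of_re_pos (by linarith)
  have hpi : (2 * Real.pi : ℂ) ≠ 0 := by
    exact_mod_cast (mul_pos two_pos Real.pi_pos).ne'
  have h2 : (2 * Real.pi : ℂ) ^ n ≠ 0 := by
    rw [Complex.cpow_ne_zero_iff]; exact Or.inl hpi
  rw [eta, (hasSum_etaTerm hp hn).tsum_eq]
  field_simp

/-! ### Residue series, conjugation and the final elimination -/

theorem summable_res {p : ℝ} (hp : 0 < p) {n : ℂ} (hn : 2 < n.re) {b : ℝ} (hb : 0 < b) :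
    Summable fun j : ℕ => res p n b (j + 1) := by
  obtain ⟨M, hM, h⟩ := norm_kerPow_le_exp hp hn
  have hq : Summable fun j : ℕ => 1 / b * (M * Real.exp (j * -(1 / b))) :=
    ((Real.summable_exp_nat_mul_iff.2 (by
      have : 0 < 1 / b := by positivity
      linarith)).mul_left M).mul_left _
  refine Summable.of_norm_bounded hq fun j => (norm_res hp n hb _).trans ?_
  have hl := (lam_spec hp (show 1 ≤ j + 1 by omega)).1
  have hμ : 0 < lam p (j + 1) / b := div_pos (lam_pos hp (by omega)) hb
  have h1 := h (lam p (j + 1) / b : ℝ) (by simpa using hμ) (by simpa using hμ.le)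
  refine mul_le_mul_of_nonneg_left (h1.trans ?_) (by positivity)
  refine mul_le_mul_of_nonneg_left (Real.exp_le_exp.2 ?_) hM.le
  rw [Complex.ofReal_re, mul_neg, neg_le_neg_iff, mul_one_div]
  refine div_le_div_of_nonneg_right ?_ hb.le
  push_cast at hl
  linarith

/-- The residues in terms of the series at the parameter `2π / b`. -/
theorem res_eq_seriesTerm {p : ℝ} (hp : 0 < p) (n : ℂ) {b α : ℝ} (hb : 0 < b)
    (hα : α * b = 2 * Real.pi) {j : ℕ} (hj : 1 ≤ j) :
    Real.pi * Complex.I * res p n b j =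
      Complex.exp (-(n * Real.log b)) * seriesTerm p α n j := by
  have hpi : (Real.pi : ℂ) ≠ 0 := by exact_mod_cast Real.pi_ne_zero
  have hbC : (b : ℂ) ≠ 0 := by exact_mod_cast hb.ne'
  have hl := lam_pos hp hj
  have e1 : α * lam p j / (2 * Real.pi) = lam p j / b := by
    rw [div_eq_div_iff (by have := Real.pi_pos; positivity) hb.ne', ← hα]; ring
  have e2 : ((lam p j / b : ℝ) : ℂ) ^ (n - 1) =
      (lam p j : ℂ) ^ (n - 1) * (b * Complex.exp (-(n * Real.log b))) := by
    have h3 : (b : ℂ) * Complex.exp (-(n * Real.log b)) = ((b⁻¹ : ℝ) : ℂ) ^ (n - 1) := by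
      rw [Complex.cpow_def_of_ne_zero (by exact_mod_cast (inv_pos.2 hb).ne'),
        ← Complex.ofReal_log (inv_pos.2 hb).le, Real.log_inv]
      nth_rewrite 1 [← Real.exp_log hb]
      rw [Complex.ofReal_exp, ← Complex.exp_add]
      push_cast
      ring_nf
    rw [h3, div_eq_mul_inv, Complex.ofReal_mul,
      Complex.mul_cpow_ofReal_nonneg hl.le (inv_pos.2 hb).le]
  rw [seriesTerm, e1, kernel_eq_kerC, res, e2]
  field_simp
  linear_combination (-(weight p j : ℂ) * (lam p j : ℂ) ^ (n - 1) *
    kerC p ((lam p j / b : ℝ) : ℂ)) * Complex.I_sq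

theorem conj_ofReal_cpow {x : ℝ} (hx : 0 < x) (n : ℂ) :
    (starRingEnd ℂ) ((x : ℂ) ^ ((starRingEnd ℂ) n - 1)) = (x : ℂ) ^ (n - 1) := by
  have h : Complex.arg x ≠ Real.pi := by
    rw [Complex.arg_ofReal_of_nonneg hx.le]; exact Real.pi_pos.ne
  have e : (starRingEnd ℂ) n - 1 = (starRingEnd ℂ) (n - 1) := by simp
  rw [e, Complex.cpow_conj _ _ h, Complex.conj_ofReal, Complex.conj_conj]

/-- For real x conjugation sends ibx to -ibx, and oddness of `cothC` gives the minus sign; n is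
conjugated too because of the power. -/
theorem pvFun_conj {p : ℝ} (n : ℂ) (b : ℝ) {x : ℝ} (hx : 0 < x) :
    (starRingEnd ℂ) (pvFun p ((starRingEnd ℂ) n) b x) = -pvFun p n b x := by
  have e : (starRingEnd ℂ) (Complex.I * b * x) = -(Complex.I * b * x) := by simp
  unfold pvFun
  rw [map_mul, map_mul, conj_ofReal_cpow hx, ← kerC_conj, ← cothC_conj, e, cothC_neg,
    Complex.conj_ofReal]
  ring

theorem res_conj {p : ℝ} (hp : 0 < p) (n : ℂ) {b : ℝ} (hb : 0 < b) {j : ℕ} (hj : 1 ≤ j) :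
    (starRingEnd ℂ) (res p ((starRingEnd ℂ) n) b j) = -res p n b j := by
  unfold res
  rw [map_mul, map_mul, map_mul, conj_ofReal_cpow (div_pos (lam_pos hp hj) hb), ← kerC_conj,
    Complex.conj_ofReal]
  simp
  ring

theorem rayInt_conj (p : ℝ) (n : ℂ) (b φ : ℝ) :
    (starRingEnd ℂ) (rayInt p ((starRingEnd ℂ) n) b φ) = -rayInt p n b (-φ) := by
  unfold rayInt
  rw [← integral_conj, ← integral_neg]
  congr 1
  ext x
  have e : (starRingEnd ℂ) ((x : ℂ) + φ * Complex.I) = x + ((-φ : ℝ) : ℂ) * Complex.I := by simp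
  have e2 : (starRingEnd ℂ) (Complex.I * b * Complex.exp (x + φ * Complex.I)) =
      -(Complex.I * b * Complex.exp (x + ((-φ : ℝ) : ℂ) * Complex.I)) := by
    rw [map_mul, map_mul, ← Complex.exp_conj, e]; simp
  unfold pvExp kerExp
  rw [map_mul, map_mul, ← Complex.exp_conj, ← kerC_conj, ← cothC_conj, e2, cothC_neg, map_mul,
    Complex.conj_conj, ← Complex.exp_conj, e]
  ring

/-- The principal value in terms of the integral below the real axis. -/
theorem tendsto_integral_pvFun_below {p : ℝ} (hp : 0 < p) {n : ℂ} (hn : 2 < n.re) {b : ℝ}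
    (hb : 0 < b) :
    Tendsto (fun ε : ℝ => ∫ x in pvDomain p b ε, pvFun p n b x) (𝓝[>] 0)
      (𝓝 (rayInt p n b (-(Real.pi / 4)) -
        Real.pi * Complex.I * ∑' j : ℕ, res p n b (j + 1))) := by
  have hn' : 2 < ((starRingEnd ℂ) n).re := by simpa using hn
  -- The formula above the axis is applied to the conjugate of n and then conjugated; this reflects
  -- the ray and reverses the sign of the half residues.
  have h := ((Complex.continuous_conj.tendsto _).comp
    (tendsto_integral_pvFun hp hn' hb (summable_res hp hn' hb))).neg
  have e : -(starRingEnd ℂ) (rayInt p ((starRingEnd ℂ) n) b (Real.pi / 4) +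
      Real.pi * Complex.I * ∑' j : ℕ, res p ((starRingEnd ℂ) n) b (j + 1)) =
      rayInt p n b (-(Real.pi / 4)) - Real.pi * Complex.I * ∑' j : ℕ, res p n b (j + 1) := by
    rw [map_add, rayInt_conj, map_mul, Complex.conj_tsum,
      tsum_congr fun j : ℕ => res_conj hp n hb (show 1 ≤ j + 1 by omega), tsum_neg]
    simp
    ring
  rw [e] at h
  refine h.congr fun ε => ?_
  simp only [Function.comp_apply]
  rw [← integral_conj, ← integral_neg]
  refine setIntegral_congr_fun (measurableSet_pvDomain p b ε) fun x hx => ?_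
  rw [pvFun_conj n b hx.1, neg_neg]

theorem setOf_pvPoles_eq_pvDomain (p β ε : ℝ) :
    {x : ℝ | 0 < x ∧ ∀ s ∈ pvPoles p β, ε < |x - s|} = pvDomain p (β / (2 * Real.pi)) ε := by
  have e : ∀ j, 2 * Real.pi * lam p j / β = lam p j / (β / (2 * Real.pi)) := fun j => by
    rw [div_div_eq_mul_div]; ring
  ext x
  constructor
  · rintro ⟨h1, h2⟩
    exact ⟨h1, fun j hj => h2 _ ⟨j, hj, (e j).symm⟩⟩
  · rintro ⟨h1, h2⟩
    refine ⟨h1, ?_⟩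
    rintro s ⟨j, hj, rfl⟩
    rw [e]
    exact h2 j hj

theorem tsum_res {p : ℝ} (hp : 0 < p) (n : ℂ) {b α : ℝ} (hb : 0 < b)
    (hα : α * b = 2 * Real.pi) :
    Real.pi * Complex.I * ∑' j : ℕ, res p n b (j + 1) =
      Complex.exp (-(n * Real.log b)) * ∑' j : ℕ, seriesTerm p α n (j + 1) := by
  rw [← tsum_mul_left, ← tsum_mul_left]
  exact tsum_congr fun j => res_eq_seriesTerm hp n hb hα (by omega)

theorem summable_seriesTerm {p : ℝ} (hp : 0 < p) {α : ℝ} (hα : 0 < α) {n : ℂ} (hn : 2 < n.re) :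
    Summable fun j : ℕ => seriesTerm p α n (j + 1) := by
  have hpi := Real.pi_pos
  have hb : 0 < 2 * Real.pi / α := by positivity
  have h := (summable_res hp hn hb).mul_left (Real.pi * Complex.I)
  rw [funext fun j : ℕ => res_eq_seriesTerm hp n hb (mul_div_cancel₀ (2 * Real.pi) hα.ne')
    (show 1 ≤ j + 1 by omega)] at h
  exact (summable_mul_left_iff (Complex.exp_ne_zero _)).1 h

/-- With b = β/(2π) the relation αβ = 4π² says α = b^{-2}β, so the prefactors differ by b^{-n}. -/
theorem cpow_half_eq {α β : ℝ} (hα : 0 < α) (hβ : 0 < β) (hαβ : α * β = 4 * Real.pi ^ 2) (n : ℂ) :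
    (α : ℂ) ^ (n / 2) =
      Complex.exp (-(n * Real.log (β / (2 * Real.pi)))) * (β : ℂ) ^ (n / 2) := by
  have hpi := Real.pi_pos
  have h : Real.log α = -2 * Real.log (β / (2 * Real.pi)) + Real.log β := by
    have e : α = (β / (2 * Real.pi)) ^ (-2 : ℤ) * β := by
      rw [zpow_neg, eq_comm]
      field_simp
      linear_combination -hαβ
    nth_rewrite 1 [e]
    rw [Real.log_mul (by positivity) hβ.ne', Real.log_zpow]
    push_cast
    ring
  rw [Complex.cpow_def_of_ne_zero (by exact_mod_cast hα.ne'),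
    Complex.cpow_def_of_ne_zero (by exact_mod_cast hβ.ne'), ← Complex.exp_add,
    ← Complex.ofReal_log hα.le, ← Complex.ofReal_log hβ.le, h]
  push_cast
  ring_nf

theorem exists_hasPVIntegral {p α β : ℝ} (hp : 0 < p) (hα : 0 < α) (hβ : 0 < β)
    (hαβ : α * β = 4 * Real.pi ^ 2) {n : ℂ} (hn : 2 < n.re) :
    ∃ I : ℂ,
      HasPVIntegral (pvIntegrand p β n) (pvPoles p β) I ∧
      (α : ℂ) ^ (n / 2) *
          (Complex.Gamma n * eta p n / (2 * Real.pi) ^ n +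
            Complex.cos (Real.pi * n / 2) *
              ∑' j : ℕ, seriesTerm p α n (j + 1)) =
        (β : ℂ) ^ (n / 2) *
          (Complex.cos (Real.pi * n / 2) *
              (Complex.Gamma n * eta p n / (2 * Real.pi) ^ n) +
            ∑' j : ℕ, seriesTerm p β n (j + 1) -
            Complex.I * Complex.sin (Real.pi * n / 2) * I) := by
  have hpi := Real.pi_pos
  have hb : 0 < β / (2 * Real.pi) := by positivity
  have hαb : α * (β / (2 * Real.pi)) = 2 * Real.pi := by
    field_simp; linear_combination hαβ
  have hβb : β * (β / (2 * Real.pi))⁻¹ = 2 * Real.pi := by field_simp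
  rw [Gamma_mul_eta hp (by linarith), cpow_half_eq hα hβ hαβ]
  have hf : pvIntegrand p β n = fun z : ℝ => pvFun p n (β / (2 * Real.pi)) z :=
    funext fun z => pvIntegrand_eq_pvFun hp β n z
  have hlim := tendsto_integral_pvFun hp hn hb (summable_res hp hn hb)
  have hset := setOf_pvPoles_eq_pvDomain p β
  have hpv : ∀ J, Tendsto (fun ε : ℝ => ∫ x in pvDomain p (β / (2 * Real.pi)) ε,
      pvFun p n (β / (2 * Real.pi)) x) (𝓝[>] 0) (𝓝 J) →
      HasPVIntegral (pvIntegrand p β n) (pvPoles p β) J := by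
    intro J hJ
    unfold HasPVIntegral
    simp only [hset, hf]
    exact ⟨eventually_mem_nhdsWithin.mono fun ε hε => integrableOn_pvFun hp hn hb hε, hJ⟩
  refine ⟨_, hpv _ hlim, ?_⟩
  -- Equating the two evaluations of the principal value, for b and for 1/b, gives one linear
  -- relation each; the functional equation gives two more.
  have hJ := tendsto_nhds_unique hlim (tendsto_integral_pvFun_below hp hn hb)
  have hJ' := tendsto_nhds_unique
    (tendsto_integral_pvFun hp hn (inv_pos.2 hb) (summable_res hp hn (inv_pos.2 hb)))
    (tendsto_integral_pvFun_below hp hn (inv_pos.2 hb))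
  have h1 := rayInt_functional hp hn hb
  have h2 := rayInt_functional hp hn (inv_pos.2 hb)
  rw [tsum_res hp n hb hαb] at hJ ⊢
  rw [tsum_res hp n (inv_pos.2 hb) hβb] at hJ'
  rw [inv_inv] at h2
  rw [Real.log_inv, Complex.ofReal_neg, mul_neg, neg_neg] at hJ' h2
  rw [mul_assoc, mul_left_comm]
  congr 1
  rw [Complex.cos, Complex.sin]
  have e1 : Complex.exp (Real.pi * n / 2 * Complex.I) =
    Complex.exp (n * (Real.pi / 2 * Complex.I)) := by ring_nf
  have e2 : Complex.exp (-(Real.pi * n / 2) * Complex.I) =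
    Complex.exp (-(n * (Real.pi / 2 * Complex.I))) := by ring_nf
  rw [e1, e2]
  have hq : Complex.exp (n * (Real.pi / 2 * Complex.I)) *
      Complex.exp (-(n * (Real.pi / 2 * Complex.I))) = 1 := by
    rw [← Complex.exp_add]; simp
  have hr : Complex.exp (n * Real.log (β / (2 * Real.pi))) *
      Complex.exp (-(n * Real.log (β / (2 * Real.pi)))) = 1 := by
    rw [← Complex.exp_add]; simp
  generalize Complex.exp (n * (Real.pi / 2 * Complex.I)) = q at *
  generalize Complex.exp (-(n * (Real.pi / 2 * Complex.I))) = q' at *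
  generalize Complex.exp (n * Real.log (β / (2 * Real.pi))) = r' at *
  generalize Complex.exp (-(n * Real.log (β / (2 * Real.pi)))) = r at *
  generalize (∑' j : ℕ, seriesTerm p α n (j + 1)) = S at *
  generalize (∑' j : ℕ, seriesTerm p β n (j + 1)) = T at *
  generalize rayInt p n (β / (2 * Real.pi)) (Real.pi / 4) = R at *
  generalize rayInt p n (β / (2 * Real.pi)) (-(Real.pi / 4)) = R₁ at *
  generalize rayInt p n (β / (2 * Real.pi))⁻¹ (Real.pi / 4) = Q at *
  generalize rayInt p n (β / (2 * Real.pi))⁻¹ (-(Real.pi / 4)) = Q₁ at *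
  generalize kerMellin p n = A at *
  -- Here q and q' are e^{±iπn/2} and r = b^{-n}. The combination eliminates both lower ray
  -- integrals and the upper one for 1/b; the upper one for b survives only inside the principal
  -- value R + rS.
  linear_combination (1 / 2) * (q * hJ + q * h1 - r * hJ' - r * h2 - r * (A + Q) * hq +
    (2 * T + q' * (A + R)) * hr + (q' - q) * (R + r * S) * Complex.I_sq)

end Koshliakov

theorem mainTheorem2 (p α β : ℝ) (hp : 0 < p) (hα : 0 < α) (hβ : 0 < β)
    (hαβ : α * β = 4 * Real.pi ^ 2) (n : ℂ) (hn : 2 < n.re) :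
    Summable (fun k : ℕ => Koshliakov.etaTerm p n (k + 1)) ∧
    Summable (fun j : ℕ => Koshliakov.seriesTerm p α n (j + 1)) ∧
    Summable (fun j : ℕ => Koshliakov.seriesTerm p β n (j + 1)) ∧
    ∃ I : ℂ,
      Koshliakov.HasPVIntegral (Koshliakov.pvIntegrand p β n) (Koshliakov.pvPoles p β) I ∧
      (α : ℂ) ^ (n / 2) *
          (Complex.Gamma n * Koshliakov.eta p n / (2 * Real.pi) ^ n +
            Complex.cos (Real.pi * n / 2) *
              ∑' j : ℕ, Koshliakov.seriesTerm p α n (j + 1)) =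
        (β : ℂ) ^ (n / 2) *
          (Complex.cos (Real.pi * n / 2) *
              (Complex.Gamma n * Koshliakov.eta p n / (2 * Real.pi) ^ n) +
            ∑' j : ℕ, Koshliakov.seriesTerm p β n (j + 1) -
            Complex.I * Complex.sin (Real.pi * n / 2) * I) := by
  exact ⟨(Koshliakov.hasSum_etaTerm hp (by linarith)).summable,
    Koshliakov.summable_seriesTerm hp hα hn, Koshliakov.summable_seriesTerm hp hβ hn,
    Koshliakov.exists_hasPVIntegral hp hα hβ hαβ hn⟩
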